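/- **Setting.** Let $A\in\mathbb R^{n\times d}$ have singular values $\sigma_1(A)\ge\sigma_2(A)\ge\cdots$ (with $\sigma_i(A)=0$ for $i>\operatorname{rank}A$), let $b\in\mathbb R^n$, $\lambda>0$, $\gamma\in(0,1)$, $\epsilon,\delta\in(0,1)$. Put $\|x\|_M=\sqrt{x^\top Mx}$, $M_\lambda=A^\top A+\lambda I$, $\kappa_\lambda=\sigma_1(A)^2/\lambda$, $\mathrm{sr}(A)=\|A\|_F^2/\sigma_1(A)^2$, $N=\mathrm{nnz}(A)+n+d$ (so $N\le 3\,\mathrm{nnz}(A)$ if $A$ has no zero row and no zero column). Let $P_{A_\lambda}$ be the orthogonal projection onto the span of the eigenvectors of $A^\top A$ with eigenvalue $\ge\lambda$, $A_\lambda=AP_{A_\lambda}$, and $A_\lambda^+$ its Moore–Penrose pseudoinverse. A *ridge regression routine* for $(A,\lambda)$ is a randomized procedure (with discrete random choices, fresh in each call) $\textsc{ridge}(y,\epsilon,\delta)$ that for all $y\in\mathbb R^d$ and $\epsilon,\delta\in(0,1)$ returns, with probability at least $1-\delta$, a vector $\tilde x$ with $\|\tilde x-M_\lambda^{-1}y\|_{M_\lambda}\le\epsilon\|y\|_{M_\lambda^{-1}}$.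 Algorithm $\textsc{pc-proj}(y,\gamma,\epsilon,\delta)$, with constants $p_1,p_2$: put $q=\lceil p_1\gamma^{-2}\log(1/\epsilon)\rceil$, $\epsilon'=p_2^{-1}\epsilon^2\gamma^2/\sqrt{\kappa_\lambda}$, $\delta'=\delta/(2q+1)$; set $s:=\textsc{ridge}(A^\top Ay,\epsilon',\delta')$, $w:=s-\frac12y$; for $k=0,\dots,q-1$ set $t:=w-\textsc{ridge}(A^\top Aw,\epsilon',\delta')$, $w:=4\frac{2k+1}{2k+2}\textsc{ridge}(A^\top At,\epsilon',\delta')$, $s:=s+w$; return $s$. Algorithm $\textsc{ridge-pcr}$, with constants $c_1,c_2$: put $q=\lceil c_1\log(\kappa_\lambda/\epsilon)\rceil$, $\epsilon'=c_2^{-1}\epsilon/(q^2\sqrt{\kappa_\lambda})$, $\delta'=\delta/(2(q+1))$; set $y:=\textsc{pc-proj}(A^\top b,\gamma,\epsilon',\delta/2)$, $s_0:=\textsc{ridge}(y,\epsilon',\delta')$, $s:=s_0$; repeat $q$ times $s:=s_0+\lambda\,\textsc{ridge}(s,\epsilon',\delta')$; return $s$. Running times count steps on a machine with exact real arithmetic: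 a scalar operation costs one step, a vector operation the length of the vectors, a product with $A$ or $A^\top$ costs $\mathrm{nnz}(A)$ plus the length of the result, a random row of $A$ (drawn with probability proportional to its squared norm) costs $d$, up to additive constants, and each call of a ridge regression program pays $N$ for reading its input. The number $\kappa_\lambda$ is given to the algorithms. **Theorem.** Suppose that for some index $k\ge1$ $$\tfrac{1}{1-4\gamma}\,\sigma_{k+1}(A)^2\le\lambda\le(1-4\gamma)\,\sigma_k(A)^2 .$$ Let $p_1,c_1$ be at least some absolute constant, and let $p_2,c_2$ be sufficiently large in terms of $p_1,c_1$. The constants in $O(\cdot)$ below depend only on $p_1,p_2,c_1,c_2$. 1. For every ridge regression routine for $(A,\lambda)$, $\textsc{ridge-pcr}$ returns with probability at least $1-\delta$ a vector $s$ with $$\|s-A_\lambda^{+}b\|_{A^\top A}\le\epsilon\|b\|_2 .$$ It makes exactly one call to $\textsc{pc-proj}$ and $O(1+\log(\kappa_\lambda/\epsilon))$ ridge calls of its own, and $\textsc{pc-proj}$ makes $O(\gamma^{-2}(1+\log(\kappa_\lambda/\epsilon)))$ ridge calls. If every call $\textsc{ridge}(\cdot,\epsilon_0,\delta_0)$ takes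 time at most $T(\epsilon_0,\delta_0)$, the total time is $$O\bigl((1+\log(\kappa_\lambda/\epsilon))\,\bigl[T(\epsilon',\delta')+N+\gamma^{-2}\,(T(\epsilon'',\delta'')+N)\bigr]\bigr),$$ where $\epsilon',\delta'$ are the accuracy and failure rate of the ridge calls made by $\textsc{ridge-pcr}$ itself, and $\epsilon'',\delta''$ those of the ridge calls made inside $\textsc{pc-proj}$. 2. There is a deterministic ridge regression program (one program for all inputs) whose answers are always accurate and with which $\textsc{ridge-pcr}$ always returns $s$ with $\|s-A_\lambda^{+}b\|_{A^\top A}\le\epsilon\|b\|_2$, in total time $$O\bigl(N\sqrt{\kappa_\lambda}\;\gamma^{-2}\log^2(\kappa_\lambda/(\epsilon\gamma))\bigr).$$ 3. There is a randomized program (one program for all inputs) that is a ridge regression routine for $(A,\lambda)$ and with which $\textsc{ridge-pcr}$ always has total running time $$O\bigl((N+d\,\mathrm{sr}(A)\,\kappa_\lambda)\,\gamma^{-2}\log^2(\kappa_\lambda/(\epsilon\gamma\delta))\bigr).$$ -/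

import Mathlib

open Matrix

noncomputable section

namespace RidgePCR

/-! ### Linear algebra -/

/-- `nnz(A)`, the number of nonzero entries of `A`. -/
def nnz {n d : ℕ} (A : Matrix (Fin n) (Fin d) ℝ) : ℕ :=
  (Finset.univ.filter fun p : Fin n × Fin d => A p.1 p.2 ≠ 0).card

/-- The size of the input: the nonzero entries of `A` together with the two dimensions. -/
def inputSize {n d : ℕ} (A : Matrix (Fin n) (Fin d) ℝ) : ℕ := nnz A + n + d

/-- `σ_i(A)`, the `i`-th largest singular value, for `i = 1, 2, …`
(zero once `i` exceeds the rank of `A`). Mathlib counts singular values from `0`. -/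
def sigma {n d : ℕ} (A : Matrix (Fin n) (Fin d) ℝ) (i : ℕ) : ℝ :=
  (Matrix.toEuclideanLin A).singularValues (i - 1)

/-- The Euclidean norm of a vector. -/
def norm2 {m : ℕ} (x : Fin m → ℝ) : ℝ := ‖WithLp.toLp 2 x‖

/-- `‖x‖_M = √(xᵀ M x)`. -/
def matNorm {m : ℕ} (M : Matrix (Fin m) (Fin m) ℝ) (x : Fin m → ℝ) : ℝ :=
  √(x ⬝ᵥ (M *ᵥ x))

/-- The squared Frobenius norm. -/
def frobSq {n d : ℕ} (A : Matrix (Fin n) (Fin d) ℝ) : ℝ := ∑ i, ∑ j, A i j ^ 2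

/-- `κ_λ = σ₁(A)² / λ`. -/
def kappa {n d : ℕ} (A : Matrix (Fin n) (Fin d) ℝ) (lam : ℝ) : ℝ := sigma A 1 ^ 2 / lam

/-- The stable rank `‖A‖_F² / ‖A‖₂²`. -/
def stableRank {n d : ℕ} (A : Matrix (Fin n) (Fin d) ℝ) : ℝ := frobSq A / sigma A 1 ^ 2

theorem isHermitian_gram {n d : ℕ} (A : Matrix (Fin n) (Fin d) ℝ) : (Aᵀ * A).IsHermitian := by
  simpa [Matrix.conjTranspose_eq_transpose_of_trivial] using
    Matrix.isHermitian_conjTranspose_mul_self A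

/-- `f(AᵀA) = V diag(f(μ₁), …, f(μ_d)) Vᵀ`, where `AᵀA = V diag(μ₁, …, μ_d) Vᵀ`. -/
def gramFun {n d : ℕ} (f : ℝ → ℝ) (A : Matrix (Fin n) (Fin d) ℝ) : Matrix (Fin d) (Fin d) ℝ :=
  (isHermitian_gram A).cfc f

/-- The orthogonal projection onto the span of the principal components of `A` with squared
singular value at least `lam`: the step function at `lam`, applied to `AᵀA`. -/
def topProj {n d : ℕ} (A : Matrix (Fin n) (Fin d) ℝ) (lam : ℝ) : Matrix (Fin d) (Fin d) ℝ :=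
  gramFun (fun x => if lam ≤ x then 1 else 0) A

/-- `A_λ`: the rows of `A`, projected onto its top principal components. -/
def topPart {n d : ℕ} (A : Matrix (Fin n) (Fin d) ℝ) (lam : ℝ) : Matrix (Fin n) (Fin d) ℝ :=
  A * topProj A lam

/-- The Moore–Penrose pseudoinverse `A⁺ = (AᵀA)⁺ Aᵀ`; here `x⁻¹` is `0` at `x = 0`, so
`gramFun (·⁻¹) A` inverts `AᵀA` on its range and vanishes on its kernel. -/
def pinv {n d : ℕ} (A : Matrix (Fin n) (Fin d) ℝ) : Matrix (Fin d) (Fin n) ℝ :=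
  gramFun (fun x => x⁻¹) A * Aᵀ

theorem gramFun_mul {n d : ℕ} (f g : ℝ → ℝ) (A : Matrix (Fin n) (Fin d) ℝ) :
    gramFun f A * gramFun g A = gramFun (fun x => f x * g x) A := by
  simp only [gramFun, Matrix.IsHermitian.cfc, ← map_mul, Matrix.diagonal_mul_diagonal]
  rfl

theorem gramFun_id {n d : ℕ} (A : Matrix (Fin n) (Fin d) ℝ) :
    gramFun (fun x => x) A = Aᵀ * A :=
  ((isHermitian_gram A).spectral_theorem).symm

theorem gramFun_transpose {n d : ℕ} (f : ℝ → ℝ) (A : Matrix (Fin n) (Fin d) ℝ) :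
    (gramFun f A)ᵀ = gramFun f A := by
  rw [← Matrix.conjTranspose_eq_transpose_of_trivial, ← Matrix.star_eq_conjTranspose]
  simp only [gramFun, Matrix.IsHermitian.cfc, ← map_star, Matrix.star_eq_conjTranspose,
    Matrix.diagonal_conjTranspose]
  congr 2

/-- `pinv` satisfies the four Penrose equations, which characterize the pseudoinverse. -/
theorem pinv_penrose {n d : ℕ} (A : Matrix (Fin n) (Fin d) ℝ) :
    A * pinv A * A = A ∧ pinv A * A * pinv A = pinv A ∧
      (A * pinv A)ᵀ = A * pinv A ∧ (pinv A * A)ᵀ = pinv A * A := by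
  have hGH : pinv A * A = gramFun (fun x => x⁻¹ * x) A := by
    rw [pinv, Matrix.mul_assoc, ← gramFun_id, gramFun_mul]
  refine ⟨?_, ?_, ?_, ?_⟩
  · have h : Aᵀ * A * (pinv A * A - 1) = 0 := by
      rw [hGH, Matrix.mul_sub, ← gramFun_id, gramFun_mul, Matrix.mul_one, sub_eq_zero]
      congr 1
      funext x
      by_cases hx : x = 0 <;> simp [hx]
    rw [← Matrix.conjTranspose_eq_transpose_of_trivial,
      Matrix.conjTranspose_mul_self_mul_eq_zero, Matrix.mul_sub, Matrix.mul_one, sub_eq_zero,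
      ← Matrix.mul_assoc] at h
    exact h
  · rw [hGH, pinv, ← Matrix.mul_assoc, gramFun_mul]
    congr 2
    funext x
    by_cases hx : x = 0 <;> simp [hx]
  · simp only [pinv, Matrix.transpose_mul, Matrix.transpose_transpose, gramFun_transpose,
      Matrix.mul_assoc]
  · rw [hGH, gramFun_transpose]

/-- `AᵀA + λI`. -/
def ridgeMat {n d : ℕ} (A : Matrix (Fin n) (Fin d) ℝ) (lam : ℝ) : Matrix (Fin d) (Fin d) ℝ :=
  Aᵀ * A + lam • (1 : Matrix (Fin d) (Fin d) ℝ)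

/-! ### Ridge regression routines -/

/-- A (randomized) ridge regression routine for a fixed matrix with `d` columns and a fixed `λ`:
`R ε δ y` is the joint law of the output vector and of the running time of `ridge(A, λ, y, ε, δ)`.
Separate calls use fresh random choices. -/
abbrev Routine (d : ℕ) : Type := ℝ → ℝ → (Fin d → ℝ) → PMF ((Fin d → ℝ) × ℕ)

/-- `x` is an `ε`-accurate answer to the ridge regression problem with right-hand side `y`. -/
def RidgeAccurate {n d : ℕ} (A : Matrix (Fin n) (Fin d) ℝ) (lam eps : ℝ)
    (y x : Fin d → ℝ) : Prop :=
  matNorm (ridgeMat A lam) (x - (ridgeMat A lam)⁻¹ *ᵥ y) ≤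
    eps * matNorm (ridgeMat A lam)⁻¹ y

/-- The guarantee of a ridge regression routine: an `ε`-accurate answer with probability at
least `1 - δ`, for every right-hand side. -/
def RidgeSpec {n d : ℕ} (A : Matrix (Fin n) (Fin d) ℝ) (lam : ℝ) (R : Routine d) : Prop :=
  ∀ eps del : ℝ, 0 < eps → eps < 1 → 0 < del → del < 1 → ∀ y : Fin d → ℝ,
    ENNReal.ofReal (1 - del) ≤
      (R eps del y).toOuterMeasure {o | RidgeAccurate A lam eps y o.1}

/-- The guarantee of a routine without failure probability: every possible answer is accurate. -/
def SureRidgeSpec {n d : ℕ} (A : Matrix (Fin n) (Fin d) ℝ) (lam : ℝ) (R : Routine d) : Prop :=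
  ∀ eps del : ℝ, 0 < eps → eps < 1 → 0 < del → del < 1 → ∀ y : Fin d → ℝ,
    ∀ o ∈ (R eps del y).support, RidgeAccurate A lam eps y o.1

/-- `T ε δ` bounds the running time of every call `ridge(A, λ, ·, ε, δ)`. -/
def CostBound {d : ℕ} (R : Routine d) (T : ℝ → ℝ → ℝ) : Prop :=
  ∀ eps del : ℝ, 0 < eps → eps < 1 → 0 < del → del < 1 → ∀ y : Fin d → ℝ,
    ∀ o ∈ (R eps del y).support, (o.2 : ℝ) ≤ T eps del

/-! ### The two algorithms, with call counters and a step counter -/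

/-- Who calls the ridge regression routine. -/
inductive Caller
  | proj
  | pcr
  deriving DecidableEq

/-- The counters of a computation: calls to `pc-proj`, calls to the ridge regression routine (made
inside `pc-proj` or by `ridge-pcr` itself), and the total number of steps. -/
structure Tally where
  projCalls : ℕ
  ridgeCalls : Caller → ℕ
  time : ℕ

/-- All counters are zero. -/
def Tally.zero : Tally := ⟨0, fun _ => 0, 0⟩

/-- Randomized computations that update the counters. -/
abbrev Comp (α : Type) : Type := StateT Tally PMF α

/-- Spend `t` steps. -/
def tick (t : ℕ) : Comp Unit := modify fun c => { c with time := c.time + t }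

/-- Count one call of `pc-proj`. -/
def countProj : Comp Unit := modify fun c => { c with projCalls := c.projCalls + 1 }

/-- Call the ridge regression routine with fresh randomness. -/
def callRidge {d : ℕ} (R : Routine d) (who : Caller) (eps del : ℝ) (y : Fin d → ℝ) :
    Comp (Fin d → ℝ) := do
  let o ← StateT.lift (R eps del y)
  modify fun c => { c with
    ridgeCalls := Function.update c.ridgeCalls who (c.ridgeCalls who + 1)
    time := c.time + o.2 }
  return o.1

/-- `a x + b y`, for vectors with `d` entries, in `d + 1` steps. -/
def linM {d : ℕ} (a : ℝ) (x : Fin d → ℝ) (b : ℝ) (y : Fin d → ℝ) : Comp (Fin d → ℝ) := do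
  tick (d + 1)
  return a • x + b • y

/-- `A x`. -/
def mulM {n d : ℕ} (A : Matrix (Fin n) (Fin d) ℝ) (x : Fin d → ℝ) : Comp (Fin n → ℝ) := do
  tick (nnz A + n + 1)
  return A *ᵥ x

/-- `Aᵀ u`. -/
def mulTM {n d : ℕ} (A : Matrix (Fin n) (Fin d) ℝ) (u : Fin n → ℝ) : Comp (Fin d → ℝ) := do
  tick (nnz A + d + 1)
  return Aᵀ *ᵥ u

/-- `AᵀA x`, by two matrix-vector products. -/
def gramM {n d : ℕ} (A : Matrix (Fin n) (Fin d) ℝ) (x : Fin d → ℝ) : Comp (Fin d → ℝ) := do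
  let u ← mulM A x
  mulTM A u

/-- `for k = 0, …, q - 1` do `body k`, on a loop state `x`. -/
def forLoop {α : Type} (body : ℕ → α → Comp α) : ℕ → α → Comp α
  | 0, x => pure x
  | q + 1, x => do
    let x' ← forLoop body q x
    tick 1
    body q x'

/-- The number of iterations of `pc-proj`. -/
def projIter (c₁ gam eps : ℝ) : ℕ := ⌈c₁ * (gam ^ 2)⁻¹ * Real.log (1 / eps)⌉₊

/-- The accuracy of the ridge calls of `pc-proj`. -/
def projTol (c₂ kap gam eps : ℝ) : ℝ := c₂⁻¹ * (eps ^ 2 * gam ^ 2 / √kap)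

/-- The failure rate of each of the `2q + 1` ridge calls of `pc-proj`. -/
def projFail (q : ℕ) (del : ℝ) : ℝ := del / (2 * q + 1)

/-- The number of iterations of `ridge-pcr`. -/
def pcrIter (c₁ kap eps : ℝ) : ℕ := ⌈c₁ * Real.log (kap / eps)⌉₊

/-- The accuracy of the calls of `ridge-pcr`. -/
def pcrTol (c₂ kap eps : ℝ) (q : ℕ) : ℝ := c₂⁻¹ * (eps / (q ^ 2 * √kap))

/-- The failure rate of each of the `q + 1` ridge calls of `ridge-pcr`. -/
def pcrFail (q : ℕ) (del : ℝ) : ℝ := del / (2 * (q + 1))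

/-- `pc-proj(A, λ, y, γ, ε, δ)` with the constants `c₁, c₂` and the ridge routine `R`. -/
def pcProj {n d : ℕ} (c₁ c₂ : ℝ) (R : Routine d) (A : Matrix (Fin n) (Fin d) ℝ) (lam : ℝ)
    (y : Fin d → ℝ) (gam eps del : ℝ) : Comp (Fin d → ℝ) := do
  countProj
  let q := projIter c₁ gam eps
  let eps' := projTol c₂ (kappa A lam) gam eps
  let del' := projFail q del
  -- the scalar arithmetic of the three lines above
  tick 20
  let g ← gramM A y
  let s ← callRidge R .proj eps' del' g
  let w ← linM 1 s (-(1 / 2)) y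
  let ws ← forLoop (fun k (ws : (Fin d → ℝ) × (Fin d → ℝ)) => do
    let (w, s) := ws
    let g ← gramM A w
    let r ← callRidge R .proj eps' del' g
    let t ← linM 1 w (-1) r
    let g ← gramM A t
    let r ← callRidge R .proj eps' del' g
    -- the coefficient of the next line
    tick 10
    let w ← linM (4 * ((2 * k + 1) / (2 * k + 2))) r 0 r
    let s ← linM 1 s 1 w
    return (w, s)) q (w, s)
  return ws.2

/-- `ridge-pcr`: the constants `p₁, p₂` are those of `pc-proj`, and `c₁, c₂` are its own. -/
def ridgePCR {n d : ℕ} (p₁ p₂ c₁ c₂ : ℝ) (R : Routine d) (A : Matrix (Fin n) (Fin d) ℝ)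
    (lam : ℝ) (b : Fin n → ℝ) (gam eps del : ℝ) : Comp (Fin d → ℝ) := do
  let q := pcrIter c₁ (kappa A lam) eps
  let eps' := pcrTol c₂ (kappa A lam) eps q
  let del' := pcrFail q del
  -- the scalar arithmetic of the three lines above
  tick 20
  let z ← mulTM A b
  let y ← pcProj p₁ p₂ R A lam z gam eps' (del / 2)
  let s₀ ← callRidge R .pcr eps' del' y
  forLoop (fun _ s => do
    let r ← callRidge R .pcr eps' del' s
    linM 1 s₀ lam r) q s₀

/-- The joint law of the output and of the final counters of `ridge-pcr`. -/
def runPCR {n d : ℕ} (p₁ p₂ c₁ c₂ : ℝ) (R : Routine d) (A : Matrix (Fin n) (Fin d) ℝ)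
    (lam : ℝ) (b : Fin n → ℝ) (gam eps del : ℝ) : PMF ((Fin d → ℝ) × Tally) :=
  (ridgePCR p₁ p₂ c₁ c₂ R A lam b gam eps del).run Tally.zero

/-! ### A programming language with a step count, for implementing ridge regression

A program works on real scalar registers and on registers for vectors with `d` and with `n`
entries. It sees the matrix only through matrix-vector products, the Frobenius norm and random
rows. Scalar instructions take one step and vector instructions as many steps as there are entries
to be processed. -/

/-- Instructions; the first argument names the register that receives the result. -/
inductive Instr
  | const (r : ℕ) (c : ℚ)
  | add (r a b : ℕ)
  | sub (r a b : ℕ)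
  | mul (r a b : ℕ)
  | div (r a b : ℕ)
  | sqrt (r a : ℕ)
  | log (r a : ℕ)
  /-- inner product of two vectors with `d` entries -/
  | dot (r i j : ℕ)
  /-- inner product of two vectors with `n` entries -/
  | dotN (r i j : ℕ)
  /-- linear combination (scalars `a`, `b`) of the vectors `j` and `k` with `d` entries -/
  | lin (i a j b k : ℕ)
  /-- linear combination (scalars `a`, `b`) of the vectors `j` and `k` with `n` entries -/
  | linN (i a j b k : ℕ)
  /-- product of `A` with a vector with `d` entries -/
  | mulA (i j : ℕ)
  /-- product of `Aᵀ` with a vector with `n` entries -/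
  | mulAT (i j : ℕ)
  /-- squared Frobenius norm of `A` -/
  | frob (r : ℕ)
  /-- a random row of `A`, chosen with probability proportional to its squared norm -/
  | sampleRow (i : ℕ)

/-- Programs: `loop r p` runs `p` for `⌈x⌉` rounds, where `x` is the content of the scalar register
`r` on entry (no round if `x ≤ 0`); `ifPos r p q` runs `p` if the scalar register `r` is positive
and `q` otherwise. -/
inductive Prog
  | op (i : Instr)
  | seq (p q : Prog)
  | loop (r : ℕ) (p : Prog)
  | ifPos (r : ℕ) (p q : Prog)

/-- The program makes no random choice. -/
def Prog.SampleFree : Prog → Prop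
  | .op (.sampleRow _) => False
  | .op _ => True
  | .seq p q => p.SampleFree ∧ q.SampleFree
  | .loop _ p => p.SampleFree
  | .ifPos _ p q => p.SampleFree ∧ q.SampleFree

/-- The contents of the registers and the number of steps made. -/
structure Store (n d : ℕ) where
  scal : ℕ → ℝ
  vec : ℕ → Fin d → ℝ
  vecN : ℕ → Fin n → ℝ
  time : ℕ

/-- Write a scalar register, in `t` steps. -/
def Store.setScal {n d : ℕ} (s : Store n d) (r : ℕ) (x : ℝ) (t : ℕ) : Store n d :=
  { s with scal := Function.update s.scal r x, time := s.time + t }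

/-- Write a register for vectors with `d` entries, in `t` steps. -/
def Store.setVec {n d : ℕ} (s : Store n d) (i : ℕ) (x : Fin d → ℝ) (t : ℕ) : Store n d :=
  { s with vec := Function.update s.vec i x, time := s.time + t }

/-- Write a register for vectors with `n` entries, in `t` steps. -/
def Store.setVecN {n d : ℕ} (s : Store n d) (i : ℕ) (x : Fin n → ℝ) (t : ℕ) : Store n d :=
  { s with vecN := Function.update s.vecN i x, time := s.time + t }

/-- Spend `t` steps. -/
def Store.wait {n d : ℕ} (s : Store n d) (t : ℕ) : Store n d := { s with time := s.time + t }

/-- The squared norm of a row. -/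
def rowWeight {n d : ℕ} (A : Matrix (Fin n) (Fin d) ℝ) (i : Fin n) : ENNReal :=
  ENNReal.ofReal (∑ j, A i j ^ 2)

theorem tsum_rowWeight_ne_top {n d : ℕ} (A : Matrix (Fin n) (Fin d) ℝ) :
    ∑' i, rowWeight A i ≠ ⊤ := by
  rw [tsum_fintype]
  exact ENNReal.sum_ne_top.2 fun i _ => ENNReal.ofReal_ne_top

open Classical in
/-- The law of a random row of `A`, chosen with probability proportional to its squared norm
(the zero vector if `A = 0`). -/
def rowLaw {n d : ℕ} (A : Matrix (Fin n) (Fin d) ℝ) : PMF (Fin d → ℝ) :=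
  if h : ∑' i, rowWeight A i ≠ 0 then
    (PMF.normalize (rowWeight A) h (tsum_rowWeight_ne_top A)).map fun i => A i
  else PMF.pure 0

/-- The effect of one instruction. -/
def Instr.exec {n d : ℕ} (A : Matrix (Fin n) (Fin d) ℝ) (s : Store n d) :
    Instr → PMF (Store n d)
  | .const r c => PMF.pure (s.setScal r c 1)
  | .add r a b => PMF.pure (s.setScal r (s.scal a + s.scal b) 1)
  | .sub r a b => PMF.pure (s.setScal r (s.scal a - s.scal b) 1)
  | .mul r a b => PMF.pure (s.setScal r (s.scal a * s.scal b) 1)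
  | .div r a b => PMF.pure (s.setScal r (s.scal a / s.scal b) 1)
  | .sqrt r a => PMF.pure (s.setScal r (√(s.scal a)) 1)
  | .log r a => PMF.pure (s.setScal r (Real.log (s.scal a)) 1)
  | .dot r i j => PMF.pure (s.setScal r (s.vec i ⬝ᵥ s.vec j) (d + 1))
  | .dotN r i j => PMF.pure (s.setScal r (s.vecN i ⬝ᵥ s.vecN j) (n + 1))
  | .lin i a j b k =>
      PMF.pure (s.setVec i (s.scal a • s.vec j + s.scal b • s.vec k) (d + 1))
  | .linN i a j b k =>
      PMF.pure (s.setVecN i (s.scal a • s.vecN j + s.scal b • s.vecN k) (n + 1))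
  | .mulA i j => PMF.pure (s.setVecN i (A *ᵥ s.vec j) (nnz A + n + 1))
  | .mulAT i j => PMF.pure (s.setVec i (Aᵀ *ᵥ s.vecN j) (nnz A + d + 1))
  | .frob r => PMF.pure (s.setScal r (frobSq A) (nnz A + 1))
  | .sampleRow i => (rowLaw A).map fun x => s.setVec i x (d + 1)

/-- `m` rounds of a loop body; each round takes one step more than the body. -/
def iterRounds {n d : ℕ} (f : Store n d → PMF (Store n d)) : ℕ → Store n d → PMF (Store n d)
  | 0, s => PMF.pure s
  | m + 1, s => (f (s.wait 1)).bind (iterRounds f m)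

open Classical in
/-- The law of the final store of a program. -/
def Prog.exec {n d : ℕ} (A : Matrix (Fin n) (Fin d) ℝ) :
    Prog → Store n d → PMF (Store n d)
  | .op i, s => i.exec A s
  | .seq p q, s => (p.exec A s).bind (q.exec A)
  | .loop r p, s => iterRounds (p.exec A) ⌈s.scal r⌉₊ (s.wait 1)
  | .ifPos r p q, s =>
      if 0 < s.scal r then p.exec A (s.wait 1) else q.exec A (s.wait 1)

/-- The store at the start of a call: the scalar registers `0, 1, 2, 3` hold `λ, ε, δ, κ_λ`, the
vector register `0` holds `y`, and all other registers are zero. The steps already counted are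
those for reading the input and preparing the sampling of rows. -/
def initStore {n d : ℕ} (A : Matrix (Fin n) (Fin d) ℝ) (lam eps del : ℝ) (y : Fin d → ℝ) :
    Store n d where
  scal := fun r =>
    if r = 0 then lam else if r = 1 then eps else if r = 2 then del
    else if r = 3 then kappa A lam else 0
  vec := fun i => if i = 0 then y else 0
  vecN := fun _ => 0
  time := inputSize A

/-- The routine that a program implements; its answer is read from the vector register `0`. -/
def Prog.routine {n d : ℕ} (P : Prog) (A : Matrix (Fin n) (Fin d) ℝ) (lam : ℝ) : Routine d :=
  fun eps del y => (P.exec A (initStore A lam eps del y)).map fun s => (s.vec 0, s.time)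

end RidgePCR

end

/-! Every matrix in the algorithms is a function of the Gram matrix G = AᵀA. In the eigenbasis of G
(`gramCoord`), identities and norm estimates become scalar statements about one eigenvalue t. Since
‖y‖ in the norm of M_λ⁻¹ equals ‖M_λ⁻¹y‖ in the norm of M_λ, a ridge call has relative error ε in
the single norm of M_λ, and all errors are tracked in it.

Projection. With x = (t - λ)/(t + λ), the projection P is the step function at x = 0, and the gap
between singular values gives |x| ≥ 2γ (`Gapped.of_sigma`). The step function is (1 + sgn x)/2, and
sgn x = x(1 - u)^{-1/2} for u = 1 - x². The algorithm sums the Taylor series of (1 - u)^{-1/2}. The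
square of a Taylor polynomial lies between two geometric sums (`stepSum_sq_bounds`), so the
truncation error is at most u^{q+1} ≤ (1 - 4γ²)^{q+1}. One round multiplies by 4B(1 - B) with B =
M_λ⁻¹G. This has norm at most one, so rounding errors are not amplified (`projInv_succ`).

Inversion. On eigenvalues t ≥ λ, the Neumann series for 1/t has ratio λ/(t + λ) ≤ 1/2, so
logarithmically many rounds suffice. The map λM_λ⁻¹ is a contraction, so errors again only add up
(`pcrInv_succ`, `pcrInv_gramNorm_sub_le`). The tolerances are balanced in
`failsAtMost_ridgePCR_of_gapped`. Failure probabilities add by the union bound (`FailsAtMost.bind`),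
and calls and steps are counted by `Uses`.

Ridge regression. The deterministic program is Polyak's heavy ball method. Its residual polynomials
are bounded through a quadratic form that the recurrence rescales (`heavyBall_energy`), and about
√κ_λ log(κ_λ/ε) rounds suffice. The randomized program is variance reduced stochastic gradient
descent. An epoch of ⌈16‖A‖_F²/λ⌉ sampled rows halves the expected squared error (`svrgEpoch_exec`),
Markov's inequality gives the success probability, and ‖A‖_F²/λ = sr(A)κ_λ gives the cost.

Running time. The logarithms of all inverse tolerances and failure rates are bounded by constants
times log(κ_λ/(εγδ)), without δ for the tolerances. One logarithm counts the calls and another is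
paid inside each call, whence the squares. -/

noncomputable section

namespace RidgePCR

variable {n d : ℕ}

/-! ### Functions of the Gram matrix -/

/-- The eigenvalues of `AᵀA`. -/
def gramEig (A : Matrix (Fin n) (Fin d) ℝ) (i : Fin d) : ℝ := (isHermitian_gram A).eigenvalues i

/-- The coordinates of a vector with respect to the eigenvectors of `AᵀA`. -/
def gramCoord (A : Matrix (Fin n) (Fin d) ℝ) (x : Fin d → ℝ) (i : Fin d) : ℝ :=
  ((star (isHermitian_gram A).eigenvectorUnitary : Matrix (Fin d) (Fin d) ℝ) *ᵥ x) i

theorem norm2_sq {m : ℕ} (x : Fin m → ℝ) : norm2 x ^ 2 = x ⬝ᵥ x := by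
  rw [norm2, EuclideanSpace.norm_sq_eq]
  simp [dotProduct, sq]

theorem norm2_nonneg {m : ℕ} (x : Fin m → ℝ) : 0 ≤ norm2 x := norm_nonneg _

theorem norm2_add_le {m : ℕ} (x y : Fin m → ℝ) : norm2 (x + y) ≤ norm2 x + norm2 y :=
  norm_add_le (WithLp.toLp 2 x) (WithLp.toLp 2 y)

theorem norm2_sub_le {m : ℕ} (x y : Fin m → ℝ) : norm2 (x - y) ≤ norm2 x + norm2 y :=
  norm_sub_le (WithLp.toLp 2 x) (WithLp.toLp 2 y)

theorem norm2_smul {m : ℕ} (c : ℝ) (x : Fin m → ℝ) : norm2 (c • x) = |c| * norm2 x :=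
  norm_smul c (WithLp.toLp 2 x)

theorem norm2_eq_zero {m : ℕ} {x : Fin m → ℝ} : norm2 x = 0 ↔ x = 0 := by
  rw [norm2, norm_eq_zero]
  exact WithLp.toLp_eq_zero 2

theorem dotProduct_le_norm2_mul {m : ℕ} (x y : Fin m → ℝ) : x ⬝ᵥ y ≤ norm2 x * norm2 y := by
  have h := real_inner_le_norm (WithLp.toLp 2 y) (WithLp.toLp 2 x)
  rw [EuclideanSpace.inner_eq_star_dotProduct] at h
  simpa [norm2, mul_comm] using h

theorem dotProduct_sq_le {m : ℕ} (x y : Fin m → ℝ) : (x ⬝ᵥ y) ^ 2 ≤ (x ⬝ᵥ x) * (y ⬝ᵥ y) := by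
  have h := Finset.sum_mul_sq_le_sq_mul_sq Finset.univ x y
  simpa [dotProduct, sq] using h

/-- The eigenvector matrix is orthogonal, so `gramFun f A` acts diagonally in these coordinates.
This is what reduces matrix identities to scalar ones. -/
theorem gramCoord_mulVec (f : ℝ → ℝ) (A : Matrix (Fin n) (Fin d) ℝ) (x : Fin d → ℝ) (i : Fin d) :
    gramCoord A (gramFun f A *ᵥ x) i = f (gramEig A i) * gramCoord A x i := by
  have hU : (star (isHermitian_gram A).eigenvectorUnitary : Matrix (Fin d) (Fin d) ℝ) *
      ((isHermitian_gram A).eigenvectorUnitary : Matrix (Fin d) (Fin d) ℝ) = 1 := by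
    simp
  rw [gramCoord, gramFun, Matrix.IsHermitian.cfc, Unitary.conjStarAlgAut_apply,
    Matrix.mulVec_mulVec, ← Matrix.mul_assoc, ← Matrix.mul_assoc, hU, Matrix.one_mul,
    ← Matrix.mulVec_mulVec, Matrix.mulVec_diagonal]
  rfl

theorem norm2_sq_eq_gramCoord (A : Matrix (Fin n) (Fin d) ℝ) (x : Fin d → ℝ) :
    norm2 x ^ 2 = ∑ i, gramCoord A x i ^ 2 := by
  have hU : ((isHermitian_gram A).eigenvectorUnitary : Matrix (Fin d) (Fin d) ℝ) *
      (star (isHermitian_gram A).eigenvectorUnitary : Matrix (Fin d) (Fin d) ℝ) = 1 := by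
    simp
  have h : ∑ i, gramCoord A x i ^ 2 = gramCoord A x ⬝ᵥ gramCoord A x := by
    simp [dotProduct, sq]
  rw [h, norm2_sq]
  change _ = (_ *ᵥ x) ⬝ᵥ (_ *ᵥ x)
  rw [Matrix.dotProduct_mulVec, Matrix.vecMul_mulVec]
  have h2 : (star (isHermitian_gram A).eigenvectorUnitary : Matrix (Fin d) (Fin d) ℝ)ᵀ =
      ((isHermitian_gram A).eigenvectorUnitary : Matrix (Fin d) (Fin d) ℝ) := by
    rw [Matrix.star_eq_conjTranspose, Matrix.conjTranspose_eq_transpose_of_trivial,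
      Matrix.transpose_transpose]
  rw [h2, hU, Matrix.vecMul_one]

theorem gramCoord_add (A : Matrix (Fin n) (Fin d) ℝ) (x y : Fin d → ℝ) (i : Fin d) :
    gramCoord A (x + y) i = gramCoord A x i + gramCoord A y i := by
  simp [gramCoord, Matrix.mulVec_add]

theorem gramCoord_sub (A : Matrix (Fin n) (Fin d) ℝ) (x y : Fin d → ℝ) (i : Fin d) :
    gramCoord A (x - y) i = gramCoord A x i - gramCoord A y i := by
  simp [gramCoord, Matrix.mulVec_sub]

theorem gramCoord_smul (A : Matrix (Fin n) (Fin d) ℝ) (c : ℝ) (x : Fin d → ℝ) (i : Fin d) :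
    gramCoord A (c • x) i = c * gramCoord A x i := by
  simp [gramCoord, Matrix.mulVec_smul]

/-- By Parseval a vector with zero coordinates has zero norm. Vector identities below are proved
through this, followed by `field_simp` and `ring` in each coordinate. -/
theorem gramCoord_ext {A : Matrix (Fin n) (Fin d) ℝ} {x y : Fin d → ℝ}
    (h : ∀ i, gramCoord A x i = gramCoord A y i) : x = y := by
  have : norm2 (x - y) ^ 2 = 0 := by
    rw [norm2_sq_eq_gramCoord A]
    simp [gramCoord_sub, h]
  exact sub_eq_zero.1 (norm2_eq_zero.1 (pow_eq_zero_iff two_ne_zero |>.1 this))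

theorem gramFun_ext {A : Matrix (Fin n) (Fin d) ℝ} {N : Matrix (Fin d) (Fin d) ℝ} {f : ℝ → ℝ}
    (h : ∀ x i, gramCoord A (N *ᵥ x) i = f (gramEig A i) * gramCoord A x i) :
    N = gramFun f A := by
  apply Matrix.ext_of_mulVec_single
  intro j
  apply gramCoord_ext (A := A)
  intro i
  rw [h, gramCoord_mulVec]

theorem gramFun_congr {A : Matrix (Fin n) (Fin d) ℝ} {f g : ℝ → ℝ}
    (h : ∀ i, f (gramEig A i) = g (gramEig A i)) : gramFun f A = gramFun g A :=
  gramFun_ext fun x i => by rw [gramCoord_mulVec, h]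

theorem gramCoord_gram (A : Matrix (Fin n) (Fin d) ℝ) (x : Fin d → ℝ) (i : Fin d) :
    gramCoord A ((Aᵀ * A) *ᵥ x) i = gramEig A i * gramCoord A x i := by
  rw [← gramFun_id, gramCoord_mulVec]

theorem ridgeMat_eq_gramFun (A : Matrix (Fin n) (Fin d) ℝ) (lam : ℝ) :
    ridgeMat A lam = gramFun (fun x => x + lam) A :=
  gramFun_ext fun x i => by
    rw [ridgeMat, Matrix.add_mulVec, gramCoord_add, gramCoord_gram, Matrix.smul_mulVec,
      Matrix.one_mulVec, gramCoord_smul]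
    ring

theorem one_eq_gramFun (A : Matrix (Fin n) (Fin d) ℝ) :
    (1 : Matrix (Fin d) (Fin d) ℝ) = gramFun (fun _ => 1) A :=
  gramFun_ext fun x i => by simp

theorem gramEig_nonneg (A : Matrix (Fin n) (Fin d) ℝ) (i : Fin d) : 0 ≤ gramEig A i := by
  have h : (Aᵀ * A).PosSemidef := by
    simpa [Matrix.conjTranspose_eq_transpose_of_trivial] using
      Matrix.posSemidef_conjTranspose_mul_self A
  exact h.eigenvalues_nonneg i

theorem ridgeMat_inv {A : Matrix (Fin n) (Fin d) ℝ} {lam : ℝ} (hlam : 0 < lam) :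
    (ridgeMat A lam)⁻¹ = gramFun (fun x => (x + lam)⁻¹) A := by
  apply Matrix.inv_eq_right_inv
  rw [ridgeMat_eq_gramFun, gramFun_mul, one_eq_gramFun A]
  apply gramFun_congr
  intro i
  have := gramEig_nonneg A i
  exact mul_inv_cancel₀ (by positivity)

/-- Comparison of the sizes of two vectors in the eigenbasis of `AᵀA`. -/
theorem norm2_le_of_gramCoord {A : Matrix (Fin n) (Fin d) ℝ} {x y : Fin d → ℝ}
    (h : ∀ i, |gramCoord A x i| ≤ |gramCoord A y i|) : norm2 x ≤ norm2 y := by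
  apply le_of_sq_le_sq _ (norm2_nonneg _)
  rw [norm2_sq_eq_gramCoord A, norm2_sq_eq_gramCoord A]
  exact Finset.sum_le_sum fun i _ => sq_le_sq.2 (h i)

theorem norm2_gramFun_le {A : Matrix (Fin n) (Fin d) ℝ} {f : ℝ → ℝ} {c : ℝ} 
    (h : ∀ i, |f (gramEig A i)| ≤ c) (x : Fin d → ℝ) : norm2 (gramFun f A *ᵥ x) ≤ c * norm2 x := by
  -- For `d = 0` the hypothesis is vacuous and `c` may be negative, but then both norms are `0`.
  rcases isEmpty_or_nonempty (Fin d) with hd | ⟨⟨i⟩⟩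
  · have hx : ∀ y : Fin d → ℝ, norm2 y = 0 := fun y => by rw [norm2_eq_zero]; ext i; exact hd.elim i
    simp [hx]
  have hc : 0 ≤ c := (abs_nonneg _).trans (h i)
  have h1 : c * norm2 x = norm2 (c • x) := by rw [norm2_smul, abs_of_nonneg hc]
  rw [h1]
  apply norm2_le_of_gramCoord (A := A)
  intro j
  rw [gramCoord_mulVec, gramCoord_smul, abs_mul, abs_mul, abs_of_nonneg hc]
  exact mul_le_mul_of_nonneg_right (h j) (abs_nonneg _)

theorem matNorm_gramFun {A : Matrix (Fin n) (Fin d) ℝ} {g : ℝ → ℝ}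
    (h : ∀ i, 0 ≤ g (gramEig A i)) (x : Fin d → ℝ) :
    matNorm (gramFun g A) x = norm2 (gramFun (fun t => √(g t)) A *ᵥ x) := by
  rw [matNorm, ← Real.sqrt_sq (norm2_nonneg (gramFun _ A *ᵥ x)), norm2_sq,
    Matrix.dotProduct_mulVec, Matrix.dotProduct_mulVec, Matrix.vecMul_mulVec, gramFun_transpose,
    gramFun_mul]
  have : gramFun g A = gramFun (fun x => √(g x) * √(g x)) A :=
    gramFun_congr fun i => (Real.mul_self_sqrt (h i)).symm
  rw [← this, ← Matrix.dotProduct_mulVec]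

theorem matNorm_gramFun_sq {A : Matrix (Fin n) (Fin d) ℝ} {g : ℝ → ℝ}
    (h : ∀ i, 0 ≤ g (gramEig A i)) (x : Fin d → ℝ) :
    matNorm (gramFun g A) x ^ 2 = ∑ i, g (gramEig A i) * gramCoord A x i ^ 2 := by
  rw [matNorm_gramFun h, norm2_sq_eq_gramCoord A]
  refine Finset.sum_congr rfl fun i _ => ?_
  rw [gramCoord_mulVec, mul_pow, Real.sq_sqrt (h i)]

theorem matNorm_nonneg (M : Matrix (Fin d) (Fin d) ℝ) (x : Fin d → ℝ) : 0 ≤ matNorm M x :=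
  Real.sqrt_nonneg _

/-- Comparison of two quadratic norms. -/
theorem matNorm_gramFun_le {A : Matrix (Fin n) (Fin d) ℝ} {g g' : ℝ → ℝ} {x y : Fin d → ℝ} {c : ℝ}
    (hc : 0 ≤ c) (h : ∀ i, 0 ≤ g (gramEig A i)) (h' : ∀ i, 0 ≤ g' (gramEig A i))
    (hle : ∀ i, g (gramEig A i) * gramCoord A x i ^ 2 ≤
      c ^ 2 * (g' (gramEig A i) * gramCoord A y i ^ 2)) :
    matNorm (gramFun g A) x ≤ c * matNorm (gramFun g' A) y := by
  apply le_of_sq_le_sq _ (mul_nonneg hc (matNorm_nonneg _ _))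
  rw [mul_pow, matNorm_gramFun_sq h, matNorm_gramFun_sq h', Finset.mul_sum]
  exact Finset.sum_le_sum fun i _ => hle i

/-! ### The norm of the ridge regression problem -/

section RidgeNorm

variable {A : Matrix (Fin n) (Fin d) ℝ} {lam : ℝ}

theorem ridgeEig_pos (hlam : 0 < lam) (i : Fin d) : 0 < gramEig A i + lam :=
  add_pos_of_nonneg_of_pos (gramEig_nonneg A i) hlam

theorem ridgeNorm_eq (hlam : 0 < lam) (x : Fin d → ℝ) :
    matNorm (ridgeMat A lam) x = norm2 (gramFun (fun t => √(t + lam)) A *ᵥ x) := by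
  rw [ridgeMat_eq_gramFun, matNorm_gramFun fun i => (ridgeEig_pos hlam i).le]

theorem ridgeNorm_sq (hlam : 0 < lam) (x : Fin d → ℝ) :
    matNorm (ridgeMat A lam) x ^ 2 = ∑ i, (gramEig A i + lam) * gramCoord A x i ^ 2 := by
  rw [ridgeMat_eq_gramFun, matNorm_gramFun_sq fun i => (ridgeEig_pos hlam i).le]

theorem ridgeNorm_add_le (hlam : 0 < lam) (x y : Fin d → ℝ) :
    matNorm (ridgeMat A lam) (x + y) ≤ matNorm (ridgeMat A lam) x + matNorm (ridgeMat A lam) y := by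
  simp only [ridgeNorm_eq hlam, Matrix.mulVec_add]
  exact norm2_add_le _ _

theorem ridgeNorm_sub_le (hlam : 0 < lam) (x y : Fin d → ℝ) :
    matNorm (ridgeMat A lam) (x - y) ≤ matNorm (ridgeMat A lam) x + matNorm (ridgeMat A lam) y := by
  simp only [ridgeNorm_eq hlam, Matrix.mulVec_sub]
  exact norm2_sub_le _ _

theorem ridgeNorm_smul (hlam : 0 < lam) (c : ℝ) (x : Fin d → ℝ) :
    matNorm (ridgeMat A lam) (c • x) = |c| * matNorm (ridgeMat A lam) x := by
  simp only [ridgeNorm_eq hlam, Matrix.mulVec_smul, norm2_smul]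

theorem ridgeNorm_gramFun_le (hlam : 0 < lam) {f : ℝ → ℝ} {c : ℝ}
    (h : ∀ i, |f (gramEig A i)| ≤ c) (x : Fin d → ℝ) :
    matNorm (ridgeMat A lam) (gramFun f A *ᵥ x) ≤ c * matNorm (ridgeMat A lam) x := by
  rw [ridgeNorm_eq hlam, ridgeNorm_eq hlam]
  have h1 : gramFun (fun t => √(t + lam)) A *ᵥ (gramFun f A *ᵥ x) =
      gramFun f A *ᵥ (gramFun (fun t => √(t + lam)) A *ᵥ x) := by
    simp only [Matrix.mulVec_mulVec, gramFun_mul, mul_comm]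
  rw [h1]
  exact norm2_gramFun_le h _

/-- The dual norm of `M_λ x`. -/
theorem ridgeDualNorm_eq (hlam : 0 < lam) (x : Fin d → ℝ) :
    matNorm (ridgeMat A lam)⁻¹ x =
      matNorm (ridgeMat A lam) (gramFun (fun t => (t + lam)⁻¹) A *ᵥ x) := by
  have h := fun i => ridgeEig_pos (A := A) hlam i
  rw [ridgeMat_inv hlam, matNorm_gramFun fun i => (inv_pos.2 (h i)).le, ridgeNorm_eq hlam,
    Matrix.mulVec_mulVec, gramFun_mul]
  congr 2
  apply gramFun_congr
  intro i
  rw [Real.sqrt_inv]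
  have := Real.sqrt_pos.2 (h i)
  have h2 := Real.mul_self_sqrt (h i).le
  field_simp
  rw [sq, h2, div_self (h i).ne']

theorem gramNorm_eq (A : Matrix (Fin n) (Fin d) ℝ) (x : Fin d → ℝ) :
    matNorm (Aᵀ * A) x = norm2 (A *ᵥ x) := by
  rw [matNorm, ← Real.sqrt_sq (norm2_nonneg (A *ᵥ x)), norm2_sq, Matrix.dotProduct_mulVec,
    Matrix.dotProduct_mulVec, Matrix.vecMul_mulVec]

/-- `A` and the square root of `AᵀA` have the same quadratic form, as in the polar decomposition. -/
theorem norm2_mulVec_eq (A : Matrix (Fin n) (Fin d) ℝ) (x : Fin d → ℝ) :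
    norm2 (A *ᵥ x) = norm2 (gramFun (fun t => √t) A *ᵥ x) := by
  rw [← gramNorm_eq, ← gramFun_id, matNorm_gramFun (gramEig_nonneg A)]

theorem gramNorm_le_ridgeNorm (hlam : 0 < lam) (x : Fin d → ℝ) :
    matNorm (Aᵀ * A) x ≤ matNorm (ridgeMat A lam) x := by
  rw [gramNorm_eq, norm2_mulVec_eq, ridgeNorm_eq hlam]
  apply norm2_le_of_gramCoord (A := A)
  intro i
  rw [gramCoord_mulVec, gramCoord_mulVec, abs_mul, abs_mul]
  refine mul_le_mul_of_nonneg_right (abs_le_abs_of_nonneg (Real.sqrt_nonneg _) ?_) (abs_nonneg _)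
  exact Real.sqrt_le_sqrt (by linarith)

theorem gramNorm_add_le (A : Matrix (Fin n) (Fin d) ℝ) (x y : Fin d → ℝ) :
    matNorm (Aᵀ * A) (x + y) ≤ matNorm (Aᵀ * A) x + matNorm (Aᵀ * A) y := by
  simp only [gramNorm_eq, Matrix.mulVec_add]
  exact norm2_add_le _ _

/-- The vector `f(AᵀA) Aᵀ b` is bounded in terms of the singular values of `A f(AᵀA)`. -/
theorem norm2_gramFun_transpose_le {f : ℝ → ℝ} {c : ℝ} (hc : 0 ≤ c)
    (h : ∀ i, |f (gramEig A i)| * √(gramEig A i) ≤ c) (b : Fin n → ℝ) :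
    norm2 (gramFun f A *ᵥ (Aᵀ *ᵥ b)) ≤ c * norm2 b := by
  set v := gramFun f A *ᵥ (Aᵀ *ᵥ b) with hv
  have h1 : norm2 (A *ᵥ (gramFun f A *ᵥ v)) ≤ c * norm2 v := by
    rw [norm2_mulVec_eq, Matrix.mulVec_mulVec, gramFun_mul]
    refine norm2_gramFun_le (fun i => ?_) v
    rw [abs_mul, abs_of_nonneg (Real.sqrt_nonneg _), mul_comm]
    exact h i
  -- Duality: `v` is the image of `b` under the transpose of `A f(AᵀA)`. Hence ‖v‖² = ⟨b, A f(AᵀA)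
  -- v⟩, which Cauchy–Schwarz and `h1` bound by c‖b‖‖v‖.
  have h3 : norm2 v ^ 2 = b ⬝ᵥ (A *ᵥ (gramFun f A *ᵥ v)) := by
    rw [norm2_sq]
    nth_rewrite 1 [hv]
    rw [Matrix.mulVec_mulVec, dotProduct_comm, Matrix.dotProduct_mulVec, ← Matrix.mulVec_transpose,
      Matrix.transpose_mul, Matrix.transpose_transpose, gramFun_transpose, ← Matrix.mulVec_mulVec,
      dotProduct_comm]
  have h4 := dotProduct_le_norm2_mul b (A *ᵥ (gramFun f A *ᵥ v))
  have h5 := mul_le_mul_of_nonneg_left h1 (norm2_nonneg b)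
  have h6 := norm2_nonneg v
  have h7 := norm2_nonneg b
  by_contra hcon
  push Not at hcon
  nlinarith [mul_nonneg hc h7]

end RidgeNorm

/-! ### Polynomial approximation of the step function -/

/-- The coefficients `∏_{j ≤ k} (2j-1)/(2j)` of the power series of `(1 - u)^{-1/2}`. -/
def stepCoeff : ℕ → ℝ
  | 0 => 1
  | k + 1 => stepCoeff k * ((2 * k + 1) / (2 * k + 2))

theorem stepCoeff_pos : ∀ k, 0 < stepCoeff k
  | 0 => one_pos
  | k + 1 => by
    have := stepCoeff_pos k
    rw [stepCoeff]
    positivity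

/-- Induction, using (2k+1)(2k+3) ≤ (2k+2)². The resulting decay like (2k+1)^{-1/2} keeps the
accumulated rounding error of `pc-proj` linear in the number of rounds. -/
theorem stepCoeff_sq_mul_le : ∀ k : ℕ, stepCoeff k ^ 2 * (2 * k + 1) ≤ 1
  | 0 => by simp [stepCoeff]
  | k + 1 => by
    have h := stepCoeff_sq_mul_le k
    have h2 : ((2 * k + 1 : ℝ) / (2 * k + 2)) ^ 2 * (2 * k + 3) ≤ 2 * k + 1 := by
      rw [div_pow, div_mul_eq_mul_div, div_le_iff₀ (by positivity)]
      nlinarith [Nat.cast_nonneg (α := ℝ) k]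
    calc stepCoeff (k + 1) ^ 2 * (2 * (k + 1 : ℕ) + 1)
        = stepCoeff k ^ 2 * (((2 * k + 1 : ℝ) / (2 * k + 2)) ^ 2 * (2 * k + 3)) := by
          rw [stepCoeff]; push_cast; ring
      _ ≤ stepCoeff k ^ 2 * (2 * k + 1) := mul_le_mul_of_nonneg_left h2 (sq_nonneg _)
      _ ≤ 1 := h

theorem stepCoeff_mul_sqrt_le (k : ℕ) : stepCoeff k * √(2 * k + 1) ≤ 1 := by
  rw [← abs_of_pos (stepCoeff_pos k), ← Real.sqrt_sq_eq_abs, ← Real.sqrt_mul (sq_nonneg _)]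
  exact Real.sqrt_le_one.2 (stepCoeff_sq_mul_le k)

/-- The generating series F satisfies 2(1 - X)F' = F, so (1 - X)F² has derivative zero and constant
term 1. Hence F² = 1/(1 - X), whose coefficients are all 1. -/
theorem sum_antidiagonal_stepCoeff (k : ℕ) :
    ∑ p ∈ Finset.HasAntidiagonal.antidiagonal k, stepCoeff p.1 * stepCoeff p.2 = 1 := by
  let F : PowerSeries ℝ := PowerSeries.mk stepCoeff
  have hF : (2 : PowerSeries ℝ) * ((1 - PowerSeries.X) * PowerSeries.derivative ℝ F) = F := by
    ext m
    have h2 : (2 : PowerSeries ℝ) = PowerSeries.C (2 : ℝ) :=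
      (map_ofNat PowerSeries.C 2).symm
    rw [h2, PowerSeries.coeff_C_mul, sub_mul, one_mul, map_sub, PowerSeries.coeff_derivative]
    cases m with
    | zero =>
      simp [F, stepCoeff]
    | succ m =>
      rw [PowerSeries.coeff_succ_X_mul, PowerSeries.coeff_derivative]
      simp only [F, PowerSeries.coeff_mk, stepCoeff]
      push_cast
      field_simp
      ring
  have hG : (1 - PowerSeries.X) * F ^ 2 = 1 := by
    apply PowerSeries.derivative.ext
    · rw [Derivation.leibniz, Derivation.leibniz_pow, map_sub, PowerSeries.derivative_X]
      simp only [Derivation.map_one_eq_zero, smul_eq_mul, nsmul_eq_mul, Nat.cast_ofNat]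
      linear_combination F * hF
    · simp [F, stepCoeff]
  have hG2 : F ^ 2 = PowerSeries.mk 1 := by
    have := PowerSeries.mk_one_mul_one_sub_eq_one ℝ
    linear_combination (PowerSeries.mk 1 : PowerSeries ℝ) * hG - F ^ 2 * this
  have h := congrArg (PowerSeries.coeff k) hG2
  rw [sq, PowerSeries.coeff_mul] at h
  simpa [F] using h

/-- The Taylor polynomial of degree `q` of `(1 - u)^{-1/2}`. -/
def stepSum (q : ℕ) (u : ℝ) : ℝ := ∑ k ∈ Finset.range (q + 1), stepCoeff k * u ^ k

theorem sum_pow_eq_sum_stepCoeff (m : ℕ) (u : ℝ) :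
    ∑ k ∈ Finset.range m, u ^ k =
      ∑ p ∈ (Finset.range m ×ˢ Finset.range m).filter (fun p => p.1 + p.2 < m),
        stepCoeff p.1 * u ^ p.1 * (stepCoeff p.2 * u ^ p.2) := by
  rw [← Finset.sum_fiberwise_of_maps_to
    (s := (Finset.range m ×ˢ Finset.range m).filter (fun p => p.1 + p.2 < m)) (t := Finset.range m) (g := fun p => p.1 + p.2)
    (by intro p hp; simp at hp ⊢; omega)]
  refine Finset.sum_congr rfl fun k hk => ?_
  have h1 : Finset.filter (fun p : ℕ × ℕ => p.1 + p.2 = k)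
      ((Finset.range m ×ˢ Finset.range m).filter (fun p => p.1 + p.2 < m)) =
      Finset.HasAntidiagonal.antidiagonal k := by
    ext p
    simp at hk ⊢
    omega
  rw [h1]
  have h2 := sum_antidiagonal_stepCoeff k
  calc u ^ k = (∑ p ∈ Finset.HasAntidiagonal.antidiagonal k, stepCoeff p.1 * stepCoeff p.2) * u ^ k := by
        rw [h2, one_mul]
    _ = _ := by
        rw [Finset.sum_mul]
        refine Finset.sum_congr rfl fun p hp => ?_
        rw [← Finset.HasAntidiagonal.mem_antidiagonal.1 hp, pow_add]
        ring

theorem stepSum_nonneg (q : ℕ) {u : ℝ} (hu : 0 ≤ u) : 0 ≤ stepSum q u :=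
  Finset.sum_nonneg fun k _ => mul_nonneg (stepCoeff_pos k).le (pow_nonneg hu k)

/-- Expanding the square gives a sum of nonnegative terms over the index square [0, q]². It contains
the triangle p₁ + p₂ < q + 1 and is contained in the triangle p₁ + p₂ < 2q + 1. Over a triangle the
sum is geometric. -/
theorem stepSum_sq_bounds (q : ℕ) {u : ℝ} (hu : 0 ≤ u) (hu1 : u ≤ 1) :
    1 - u ^ (q + 1) ≤ stepSum q u ^ 2 * (1 - u) ∧ stepSum q u ^ 2 * (1 - u) ≤ 1 := by
  have hS : stepSum q u ^ 2 = ∑ p ∈ Finset.range (q + 1) ×ˢ Finset.range (q + 1),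
      stepCoeff p.1 * u ^ p.1 * (stepCoeff p.2 * u ^ p.2) := by
    rw [sq, stepSum, Finset.sum_mul_sum, Finset.sum_product]
  have hnn : ∀ p : ℕ × ℕ, 0 ≤ stepCoeff p.1 * u ^ p.1 * (stepCoeff p.2 * u ^ p.2) := fun p =>
    mul_nonneg (mul_nonneg (stepCoeff_pos _).le (pow_nonneg hu _))
      (mul_nonneg (stepCoeff_pos _).le (pow_nonneg hu _))
  have hgeo : ∀ m, (∑ k ∈ Finset.range m, u ^ k) * (1 - u) = 1 - u ^ m := fun m => by
    linear_combination -(geom_sum_mul u m)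
  have h1u : 0 ≤ 1 - u := by linarith
  constructor
  · rw [← hgeo, hS, sum_pow_eq_sum_stepCoeff]
    exact mul_le_mul_of_nonneg_right
      (Finset.sum_le_sum_of_subset_of_nonneg (Finset.filter_subset _ _) fun p _ _ => hnn p) h1u
  · have h2 : stepSum q u ^ 2 ≤ ∑ k ∈ Finset.range (2 * q + 1), u ^ k := by
      rw [hS, sum_pow_eq_sum_stepCoeff]
      refine Finset.sum_le_sum_of_subset_of_nonneg (fun p hp => ?_) fun p _ _ => hnn p
      simp at hp ⊢
      omega
    calc _ ≤ (∑ k ∈ Finset.range (2 * q + 1), u ^ k) * (1 - u) :=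
          mul_le_mul_of_nonneg_right h2 h1u
      _ = 1 - u ^ (2 * q + 1) := hgeo _
      _ ≤ 1 := by linarith [pow_nonneg hu (2 * q + 1)]

/-- For u = 1 - x² the previous bounds put (x S)² between 1 - u^{q+1} and 1. As x S ≥ 0, also 0 ≤ 1
- x S ≤ 1 - (x S)². -/
theorem abs_one_sub_mul_stepSum_le (q : ℕ) {x : ℝ} (hx : 0 < x) (hx1 : x ≤ 1) :
    |1 - x * stepSum q (1 - x ^ 2)| ≤ (1 - x ^ 2) ^ (q + 1) := by
  have hu : 0 ≤ 1 - x ^ 2 := by nlinarith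
  have hu1 : 1 - x ^ 2 ≤ 1 := by nlinarith
  obtain ⟨h1, h2⟩ := stepSum_sq_bounds q hu hu1
  have hS := mul_nonneg hx.le (stepSum_nonneg q hu)
  have ht := pow_nonneg hu (q + 1)
  have ht1 := pow_le_one₀ (n := q + 1) hu hu1
  rw [abs_le]
  constructor <;> nlinarith

/-- The polynomial in `x` that `pc-proj` evaluates after `q` iterations. -/
def stepPoly (q : ℕ) (x : ℝ) : ℝ := 1 / 2 + 1 / 2 * (x * stepSum q (1 - x ^ 2))

/-- The polynomial x S(1 - x²) is odd, so negative arguments reduce to positive ones. At x = 0 the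
estimate would fail for the step but is never needed. -/
theorem abs_step_sub_stepPoly_le (q : ℕ) {x : ℝ} (hx : x ≠ 0) (hx1 : |x| ≤ 1) :
    |(if 0 ≤ x then 1 else 0) - stepPoly q x| ≤ 1 / 2 * (1 - x ^ 2) ^ (q + 1) := by
  rcases lt_or_gt_of_ne hx with h | h
  · rw [if_neg (by linarith), stepPoly]
    have := abs_one_sub_mul_stepSum_le q (neg_pos.2 h) (by rwa [abs_of_neg h] at hx1)
    rw [neg_sq] at this
    rw [abs_le] at this ⊢
    constructor <;> nlinarith
  · rw [if_pos h.le, stepPoly]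
    have := abs_one_sub_mul_stepSum_le q h (by rwa [abs_of_pos h] at hx1)
    rw [abs_le] at this ⊢
    constructor <;> nlinarith

/-- By Bernoulli, 1 + 2k x² ≤ (1 + x²)^{2k}, and (1 - x²)(1 + x²) ≤ 1. This bounds the exact vector
`w` in round k, and with it the fresh rounding error. -/
theorem abs_mul_one_sub_sq_pow_le (k : ℕ) {x : ℝ} (hx : |x| ≤ 1) :
    |x * (1 - x ^ 2) ^ k| * √(2 * k + 1) ≤ 1 := by
  have hu0 := sq_nonneg x
  have hu1 : x ^ 2 ≤ 1 := by rw [sq_le_one_iff_abs_le_one]; exact hx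
  rw [← Real.sqrt_sq_eq_abs, ← Real.sqrt_mul (sq_nonneg _)]
  apply Real.sqrt_le_one.2
  have h1 : (1 - x ^ 2) ^ (2 * k) * (1 + (2 * k : ℕ) * x ^ 2) ≤ 1 := by
    have h2 := one_add_mul_le_pow (a := x ^ 2) (by linarith) (2 * k)
    calc _ ≤ (1 - x ^ 2) ^ (2 * k) * (1 + x ^ 2) ^ (2 * k) :=
          mul_le_mul_of_nonneg_left h2 (pow_nonneg (by linarith) _)
      _ = (1 - (x ^ 2) ^ 2) ^ (2 * k) := by rw [← mul_pow]; ring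
      _ ≤ 1 := pow_le_one₀ (by nlinarith) (by nlinarith)
  have h3 : x ^ 2 * (2 * k + 1) ≤ 1 + (2 * k : ℕ) * x ^ 2 := by
    push_cast
    nlinarith
  calc (x * (1 - x ^ 2) ^ k) ^ 2 * (2 * k + 1)
      = (1 - x ^ 2) ^ (2 * k) * (x ^ 2 * (2 * k + 1)) := by ring
    _ ≤ (1 - x ^ 2) ^ (2 * k) * (1 + (2 * k : ℕ) * x ^ 2) :=
        mul_le_mul_of_nonneg_left h3 (pow_nonneg (by linarith) _)
    _ ≤ 1 := h1

/-! ### Accuracy of `pc-proj` -/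

/-- The eigenvalue `(t - λ)/(t + λ)` of `2 M_λ⁻¹ AᵀA - I`. -/
def signArg (lam t : ℝ) : ℝ := (t - lam) / (t + lam)

section

variable {A : Matrix (Fin n) (Fin d) ℝ} {lam : ℝ}

theorem abs_signArg_le_one (hlam : 0 < lam) {t : ℝ} (ht : 0 ≤ t) : |signArg lam t| ≤ 1 := by
  rw [signArg, abs_div, abs_of_pos (a := t + lam) (by positivity), div_le_one (by positivity),
    abs_le]
  constructor <;> linarith

theorem signArg_nonneg_iff (hlam : 0 < lam) {t : ℝ} (ht : 0 ≤ t) : 0 ≤ signArg lam t ↔ lam ≤ t := by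
  rw [signArg, le_div_iff₀ (by positivity)]
  constructor <;> intro h <;> linarith

theorem RidgeAccurate.norm_sub_le (hlam : 0 < lam) {eps : ℝ} {y r : Fin d → ℝ}
    (h : RidgeAccurate A lam eps y r) :
    matNorm (ridgeMat A lam) (r - gramFun (fun t => (t + lam)⁻¹) A *ᵥ y) ≤
      eps * matNorm (ridgeMat A lam) (gramFun (fun t => (t + lam)⁻¹) A *ᵥ y) := by
  rw [RidgeAccurate, ridgeDualNorm_eq hlam, ridgeMat_inv hlam] at h
  exact h

/-- The factor t/(t + λ) is at most 1, so the error, relative to M_λ⁻¹AᵀAw by definition, is also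
relative to `w` itself. -/
theorem RidgeAccurate.norm_sub_le_of_gram (hlam : 0 < lam) {eps : ℝ} (heps : 0 ≤ eps)
    {w r : Fin d → ℝ} (h : RidgeAccurate A lam eps (Aᵀ *ᵥ (A *ᵥ w)) r) :
    matNorm (ridgeMat A lam) (r - gramFun (fun t => t / (t + lam)) A *ᵥ w) ≤
      eps * matNorm (ridgeMat A lam) w := by
  have h1 := h.norm_sub_le hlam
  have h2 : gramFun (fun t => (t + lam)⁻¹) A *ᵥ (Aᵀ *ᵥ (A *ᵥ w)) =
      gramFun (fun t => t / (t + lam)) A *ᵥ w := by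
    apply gramCoord_ext (A := A)
    intro i
    rw [Matrix.mulVec_mulVec w, gramCoord_mulVec, gramCoord_mulVec, gramCoord_gram]
    ring
  rw [h2] at h1
  refine h1.trans (mul_le_mul_of_nonneg_left ?_ heps)
  have h3 := ridgeNorm_gramFun_le (A := A) hlam (f := fun t => t / (t + lam)) (c := 1)
    (fun i => ?_) w
  · rwa [one_mul] at h3
  · have h0 := gramEig_nonneg A i
    have h1 := ridgeEig_pos (A := A) hlam i
    rw [abs_of_nonneg (by positivity), div_le_one h1]
    linarith

/-- The state `(w, s)` of `pc-proj` is close to that of the exact iteration. -/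
def ProjInv (A : Matrix (Fin n) (Fin d) ℝ) (lam eta : ℝ) (y : Fin d → ℝ) (k : ℕ)
    (ws : (Fin d → ℝ) × (Fin d → ℝ)) : Prop :=
  matNorm (ridgeMat A lam) (ws.1 - stepCoeff k •
      (gramFun (fun t => signArg lam t * (1 - signArg lam t ^ 2) ^ k / 2) A *ᵥ y)) ≤
    stepCoeff k * (2 * eta * √(2 * k + 1)) * matNorm (ridgeMat A lam) y ∧
  matNorm (ridgeMat A lam) (ws.2 - gramFun (fun t => stepPoly k (signArg lam t)) A *ᵥ y) ≤
    (k + 1) * (2 * eta) * matNorm (ridgeMat A lam) y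

/-- With X = `signArg lam t`, t/(t + λ) = (1 + X)/2, so the exact initial state is w = (X/2) y and s
= ((1 + X)/2) y. The one ridge call costs `eps`, well within the allowance 2 · 12 · `eps`. -/
theorem projInv_zero (hlam : 0 < lam) {eps : ℝ} (heps : 0 < eps) {y s : Fin d → ℝ}
    (hs : RidgeAccurate A lam eps (Aᵀ *ᵥ (A *ᵥ y)) s) :
    ProjInv A lam (12 * eps) y 0 ((1 : ℝ) • s + (-(1 / 2) : ℝ) • y, s) := by
  have h := hs.norm_sub_le_of_gram hlam heps.le
  have hy := matNorm_nonneg (ridgeMat A lam) y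
  have h2 : eps * matNorm (ridgeMat A lam) y ≤ 2 * (12 * eps) * matNorm (ridgeMat A lam) y :=
    mul_le_mul_of_nonneg_right (by linarith) hy
  have key : ∀ i, 0 < gramEig A i + lam := fun i => ridgeEig_pos hlam i
  constructor
  · have h1 : (1 : ℝ) • s + (-(1 / 2) : ℝ) • y - stepCoeff 0 •
        (gramFun (fun t => signArg lam t * (1 - signArg lam t ^ 2) ^ 0 / 2) A *ᵥ y) =
        s - gramFun (fun t => t / (t + lam)) A *ᵥ y := by
      apply gramCoord_ext (A := A)
      intro i
      have := key i
      simp only [gramCoord_add, gramCoord_sub, gramCoord_smul, gramCoord_mulVec, stepCoeff, signArg]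
      field_simp
      ring
    simp only [h1]
    simpa [stepCoeff] using h.trans h2
  · have h1 : gramFun (fun t => stepPoly 0 (signArg lam t)) A =
        gramFun (fun t => t / (t + lam)) A := by
      apply gramFun_congr
      intro i
      have := key i
      simp only [stepPoly, stepSum, stepCoeff, signArg, zero_add, Finset.sum_range_one, pow_zero]
      field_simp
      ring
    simp only [h1]
    simpa using h.trans h2

theorem stepPoly_succ (k : ℕ) (x : ℝ) :
    stepPoly (k + 1) x = stepPoly k x + stepCoeff (k + 1) * (x * (1 - x ^ 2) ^ (k + 1) / 2) := by
  rw [stepPoly, stepPoly, stepSum, stepSum, Finset.sum_range_succ _ (k + 1)]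
  ring

/-- Write R = √(2k+1). Then √(2k+3) ≥ R + 1/(2R), so the right-hand side offers 1/R of room. The
term 2ηR takes at most 1/(5R) of it, by `hk`, and the last term takes 1/(2R). -/
theorem sqrt_step_le {eta : ℝ} {k : ℕ} (hk : eta * (2 * k + 1) ≤ 1 / 10) :
    2 * √(2 * k + 1) + (2 * eta * √(2 * k + 1) + 1 / (2 * √(2 * k + 1))) ≤
      2 * √(2 * (k + 1 : ℕ) + 1) := by
  set R := √(2 * (k : ℝ) + 1) with hR
  have hR2 : R ^ 2 = 2 * k + 1 := Real.sq_sqrt (by positivity)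
  have hRpos : 0 < R := Real.sqrt_pos.2 (by positivity)
  have hR1 : 1 ≤ R ^ 2 := by rw [hR2]; linarith [Nat.cast_nonneg (α := ℝ) k]
  have h1 : eta * R ≤ 1 / (10 * R) := by
    rw [le_div_iff₀ (by positivity)]
    rw [← hR2] at hk
    nlinarith
  have h2 : R + 1 / (2 * R) ≤ √(2 * (k + 1 : ℕ) + 1) := by
    apply Real.le_sqrt_of_sq_le
    have : (R + 1 / (2 * R)) ^ 2 = R ^ 2 + 1 + 1 / (4 * R ^ 2) := by
      field_simp
      ring
    rw [this]
    have h3 : 1 / (4 * R ^ 2) ≤ 1 := by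
      rw [div_le_one (by positivity)]
      linarith
    push_cast
    linarith
  have h3 : 2 * (1 / (10 * R)) + 1 / (2 * R) ≤ 2 * (1 / (2 * R)) := by
    have : 0 < 1 / R := by positivity
    have e1 : 1 / (10 * R) = 1 / R / 10 := by field_simp
    have e2 : 1 / (2 * R) = 1 / R / 2 := by field_simp
    rw [e1, e2]
    linarith
  linarith

/-- The factor 1 - X² does not amplify the old error. The fresh error is proportional to `w`, whose
exact size is at most the current coefficient times ‖y‖/(2√(2k+1)). Such increments sum to the
growth √(2k+1) allowed by the invariant. -/
theorem projInv_succ (hlam : 0 < lam) {eps : ℝ} (heps : 0 < eps) (heps1 : eps ≤ 1)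
    {y : Fin d → ℝ} {k : ℕ} (hk : 12 * eps * (2 * k + 1) ≤ 1 / 10)
    {ws : (Fin d → ℝ) × (Fin d → ℝ)} (hws : ProjInv A lam (12 * eps) y k ws) {r₁ r₂ : Fin d → ℝ}
    (h₁ : RidgeAccurate A lam eps (Aᵀ *ᵥ (A *ᵥ ws.1)) r₁)
    (h₂ : RidgeAccurate A lam eps (Aᵀ *ᵥ (A *ᵥ ((1 : ℝ) • ws.1 + (-1 : ℝ) • r₁))) r₂)
    {w' : Fin d → ℝ} (hw' : w' = (4 * ((2 * k + 1) / (2 * k + 2)) : ℝ) • r₂ + (0 : ℝ) • r₂) :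
    ProjInv A lam (12 * eps) y (k + 1) (w', (1 : ℝ) • ws.2 + (1 : ℝ) • w') := by
  obtain ⟨w, s⟩ := ws
  obtain ⟨hw, hs⟩ := hws
  simp only at hw hs h₁ h₂ ⊢
  set t := (1 : ℝ) • w + (-1 : ℝ) • r₁ with ht
  have key : ∀ i, 0 < gramEig A i + lam := fun i => ridgeEig_pos hlam i
  have g₁ := h₁.norm_sub_le_of_gram hlam heps.le
  have g₂ := h₂.norm_sub_le_of_gram hlam heps.le
  set N := matNorm (ridgeMat A lam) with hN
  set B := gramFun (fun t => t / (t + lam)) A with hB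
  set a : ℝ := (2 * k + 1) / (2 * k + 2) with ha
  have ha0 : 0 < a := by positivity
  set e₁ := r₁ - B *ᵥ w with he₁
  set e₂ := r₂ - B *ᵥ t with he₂
  have hadd : ∀ x y, N (x + y) ≤ N x + N y := ridgeNorm_add_le hlam
  have hsub : ∀ x y, N (x - y) ≤ N x + N y := ridgeNorm_sub_le hlam
  have hBle : ∀ x, N (B *ᵥ x) ≤ N x := fun x => by
    have h3 := ridgeNorm_gramFun_le (A := A) hlam (f := fun t => t / (t + lam)) (c := 1)
      (fun i => ?_) x
    · rwa [one_mul] at h3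
    · have h0 := gramEig_nonneg A i
      rw [abs_of_nonneg (div_nonneg h0 (key i).le), div_le_one (key i)]
      linarith
  have hCle : ∀ x, N (x - B *ᵥ x) ≤ N x := fun x => by
    have h3 := ridgeNorm_gramFun_le (A := A) hlam (f := fun t => lam / (t + lam)) (c := 1)
      (fun i => ?_) x
    · rw [one_mul] at h3
      convert h3 using 2
      apply gramCoord_ext (A := A)
      intro i
      have := key i
      simp only [hB, gramCoord_sub, gramCoord_mulVec]
      field_simp
      ring
    · rw [abs_of_nonneg (div_nonneg hlam.le (key i).le), div_le_one (key i)]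
      linarith [gramEig_nonneg A i]
  have hNw : 0 ≤ N w := matNorm_nonneg _ _
  have hNy : 0 ≤ N y := matNorm_nonneg _ _
  have ht_le : N t ≤ 2 * N w := by
    have : t = (w - B *ᵥ w) - e₁ := by
      rw [ht, he₁, one_smul, neg_one_smul]
      abel
    rw [this]
    have := hsub (w - B *ᵥ w) e₁
    have := hCle w
    nlinarith
  set V : ℕ → Fin d → ℝ := fun k =>
    gramFun (fun t => signArg lam t * (1 - signArg lam t ^ 2) ^ k / 2) A *ᵥ y with hV
  set D := gramFun (fun t => 1 - signArg lam t ^ 2) A with hD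
  have hDle : ∀ x, N (D *ᵥ x) ≤ N x := fun x => by
    have h3 := ridgeNorm_gramFun_le (A := A) hlam (f := fun t => 1 - signArg lam t ^ 2) (c := 1)
      (fun i => ?_) x
    · rwa [one_mul] at h3
    · have h0 := abs_signArg_le_one hlam (gramEig_nonneg A i)
      rw [← sq_le_one_iff_abs_le_one] at h0
      rw [abs_le]
      constructor <;> nlinarith [sq_nonneg (signArg lam (gramEig A i))]
  -- With β = t/(t + λ) one has 1 - X² = 4β(1 - β). The exact round is therefore `a` times `D`, and
  -- the two ridge errors enter as 4(e₂ - B e₁).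
  have hdec : w' - stepCoeff (k + 1) • V (k + 1) =
      a • (D *ᵥ (w - stepCoeff k • V k) + (4 : ℝ) • (e₂ - B *ᵥ e₁)) := by
    apply gramCoord_ext (A := A)
    intro i
    have := key i
    simp only [hw', hV, hD, hB, he₁, he₂, ht, gramCoord_add, gramCoord_sub, gramCoord_smul,
      gramCoord_mulVec, stepCoeff, pow_succ]
    have h4 : 1 - signArg lam (gramEig A i) ^ 2 = 4 * (gramEig A i / (gramEig A i + lam)) *
        (1 - gramEig A i / (gramEig A i + lam)) := by
      rw [signArg]
      field_simp
      ring
    rw [← ha]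
    generalize gramEig A i / (gramEig A i + lam) = β at *
    generalize signArg lam (gramEig A i) = X at *
    linear_combination (-(a * gramCoord A w i)) * h4
  have hc := stepCoeff_pos k
  set R := √(2 * (k : ℝ) + 1) with hR
  have hRpos : 0 < R := Real.sqrt_pos.2 (by positivity)
  have hVle : N (V k) ≤ 1 / (2 * R) * N y := by
    refine ridgeNorm_gramFun_le hlam (fun i => ?_) y
    have h3 := abs_mul_one_sub_sq_pow_le k (abs_signArg_le_one hlam (gramEig_nonneg A i))
    rw [abs_div, abs_two, div_le_div_iff₀ two_pos (by positivity)]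
    nlinarith
  have hwle : N w ≤ stepCoeff k * ((2 * (12 * eps) * R + 1 / (2 * R)) * N y) := by
    have h3 := hadd (w - stepCoeff k • V k) (stepCoeff k • V k)
    rw [sub_add_cancel] at h3
    have h4 : N (stepCoeff k • V k) = stepCoeff k * N (V k) := by
      rw [hN, ridgeNorm_smul hlam, abs_of_pos hc]
    have h5 := mul_le_mul_of_nonneg_left hVle hc.le
    calc N w ≤ N (w - stepCoeff k • V k) + stepCoeff k * N (V k) := by rw [← h4]; exact h3
      _ ≤ stepCoeff k * (2 * (12 * eps) * R) * N y + stepCoeff k * (1 / (2 * R) * N y) :=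
        add_le_add hw h5
      _ = _ := by ring
  have hw'le : N (w' - stepCoeff (k + 1) • V (k + 1)) ≤
      stepCoeff (k + 1) * (2 * (12 * eps) * √(2 * (k + 1 : ℕ) + 1)) * N y := by
    -- This is the origin of the 12: `e₁` costs eps · N w, `e₂` costs eps · N t ≤ 2 eps · N w, and
    -- their sum is multiplied by 4.
    have h3 : N (D *ᵥ (w - stepCoeff k • V k) + (4 : ℝ) • (e₂ - B *ᵥ e₁)) ≤
        stepCoeff k * (2 * (12 * eps) * R) * N y + 12 * eps * N w := by
      refine (hadd _ _).trans (add_le_add ((hDle _).trans hw) ?_)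
      rw [hN, ridgeNorm_smul hlam, ← hN, abs_of_pos four_pos]
      have h5 := hsub e₂ (B *ᵥ e₁)
      have h6 := hBle e₁
      nlinarith
    rw [hdec, hN, ridgeNorm_smul hlam, ← hN, abs_of_pos ha0]
    calc a * N (D *ᵥ (w - stepCoeff k • V k) + (4 : ℝ) • (e₂ - B *ᵥ e₁))
        ≤ a * (stepCoeff k * (2 * (12 * eps) * R) * N y + 12 * eps *
          (stepCoeff k * ((2 * (12 * eps) * R + 1 / (2 * R)) * N y))) :=
          mul_le_mul_of_nonneg_left
            (h3.trans (add_le_add_right (mul_le_mul_of_nonneg_left hwle (by positivity)) _)) ha0.le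
      _ = stepCoeff (k + 1) * (12 * eps) * N y *
          (2 * R + (2 * (12 * eps) * R + 1 / (2 * R))) := by
          rw [stepCoeff, ← ha]
          ring
      _ ≤ stepCoeff (k + 1) * (12 * eps) * N y * (2 * √(2 * (k + 1 : ℕ) + 1)) := by
          refine mul_le_mul_of_nonneg_left (sqrt_step_le hk) ?_
          have := stepCoeff_pos (k + 1)
          positivity
      _ = _ := by ring
  refine ⟨hw'le, ?_⟩
  have h3 : (1 : ℝ) • s + (1 : ℝ) • w' - gramFun (fun t => stepPoly (k + 1) (signArg lam t)) A *ᵥ y =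
      (s - gramFun (fun t => stepPoly k (signArg lam t)) A *ᵥ y) +
        (w' - stepCoeff (k + 1) • V (k + 1)) := by
    apply gramCoord_ext (A := A)
    intro i
    simp only [hV, gramCoord_add, gramCoord_sub, gramCoord_smul, gramCoord_mulVec, stepPoly_succ]
    ring
  simp only [h3]
  refine (hadd _ _).trans ((add_le_add hs hw'le).trans ?_)
  -- The decay of the coefficient cancels the square root, so each round adds at most 2 · 12 · `eps`
  -- · N y to the error of `s`.
  have h4 := stepCoeff_mul_sqrt_le (k + 1)
  have h5 : stepCoeff (k + 1) * (2 * (12 * eps) * √(2 * (k + 1 : ℕ) + 1)) * N y ≤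
      2 * (12 * eps) * N y := by
    have := mul_le_mul_of_nonneg_left h4 (show 0 ≤ 2 * (12 * eps) * N y by positivity)
    nlinarith
  push_cast at h5 ⊢
  linarith

theorem projInv_norm_sub_le (hlam : 0 < lam) {gam eta : ℝ} (hgam : 0 < gam)
    (hgap : ∀ i, 2 * gam ≤ |signArg lam (gramEig A i)|) {y : Fin d → ℝ} {q : ℕ}
    {ws : (Fin d → ℝ) × (Fin d → ℝ)} (h : ProjInv A lam eta y q ws) :
    matNorm (ridgeMat A lam) (ws.2 - topProj A lam *ᵥ y) ≤
      (1 / 2 * (1 - 4 * gam ^ 2) ^ (q + 1) + (q + 1) * (2 * eta)) *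
        matNorm (ridgeMat A lam) y := by
  have h1 : ws.2 - topProj A lam *ᵥ y =
      (ws.2 - gramFun (fun t => stepPoly q (signArg lam t)) A *ᵥ y) -
        gramFun (fun t => (if lam ≤ t then 1 else 0) - stepPoly q (signArg lam t)) A *ᵥ y := by
    apply gramCoord_ext (A := A)
    intro i
    simp only [topProj, gramCoord_sub, gramCoord_mulVec]
    ring
  rw [h1]
  refine (ridgeNorm_sub_le hlam _ _).trans ?_
  have h2 := ridgeNorm_gramFun_le (A := A) hlam
    (f := fun t => (if lam ≤ t then 1 else 0) - stepPoly q (signArg lam t))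
    (c := 1 / 2 * (1 - 4 * gam ^ 2) ^ (q + 1)) (fun i => ?_) y
  · linarith [h.2]
  · have hX := abs_signArg_le_one hlam (gramEig_nonneg A i)
    have hg := hgap i
    have h3 := abs_step_sub_stepPoly_le q (x := signArg lam (gramEig A i))
      (abs_pos.1 (by linarith)) hX
    simp only [signArg_nonneg_iff hlam (gramEig_nonneg A i)] at h3
    refine h3.trans ?_
    have h4 : (1 : ℝ) - signArg lam (gramEig A i) ^ 2 ≤ 1 - 4 * gam ^ 2 := by
      have : (2 * gam) ^ 2 ≤ signArg lam (gramEig A i) ^ 2 := by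
        rw [← sq_abs (signArg _ _)]
        exact pow_le_pow_left₀ (by positivity) hg 2
      linarith
    have h5 : (0 : ℝ) ≤ 1 - signArg lam (gramEig A i) ^ 2 := by
      rw [← sq_le_one_iff_abs_le_one] at hX
      linarith
    exact mul_le_mul_of_nonneg_left (pow_le_pow_left₀ h5 h4 _) (by norm_num)

end

/-! ### The pseudoinverse of the top part -/

/-- The Penrose equations determine the pseudoinverse. -/
theorem penrose_unique {T : Matrix (Fin n) (Fin d) ℝ} {X Y : Matrix (Fin d) (Fin n) ℝ}
    (hX : T * X * T = T ∧ X * T * X = X ∧ (T * X)ᵀ = T * X ∧ (X * T)ᵀ = X * T)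
    (hY : T * Y * T = T ∧ Y * T * Y = Y ∧ (T * Y)ᵀ = T * Y ∧ (Y * T)ᵀ = Y * T) : X = Y := by
  obtain ⟨hX1, hX2, hX3, hX4⟩ := hX
  obtain ⟨hY1, hY2, hY3, hY4⟩ := hY
  have h1 : T * X = T * Y := by
    calc T * X = (T * Y * T) * X := by rw [hY1]
      _ = (T * Y) * (T * X) := by rw [Matrix.mul_assoc]
      _ = (T * Y)ᵀ * (T * X)ᵀ := by rw [hX3, hY3]
      _ = ((T * X * T) * Y)ᵀ := by rw [← Matrix.transpose_mul, ← Matrix.mul_assoc]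
      _ = T * Y := by rw [hX1, hY3]
  have h2 : X * T = Y * T := by
    calc X * T = X * (T * Y * T) := by rw [hY1]
      _ = (X * T) * (Y * T) := by simp only [Matrix.mul_assoc]
      _ = (X * T)ᵀ * (Y * T)ᵀ := by rw [hX4, hY4]
      _ = (Y * (T * X * T))ᵀ := by rw [← Matrix.transpose_mul]; simp only [Matrix.mul_assoc]
      _ = Y * T := by rw [hX1, hY4]
  rw [← hX2, h2, Matrix.mul_assoc, h1, ← Matrix.mul_assoc, hY2]

theorem gram_mul_gramFun (f : ℝ → ℝ) (A : Matrix (Fin n) (Fin d) ℝ) :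
    Aᵀ * (A * gramFun f A) = gramFun (fun t => t * f t) A := by
  rw [← Matrix.mul_assoc, ← gramFun_id, gramFun_mul]

/-- The pseudoinverse on the left is defined through the spectral decomposition of another Gram
matrix, that of `topPart A lam`. The Penrose equations connect it with the functional calculus of
`A`. -/
theorem pinv_topPart {A : Matrix (Fin n) (Fin d) ℝ} {lam : ℝ} (hlam : 0 < lam) :
    pinv (topPart A lam) = gramFun (fun t => if lam ≤ t then t⁻¹ else 0) A * Aᵀ := by
  refine penrose_unique (pinv_penrose (topPart A lam)) ?_
  have hXT : gramFun (fun t => if lam ≤ t then t⁻¹ else 0) A * Aᵀ * topPart A lam =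
      gramFun (fun t => if lam ≤ t then 1 else 0) A := by
    rw [topPart, topProj, Matrix.mul_assoc, gram_mul_gramFun, gramFun_mul]
    apply gramFun_congr
    intro i
    by_cases h : lam ≤ gramEig A i
    · have : gramEig A i ≠ 0 := by linarith
      simp [h, this]
    · simp [h]
  refine ⟨?_, ?_, ?_, ?_⟩
  · rw [Matrix.mul_assoc, hXT, topPart, topProj, Matrix.mul_assoc, gramFun_mul]
    congr 2
    funext t
    split_ifs <;> simp
  · rw [hXT, ← Matrix.mul_assoc, gramFun_mul]
    congr 2
    funext t
    split_ifs <;> simp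
  · rw [topPart, topProj, Matrix.mul_assoc, ← Matrix.mul_assoc (gramFun _ A), gramFun_mul]
    simp only [Matrix.transpose_mul, Matrix.transpose_transpose, gramFun_transpose,
      Matrix.mul_assoc]
  · rw [hXT, gramFun_transpose]

/-! ### Accuracy of `ridge-pcr` -/

/-- The truncated Neumann series `∑_{i ≤ m} λ^i / (t + λ)^{i+1}` for `1/t`. -/
def neumannSum (lam t : ℝ) : ℕ → ℝ
  | 0 => (t + lam)⁻¹
  | m + 1 => (t + lam)⁻¹ + lam * (t + lam)⁻¹ * neumannSum lam t m

/-- The series is geometric with ratio λ/(t + λ), and t/(t + λ) is 1 minus that ratio. -/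
theorem mul_neumannSum {lam t : ℝ} (h : 0 < t + lam) :
    ∀ m, t * neumannSum lam t m = 1 - (lam / (t + lam)) ^ (m + 1)
  | 0 => by
    simp only [neumannSum, zero_add, pow_one]
    field_simp
    ring
  | m + 1 => by
    have ih := mul_neumannSum h m
    have h2 : t * neumannSum lam t (m + 1) =
        t / (t + lam) + lam / (t + lam) * (t * neumannSum lam t m) := by
      rw [neumannSum]
      ring
    rw [h2, ih, pow_succ _ (m + 1)]
    field_simp
    ring

theorem neumannSum_nonneg {lam t : ℝ} (hlam : 0 < lam) (ht : 0 ≤ t) :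
    ∀ m, 0 ≤ neumannSum lam t m
  | 0 => by rw [neumannSum]; positivity
  | m + 1 => by
    have := neumannSum_nonneg hlam ht m
    rw [neumannSum]
    positivity

section

variable {A : Matrix (Fin n) (Fin d) ℝ} {lam : ℝ}

/-- The iterates of `ridge-pcr`, without rounding. -/
def pcrExact (A : Matrix (Fin n) (Fin d) ℝ) (lam : ℝ) (b : Fin n → ℝ) (m : ℕ) : Fin d → ℝ :=
  gramFun (fun t => neumannSum lam t m * if lam ≤ t then 1 else 0) A *ᵥ (Aᵀ *ᵥ b)

/-- For t ≥ λ one has √(t + λ)√t ≤ 2t, and t times the Neumann sum is at most 1. The bound is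
uniform in the round, so each ridge call has error O(eps ‖b‖). -/
theorem ridgeNorm_pcrExact_le (hlam : 0 < lam) (b : Fin n → ℝ) (m : ℕ) :
    matNorm (ridgeMat A lam) (pcrExact A lam b m) ≤ 2 * norm2 b := by
  rw [ridgeNorm_eq hlam, pcrExact, Matrix.mulVec_mulVec, gramFun_mul]
  refine norm2_gramFun_transpose_le zero_le_two (fun i => ?_) b
  set t := gramEig A i
  by_cases h : lam ≤ t
  · have ht : 0 < t := hlam.trans_le h
    have h1 := neumannSum_nonneg hlam ht.le m
    rw [if_pos h, mul_one, abs_of_nonneg (by positivity)]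
    have h2 : t * neumannSum lam t m ≤ 1 := by
      rw [mul_neumannSum (by positivity)]
      have : 0 ≤ (lam / (t + lam)) ^ (m + 1) := by positivity
      linarith
    have h3 : √(t + lam) * √t ≤ 2 * t := by
      rw [← Real.sqrt_mul (by positivity)]
      apply Real.sqrt_le_iff.2
      constructor <;> nlinarith
    calc √(t + lam) * neumannSum lam t m * √t = √(t + lam) * √t * neumannSum lam t m := by ring
      _ ≤ 2 * t * neumannSum lam t m := mul_le_mul_of_nonneg_right h3 h1
      _ ≤ 2 := by linarith
  · simp [h]

/-- This converts the relative error of `pc-proj` into an absolute one. The factor `kap` lost here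
is what the tolerances must compensate. -/
theorem ridgeNorm_transpose_mulVec_le (hlam : 0 < lam) {kap : ℝ} (hkap : 1 ≤ kap)
    (heig : ∀ i, gramEig A i ≤ kap * lam) (b : Fin n → ℝ) :
    matNorm (ridgeMat A lam) (Aᵀ *ᵥ b) ≤ 2 * kap * lam * norm2 b := by
  rw [ridgeNorm_eq hlam]
  refine norm2_gramFun_transpose_le (by positivity) (fun i => ?_) b
  have h0 := gramEig_nonneg A i
  have h1 := heig i
  rw [abs_of_nonneg (Real.sqrt_nonneg _), ← Real.sqrt_mul (by positivity)]
  apply Real.sqrt_le_iff.2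
  refine ⟨by positivity, ?_⟩
  have h2 : gramEig A i + lam ≤ 2 * kap * lam := by nlinarith
  have h3 : gramEig A i ≤ 2 * kap * lam := by linarith
  have := mul_le_mul h2 h3 h0 (by positivity)
  nlinarith

/-- The eigenvalues λ/(t + λ) are at most 1, so the iteration of `ridge-pcr` passes on earlier
errors without amplifying them. -/
theorem lam_mul_ridgeNorm_inv_le (hlam : 0 < lam) (x : Fin d → ℝ) :
    lam * matNorm (ridgeMat A lam) (gramFun (fun t => (t + lam)⁻¹) A *ᵥ x) ≤
      matNorm (ridgeMat A lam) x := by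
  have h := ridgeNorm_gramFun_le (A := A) hlam (f := fun t => (t + lam)⁻¹) (c := lam⁻¹)
    (fun i => ?_) x
  · rwa [← div_eq_inv_mul, le_div_iff₀' hlam] at h
  · have := ridgeEig_pos (A := A) hlam i
    rw [abs_of_pos (inv_pos.2 this)]
    exact inv_anti₀ hlam (by linarith [gramEig_nonneg A i])

/-- The state of `ridge-pcr` is close to that of the exact iteration. -/
def PcrInv (A : Matrix (Fin n) (Fin d) ℝ) (lam : ℝ) (b : Fin n → ℝ) (theta : ℝ) (m : ℕ)
    (s : Fin d → ℝ) : Prop :=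
  matNorm (ridgeMat A lam) (s - pcrExact A lam b m) ≤ (m + 1) * theta * norm2 b

theorem PcrInv.mono {b : Fin n → ℝ} {theta theta' : ℝ} (h : theta ≤ theta') {m : ℕ}
    {s : Fin d → ℝ} (hs : PcrInv A lam b theta m s) : PcrInv A lam b theta' m s :=
  le_trans hs (mul_le_mul_of_nonneg_right (mul_le_mul_of_nonneg_left h (by positivity))
    (norm2_nonneg b))

/-- The projection error is at most ρ · 2κλ‖b‖, and M_λ⁻¹ divides it by λ. The exact answer for the
computed `y` has norm at most (2 + 1)‖b‖, the 1 coming from `hrho1`, so the ridge call adds 3 eps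
‖b‖. -/
theorem pcrInv_zero (hlam : 0 < lam) {kap rho eps : ℝ} (hkap : 1 ≤ kap)
    (heig : ∀ i, gramEig A i ≤ kap * lam) (hrho : 0 ≤ rho) (hrho1 : 2 * kap * rho ≤ 1)
    (heps : 0 ≤ eps) {b : Fin n → ℝ} {y s : Fin d → ℝ}
    (hy : matNorm (ridgeMat A lam) (y - topProj A lam *ᵥ (Aᵀ *ᵥ b)) ≤
      rho * matNorm (ridgeMat A lam) (Aᵀ *ᵥ b))
    (hs : RidgeAccurate A lam eps y s) : PcrInv A lam b (2 * kap * rho + 3 * eps) 0 s := by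
  have h1 := hs.norm_sub_le hlam
  rw [PcrInv]
  set N := matNorm (ridgeMat A lam) with hN
  set W := gramFun (fun t => (t + lam)⁻¹) A with hW
  set z := Aᵀ *ᵥ b with hz
  have hb := norm2_nonneg b
  have h2 : N (W *ᵥ (y - topProj A lam *ᵥ z)) ≤ 2 * kap * rho * norm2 b := by
    have h3 := lam_mul_ridgeNorm_inv_le (A := A) hlam (y - topProj A lam *ᵥ z)
    have h4 := mul_le_mul_of_nonneg_left (ridgeNorm_transpose_mulVec_le hlam hkap heig b) hrho
    have h5 : lam * N (W *ᵥ (y - topProj A lam *ᵥ z)) ≤ lam * (2 * kap * rho * norm2 b) := by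
      calc _ ≤ _ := h3.trans (hy.trans h4)
        _ = _ := by ring
    exact le_of_mul_le_mul_left h5 hlam
  have h6 : W *ᵥ y = W *ᵥ (y - topProj A lam *ᵥ z) + pcrExact A lam b 0 := by
    apply gramCoord_ext (A := A)
    intro i
    simp only [hW, pcrExact, topProj, neumannSum, gramCoord_add, gramCoord_sub, gramCoord_mulVec]
    ring
  have h7 : N (W *ᵥ y) ≤ 3 * norm2 b := by
    rw [h6]
    have h8 := ridgeNorm_add_le (A := A) hlam (W *ᵥ (y - topProj A lam *ᵥ z)) (pcrExact A lam b 0)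
    have h9 := ridgeNorm_pcrExact_le (A := A) hlam b 0
    nlinarith
  have h10 : s - pcrExact A lam b 0 = (s - W *ᵥ y) + W *ᵥ (y - topProj A lam *ᵥ z) := by
    rw [h6]
    abel
  rw [h10]
  have h11 := ridgeNorm_add_le (A := A) hlam (s - W *ᵥ y) (W *ᵥ (y - topProj A lam *ᵥ z))
  have h12 := mul_le_mul_of_nonneg_left h7 heps
  push_cast
  nlinarith

/-- Three errors add: θ from `s₀`, the contracted old error, and 3 eps from the new call. The
hypothesis `hm` keeps `s` below 3‖b‖, within ‖b‖ of the exact iterate. -/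
theorem pcrInv_succ (hlam : 0 < lam) {theta eps : ℝ} (heps : 0 ≤ eps) {b : Fin n → ℝ} {m : ℕ}
    (hm : (m + 1) * (theta + 3 * eps) ≤ 1) {s₀ s r : Fin d → ℝ}
    (hs₀ : PcrInv A lam b theta 0 s₀) (hs : PcrInv A lam b (theta + 3 * eps) m s)
    (hr : RidgeAccurate A lam eps s r) :
    PcrInv A lam b (theta + 3 * eps) (m + 1) ((1 : ℝ) • s₀ + lam • r) := by
  have h1 := hr.norm_sub_le hlam
  rw [PcrInv] at hs₀ hs ⊢
  set N := matNorm (ridgeMat A lam) with hN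
  set W := gramFun (fun t => (t + lam)⁻¹) A with hW
  have hb := norm2_nonneg b
  have h2 : (1 : ℝ) • s₀ + lam • r - pcrExact A lam b (m + 1) =
      (s₀ - pcrExact A lam b 0) + (lam • (W *ᵥ (s - pcrExact A lam b m)) + lam • (r - W *ᵥ s)) := by
    apply gramCoord_ext (A := A)
    intro i
    simp only [hW, pcrExact, neumannSum, gramCoord_add, gramCoord_sub, gramCoord_mulVec,
      gramCoord_smul]
    ring
  have h3 : N s ≤ 3 * norm2 b := by
    have h4 := ridgeNorm_add_le (A := A) hlam (s - pcrExact A lam b m) (pcrExact A lam b m)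
    rw [sub_add_cancel] at h4
    have h5 := ridgeNorm_pcrExact_le (A := A) hlam b m
    nlinarith
  have h6 := lam_mul_ridgeNorm_inv_le (A := A) hlam s
  have h7 := lam_mul_ridgeNorm_inv_le (A := A) hlam (s - pcrExact A lam b m)
  have h8 : N (lam • (r - W *ᵥ s)) ≤ 3 * eps * norm2 b := by
    rw [hN, ridgeNorm_smul hlam, abs_of_pos hlam]
    calc lam * N (r - W *ᵥ s) ≤ lam * (eps * N (W *ᵥ s)) := mul_le_mul_of_nonneg_left h1 hlam.le
      _ = eps * (lam * N (W *ᵥ s)) := by ring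
      _ ≤ eps * (3 * norm2 b) := mul_le_mul_of_nonneg_left (h6.trans h3) heps
      _ = _ := by ring
  have h9 : N (lam • (W *ᵥ (s - pcrExact A lam b m))) ≤ N (s - pcrExact A lam b m) := by
    rw [hN, ridgeNorm_smul hlam, abs_of_pos hlam]
    exact h7
  rw [h2]
  have h10 := ridgeNorm_add_le (A := A) hlam (lam • (W *ᵥ (s - pcrExact A lam b m)))
    (lam • (r - W *ᵥ s))
  have h11 := ridgeNorm_add_le (A := A) hlam (s₀ - pcrExact A lam b 0)
    (lam • (W *ᵥ (s - pcrExact A lam b m)) + lam • (r - W *ᵥ s))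
  push_cast at hs₀ ⊢
  linarith

/-- To the rounding error comes the Neumann tail. On t ≥ λ it is (λ/(t + λ))^{q+1} ≤ 2^{-(q+1)},
once the two factors √t, from the norm and from Aᵀ, are multiplied with 1/t. -/
theorem pcrInv_gramNorm_sub_le (hlam : 0 < lam) {b : Fin n → ℝ} {theta : ℝ} {q : ℕ} {s : Fin d → ℝ}
    (h : PcrInv A lam b theta q s) :
    matNorm (Aᵀ * A) (s - pinv (topPart A lam) *ᵥ b) ≤
      ((q + 1) * theta + (1 / 2) ^ (q + 1)) * norm2 b := by
  have h1 : s - pinv (topPart A lam) *ᵥ b = (s - pcrExact A lam b q) +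
      gramFun (fun t => (neumannSum lam t q - t⁻¹) * if lam ≤ t then 1 else 0) A *ᵥ (Aᵀ *ᵥ b) := by
    rw [pinv_topPart hlam, ← Matrix.mulVec_mulVec]
    apply gramCoord_ext (A := A)
    intro i
    simp only [pcrExact, gramCoord_add, gramCoord_sub, gramCoord_mulVec]
    split_ifs <;> ring
  rw [h1, add_mul]
  refine (gramNorm_add_le _ _ _).trans
    (add_le_add ((gramNorm_le_ridgeNorm hlam _).trans h) ?_)
  rw [gramNorm_eq, norm2_mulVec_eq, Matrix.mulVec_mulVec, gramFun_mul]
  refine norm2_gramFun_transpose_le (by positivity) (fun i => ?_) b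
  set t := gramEig A i
  by_cases hi : lam ≤ t
  · have ht : 0 < t := hlam.trans_le hi
    have h2 : (neumannSum lam t q - t⁻¹) * t = -(lam / (t + lam)) ^ (q + 1) := by
      rw [sub_mul, mul_comm, mul_neumannSum (by positivity), inv_mul_cancel₀ ht.ne']
      ring
    have h3 : √t * ((neumannSum lam t q - t⁻¹) * 1) = -(lam / (t + lam)) ^ (q + 1) / √t := by
      rw [eq_div_iff (Real.sqrt_pos.2 ht).ne', ← h2]
      linear_combination (neumannSum lam t q - t⁻¹) * Real.mul_self_sqrt ht.le
    rw [if_pos hi, h3, abs_div, abs_of_nonneg (Real.sqrt_nonneg t),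
      div_mul_cancel₀ _ (Real.sqrt_pos.2 ht).ne', abs_neg, abs_of_nonneg (by positivity)]
    refine pow_le_pow_left₀ (by positivity) ?_ _
    rw [div_le_div_iff₀ (by positivity) two_pos]
    linarith
  · rw [if_neg hi]
    simp

end

/-! ### Failure probabilities -/

/-- The output violates `Q` with probability at most `φ`, whatever the initial counters are. -/
def FailsAtMost {α : Type} (c : Comp α) (φ : ENNReal) (Q : α → Prop) : Prop :=
  ∀ t, (c.run t).toOuterMeasure {o | ¬ Q o.1} ≤ φ

theorem FailsAtMost.mono {α : Type} {c : Comp α} {φ ψ : ENNReal} {Q Q' : α → Prop}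
    (h : FailsAtMost c φ Q) (hφ : φ ≤ ψ) (hQ : ∀ a, Q a → Q' a) : FailsAtMost c ψ Q' := fun t =>
  ((c.run t).toOuterMeasure.mono fun o (ho : ¬ Q' o.1) hq => ho (hQ _ hq)).trans ((h t).trans hφ)

theorem FailsAtMost.pure {α : Type} {a : α} {Q : α → Prop} (h : Q a) :
    FailsAtMost (Pure.pure a) 0 Q := fun t => by
  change (PMF.pure (a, t)).toOuterMeasure _ ≤ 0
  simp [h]

/-- Union bound: an intermediate outcome that violates `Q` is charged its whole probability, and any
other one the fraction `ψ` of its probability. -/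
theorem FailsAtMost.bind {α β : Type} {c : Comp α} {f : α → Comp β} {φ ψ : ENNReal}
    {Q : α → Prop} {Q' : β → Prop} (hc : FailsAtMost c φ Q)
    (hf : ∀ a, Q a → FailsAtMost (f a) ψ Q') : FailsAtMost (c >>= f) (φ + ψ) Q' := fun t => by
  change ((c.run t).bind fun o => (f o.1).run o.2).toOuterMeasure _ ≤ _
  rw [PMF.toOuterMeasure_bind_apply]
  calc _ ≤ ∑' o, ({o | ¬ Q o.1}.indicator (c.run t) o + c.run t o * ψ) := by
        refine ENNReal.tsum_le_tsum fun o => ?_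
        by_cases ho : Q o.1
        · rw [Set.indicator_of_notMem (by simpa using ho), zero_add]
          exact mul_le_mul_right (hf o.1 ho o.2) _
        · rw [Set.indicator_of_mem (by simpa using ho)]
          refine le_add_right ?_
          calc _ ≤ c.run t o * 1 := mul_le_mul_right (by
                rw [PMF.toOuterMeasure_apply, ← ((f o.1).run o.2).tsum_coe]
                exact ENNReal.tsum_le_tsum fun x => Set.indicator_le_self _ _ _) _
            _ = _ := mul_one _
    _ = (c.run t).toOuterMeasure {o | ¬ Q o.1} + ψ := by
        rw [ENNReal.tsum_add, PMF.toOuterMeasure_apply, ENNReal.tsum_mul_right, PMF.tsum_coe,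
          one_mul]
    _ ≤ φ + ψ := add_le_add_left (hc t) _

/-- A step without possible failure. -/
theorem FailsAtMost.sure_bind {α β : Type} {c : Comp α} {f : α → Comp β} {ψ : ENNReal}
    {Q : α → Prop} {Q' : β → Prop} (hc : FailsAtMost c 0 Q)
    (hf : ∀ a, Q a → FailsAtMost (f a) ψ Q') : FailsAtMost (c >>= f) ψ Q' := by
  have := hc.bind hf
  rwa [zero_add] at this

theorem failsAtMost_modify (g : Tally → Tally) :
    FailsAtMost (modify g : Comp PUnit) 0 fun _ => True := fun t => by
  simp

theorem failsAtMost_linM (a : ℝ) (x : Fin d → ℝ) (b : ℝ) (y : Fin d → ℝ) :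
    FailsAtMost (linM a x b y) 0 (· = a • x + b • y) :=
  (failsAtMost_modify _).sure_bind fun _ _ => FailsAtMost.pure rfl

theorem failsAtMost_mulTM (A : Matrix (Fin n) (Fin d) ℝ) (u : Fin n → ℝ) :
    FailsAtMost (mulTM A u) 0 (· = Aᵀ *ᵥ u) :=
  (failsAtMost_modify _).sure_bind fun _ _ => FailsAtMost.pure rfl

theorem failsAtMost_gramM (A : Matrix (Fin n) (Fin d) ℝ) (x : Fin d → ℝ) :
    FailsAtMost (gramM A x) 0 (· = Aᵀ *ᵥ (A *ᵥ x)) := by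
  have h : FailsAtMost (mulM A x) 0 (· = A *ᵥ x) :=
    (failsAtMost_modify _).sure_bind fun _ _ => FailsAtMost.pure rfl
  refine h.sure_bind ?_
  rintro _ rfl
  exact failsAtMost_mulTM A _

theorem failsAtMost_callRidge {R : Routine d} {who : Caller} {eps del : ℝ} {y : Fin d → ℝ}
    {φ : ENNReal} {Q : (Fin d → ℝ) → Prop}
    (h : (R eps del y).toOuterMeasure {o | ¬ Q o.1} ≤ φ) :
    FailsAtMost (callRidge R who eps del y) φ Q := by
  have h1 : FailsAtMost (StateT.lift (R eps del y) : Comp _) φ fun o => Q o.1 := fun t => by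
    change ((R eps del y).bind fun o => PMF.pure (o, t)).toOuterMeasure _ ≤ φ
    have : ((R eps del y).bind fun o => PMF.pure (o, t)) = (R eps del y).map fun o => (o, t) := rfl
    rw [this, PMF.toOuterMeasure_map_apply]
    exact h
  have h2 := h1.bind (ψ := 0) (Q' := Q) (f := fun o => do
    modify fun c => { c with
      ridgeCalls := Function.update c.ridgeCalls who (c.ridgeCalls who + 1)
      time := c.time + o.2 }
    return o.1) fun o ho => (failsAtMost_modify _).sure_bind fun _ _ => FailsAtMost.pure ho
  rwa [add_zero] at h2

theorem FailsAtMost.forLoop {α : Type} {body : ℕ → α → Comp α} {φ : ENNReal} {I : ℕ → α → Prop}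
    {x : α} (hx : I 0 x) : ∀ {q : ℕ}, (∀ k < q, ∀ a, I k a → FailsAtMost (body k a) φ (I (k + 1))) →
      FailsAtMost (RidgePCR.forLoop body q x) (q * φ) (I q)
  | 0, _ => by
    rw [RidgePCR.forLoop, Nat.cast_zero, zero_mul]
    exact FailsAtMost.pure hx
  | q + 1, h => by
    have h1 := FailsAtMost.forLoop hx (q := q) fun k hk => h k (hk.trans (Nat.lt_succ_self q))
    have h2 := h1.bind (f := fun x' => tick 1 >>= fun _ => body q x') fun a ha =>
      (failsAtMost_modify _).sure_bind fun _ _ => h q (Nat.lt_succ_self q) a ha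
    push_cast
    rw [add_mul, one_mul]
    exact h2

theorem failsAtMost_pcProj {c₁ c₂ : ℝ} {R : Routine d} {A : Matrix (Fin n) (Fin d) ℝ} {lam : ℝ}
    {gam eps del : ℝ} (hlam : 0 < lam) (hgam : 0 < gam)
    (hgap : ∀ i, 2 * gam ≤ |signArg lam (gramEig A i)|)
    {φ : ENNReal} (heps : 0 < projTol c₂ (kappa A lam) gam eps)
    (heps1 : 12 * projTol c₂ (kappa A lam) gam eps * (2 * projIter c₁ gam eps + 1) ≤ 1 / 10)
    (hR : ∀ y, (R (projTol c₂ (kappa A lam) gam eps)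
      (projFail (projIter c₁ gam eps) del) y).toOuterMeasure
        {o | ¬ RidgeAccurate A lam (projTol c₂ (kappa A lam) gam eps) y o.1} ≤ φ)
    (y : Fin d → ℝ) :
    FailsAtMost (pcProj c₁ c₂ R A lam y gam eps del) ((2 * projIter c₁ gam eps + 1) * φ) fun s =>
      matNorm (ridgeMat A lam) (s - topProj A lam *ᵥ y) ≤
        (1 / 2 * (1 - 4 * gam ^ 2) ^ (projIter c₁ gam eps + 1) + (projIter c₁ gam eps + 1) *
          (2 * (12 * projTol c₂ (kappa A lam) gam eps))) * matNorm (ridgeMat A lam) y := by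
  unfold pcProj
  set q := projIter c₁ gam eps
  set eps' := projTol c₂ (kappa A lam) gam eps
  set del' := projFail q del
  have heps' : eps' ≤ 1 := by
    have : 0 ≤ eps' * q := by positivity
    linarith
  refine (failsAtMost_modify _).sure_bind fun _ _ => ?_
  refine (failsAtMost_modify _).sure_bind fun _ _ => ?_
  refine (failsAtMost_gramM A y).sure_bind ?_
  rintro _ rfl
  -- One call precedes the loop and each of the `q` rounds makes two.
  refine ((failsAtMost_callRidge (hR _)).bind (ψ := q * φ + q * φ) fun s hs => ?_).mono
    (le_of_eq (by ring)) fun _ h => h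
  refine (failsAtMost_linM _ _ _ _).sure_bind ?_
  rintro _ rfl
  refine ((FailsAtMost.forLoop (q := q) (φ := φ + φ) (I := ProjInv A lam (12 * eps') y)
    (projInv_zero hlam heps hs) ?_).bind (Q := ProjInv A lam (12 * eps') y q) (ψ := 0)
      (f := fun ws => pure ws.2) fun ws hws => FailsAtMost.pure
        (projInv_norm_sub_le hlam hgam hgap hws)).mono (le_of_eq (by ring)) fun _ h => h
  rintro k hk ⟨w, s⟩ hws
  refine (failsAtMost_gramM A w).sure_bind ?_
  rintro _ rfl
  refine (failsAtMost_callRidge (hR _)).bind fun r₁ hr₁ => ?_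
  refine (failsAtMost_linM _ _ _ _).sure_bind ?_
  rintro _ rfl
  refine (failsAtMost_gramM A _).sure_bind ?_
  rintro _ rfl
  refine ((failsAtMost_callRidge (hR _)).bind (ψ := 0) fun r₂ hr₂ => ?_).mono
    (le_of_eq (add_zero _)) fun _ h => h
  refine (failsAtMost_modify _).sure_bind fun _ _ => ?_
  refine (failsAtMost_linM _ _ _ _).sure_bind fun w' hw' => ?_
  refine (failsAtMost_linM _ _ _ _).sure_bind ?_
  rintro _ rfl
  refine FailsAtMost.pure (projInv_succ hlam heps heps' ?_ hws hr₁ hr₂ hw')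
  refine le_trans (mul_le_mul_of_nonneg_left ?_ (by positivity)) heps1
  have : (k : ℝ) ≤ q := by exact_mod_cast hk.le
  linarith

theorem failsAtMost_ridgePCR {p₁ p₂ c₁ c₂ : ℝ} {R : Routine d} {A : Matrix (Fin n) (Fin d) ℝ}
    {lam : ℝ} {b : Fin n → ℝ} {gam eps del : ℝ} (hlam : 0 < lam) (hkap : 1 ≤ kappa A lam)
    (heig : ∀ i, gramEig A i ≤ kappa A lam * lam) {rho : ℝ} (hrho : 0 ≤ rho) {φ ψ : ENNReal}
    (heps : 0 < pcrTol c₂ (kappa A lam) eps (pcrIter c₁ (kappa A lam) eps))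
    (hsmall : (pcrIter c₁ (kappa A lam) eps + 1) * (2 * kappa A lam * rho +
      6 * pcrTol c₂ (kappa A lam) eps (pcrIter c₁ (kappa A lam) eps)) ≤ 1)
    (hR : ∀ y, (R (pcrTol c₂ (kappa A lam) eps (pcrIter c₁ (kappa A lam) eps))
      (pcrFail (pcrIter c₁ (kappa A lam) eps) del) y).toOuterMeasure
        {o | ¬ RidgeAccurate A lam (pcrTol c₂ (kappa A lam) eps (pcrIter c₁ (kappa A lam) eps)) y
          o.1} ≤ φ)
    (hproj : ∀ z, FailsAtMost (pcProj p₁ p₂ R A lam z gam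
      (pcrTol c₂ (kappa A lam) eps (pcrIter c₁ (kappa A lam) eps)) (del / 2)) ψ fun s =>
        matNorm (ridgeMat A lam) (s - topProj A lam *ᵥ z) ≤ rho * matNorm (ridgeMat A lam) z) :
    FailsAtMost (ridgePCR p₁ p₂ c₁ c₂ R A lam b gam eps del)
      (ψ + (pcrIter c₁ (kappa A lam) eps + 1) * φ) fun s =>
      matNorm (Aᵀ * A) (s - pinv (topPart A lam) *ᵥ b) ≤
        ((pcrIter c₁ (kappa A lam) eps + 1) * (2 * kappa A lam * rho +
          6 * pcrTol c₂ (kappa A lam) eps (pcrIter c₁ (kappa A lam) eps)) +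
            (1 / 2) ^ (pcrIter c₁ (kappa A lam) eps + 1)) * norm2 b := by
  unfold ridgePCR
  set q := pcrIter c₁ (kappa A lam) eps
  set eps' := pcrTol c₂ (kappa A lam) eps q
  set kap := kappa A lam
  have hkr : 0 ≤ 2 * kap * rho := by positivity
  have h1 : 2 * kap * rho ≤ 1 := by
    have : 0 ≤ q * (2 * kap * rho + 6 * eps') := by positivity
    linarith
  refine (failsAtMost_modify _).sure_bind fun _ _ => ?_
  refine (failsAtMost_mulTM A b).sure_bind ?_
  rintro _ rfl
  refine (hproj _).bind fun y hy => ?_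
  refine ((failsAtMost_callRidge (hR _)).bind (ψ := q * φ) fun s₀ hs₀ => ?_).mono
    (le_of_eq (by ring)) fun _ h => h
  have hs₀' := pcrInv_zero hlam hkap heig hrho h1 heps.le hy hs₀
  -- The first 3 eps' belongs to `s₀`, the second is the cost of a ridge call in each round.
  have htheta : 2 * kap * rho + 6 * eps' = 2 * kap * rho + 3 * eps' + 3 * eps' := by ring
  rw [htheta] at hsmall ⊢
  refine (FailsAtMost.forLoop (φ := φ)
    (I := PcrInv A lam b (2 * kap * rho + 3 * eps' + 3 * eps'))
    (hs₀'.mono (by linarith)) ?_).mono le_rfl fun s hs => pcrInv_gramNorm_sub_le hlam hs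
  intro k hk s hs
  refine ((failsAtMost_callRidge (hR _)).bind (ψ := 0) fun r hr => ?_).mono
    (le_of_eq (add_zero _)) fun _ h => h
  refine (failsAtMost_linM _ _ _ _).mono le_rfl ?_
  rintro _ rfl
  refine pcrInv_succ hlam heps.le ?_ hs₀' hs hr
  refine le_trans (mul_le_mul_of_nonneg_right ?_ (by positivity)) hsmall
  have : (k : ℝ) ≤ q := by exact_mod_cast hk.le
  linarith

/-! ### Counting calls and steps -/

/-- The computation makes `np` calls of `pc-proj`, `a` and `b` ridge calls on behalf of `ridge-pcr`
and of `pc-proj`, and, under the hypothesis `P`, at most `τ` steps. -/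
def Uses {α : Type} (P : Prop) (c : Comp α) (np a b : ℕ) (τ : ℝ) : Prop :=
  ∀ t, ∀ o ∈ (c.run t).support, o.2.projCalls = t.projCalls + np ∧
    o.2.ridgeCalls .pcr = t.ridgeCalls .pcr + a ∧ o.2.ridgeCalls .proj = t.ridgeCalls .proj + b ∧
      (P → (o.2.time : ℝ) ≤ t.time + τ)

theorem Uses.bind {α β : Type} {P : Prop} {c : Comp α} {f : α → Comp β} {np a b np' a' b' : ℕ}
    {τ τ' : ℝ} (hc : Uses P c np a b τ) (hf : ∀ x, Uses P (f x) np' a' b' τ') :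
    Uses P (c >>= f) (np + np') (a + a') (b + b') (τ + τ') := fun t o ho => by
  change o ∈ ((c.run t).bind fun o => (f o.1).run o.2).support at ho
  rw [PMF.mem_support_bind_iff] at ho
  obtain ⟨o', ho', ho⟩ := ho
  obtain ⟨h1, h2, h3, h4⟩ := hc t o' ho'
  obtain ⟨h1', h2', h3', h4'⟩ := hf o'.1 o'.2 o ho
  refine ⟨by omega, by omega, by omega, fun hP => ?_⟩
  have := h4 hP
  have := h4' hP
  linarith

theorem uses_pure {α : Type} (P : Prop) (x : α) : Uses P (pure x) 0 0 0 0 := fun t o ho => by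
  change o ∈ (PMF.pure (x, t)).support at ho
  rw [PMF.support_pure, Set.mem_singleton_iff] at ho
  subst ho
  simp

theorem uses_tick (P : Prop) (k : ℕ) : Uses P (tick k) 0 0 0 k := fun t o ho => by
  change o ∈ (PMF.pure ((), _)).support at ho
  rw [PMF.support_pure, Set.mem_singleton_iff] at ho
  subst ho
  simp

theorem uses_countProj (P : Prop) : Uses P countProj 1 0 0 0 := fun t o ho => by
  change o ∈ (PMF.pure ((), _)).support at ho
  rw [PMF.support_pure, Set.mem_singleton_iff] at ho
  subst ho
  simp

theorem Uses.congr {α : Type} {P : Prop} {c : Comp α} {np a b np' a' b' : ℕ} {τ τ' : ℝ}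
    (h : Uses P c np a b τ) (h1 : np = np') (h2 : a = a') (h3 : b = b') (h4 : τ = τ') :
    Uses P c np' a' b' τ' := by
  subst h1 h2 h3 h4
  exact h

theorem uses_linM (P : Prop) (a : ℝ) (x : Fin d → ℝ) (b : ℝ) (y : Fin d → ℝ) :
    Uses P (linM a x b y) 0 0 0 (d + 1) :=
  ((uses_tick P _).bind fun _ => uses_pure P _).congr rfl rfl rfl (by push_cast; ring)

theorem uses_mulTM (P : Prop) (A : Matrix (Fin n) (Fin d) ℝ) (u : Fin n → ℝ) :
    Uses P (mulTM A u) 0 0 0 (nnz A + d + 1) :=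
  ((uses_tick P _).bind fun _ => uses_pure P _).congr rfl rfl rfl (by push_cast; ring)

theorem uses_gramM (P : Prop) (A : Matrix (Fin n) (Fin d) ℝ) (x : Fin d → ℝ) :
    Uses P (gramM A x) 0 0 0 (2 * nnz A + n + d + 2) :=
  (((uses_tick P _).bind fun _ => uses_pure P _).bind fun _ => uses_mulTM P A _).congr rfl rfl rfl
    (by push_cast; ring)

theorem uses_callRidge {P : Prop} {R : Routine d} {eps del : ℝ} {y : Fin d → ℝ} {τ : ℝ}
    (who : Caller) (h : P → ∀ o ∈ (R eps del y).support, (o.2 : ℝ) ≤ τ) :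
    Uses P (callRidge R who eps del y) 0 (if who = .pcr then 1 else 0)
      (if who = .proj then 1 else 0) τ := fun t o ho => by
  change o ∈ (((R eps del y).bind fun o => PMF.pure (o, t)).bind fun o =>
    (PMF.pure (PUnit.unit, (⟨o.2.projCalls,
      Function.update o.2.ridgeCalls who (o.2.ridgeCalls who + 1),
      o.2.time + o.1.2⟩ : Tally))).bind fun u => PMF.pure (o.1.1, u.2)).support at ho
  simp only [PMF.pure_bind] at ho
  simp only [PMF.mem_support_bind_iff, PMF.support_pure, Set.mem_singleton_iff] at ho
  obtain ⟨_, ⟨o', ho', rfl⟩, rfl⟩ := ho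
  refine ⟨rfl, ?_, ?_, fun hP => ?_⟩
  · cases who <;> simp
  · cases who <;> simp
  · have := h hP o' ho'
    push_cast
    linarith

theorem Uses.forLoop {α : Type} {P : Prop} {body : ℕ → α → Comp α} {np a b : ℕ} {τ : ℝ}
    (h : ∀ k x, Uses P (body k x) np a b τ) (x : α) :
    ∀ q : ℕ, Uses P (RidgePCR.forLoop body q x) (q * np) (q * a) (q * b) (q * (τ + 1))
  | 0 => by
    rw [RidgePCR.forLoop]
    simpa using uses_pure P x
  | q + 1 => ((Uses.forLoop h x q).bind fun x' => (uses_tick P 1).bind fun _ => h q x').congr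
      (by ring) (by ring) (by ring) (by push_cast; ring)

theorem uses_pcProj {P : Prop} {c₁ c₂ : ℝ} {R : Routine d} {A : Matrix (Fin n) (Fin d) ℝ} {lam : ℝ}
    {gam eps del : ℝ} {τ : ℝ}
    (h : P → ∀ y, ∀ o ∈ (R (projTol c₂ (kappa A lam) gam eps)
      (projFail (projIter c₁ gam eps) del) y).support, (o.2 : ℝ) ≤ τ) (y : Fin d → ℝ) :
    Uses P (pcProj c₁ c₂ R A lam y gam eps del) 1 0 (2 * projIter c₁ gam eps + 1)
      (2 * nnz A + n + 2 * d + 23 + τ + projIter c₁ gam eps *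
        (4 * nnz A + 2 * n + 5 * d + 18 + 2 * τ)) := by
  unfold pcProj
  have hcall := fun y => uses_callRidge Caller.proj (fun hP => h hP y)
  refine ((uses_countProj P).bind fun _ => (uses_tick P 20).bind fun _ =>
    (uses_gramM P A y).bind fun g => (hcall g).bind fun s => (uses_linM P _ _ _ _).bind fun w =>
      (Uses.forLoop (np := 0) (a := 0) (b := 2) (τ := 4 * nnz A + 2 * n + 5 * d + 17 + 2 * τ)
        (fun k ws => ?_) (w, s) _).bind fun ws => uses_pure P ws.2).congr
        (np' := 1) (a' := 0) ?_ ?_ ?_ ?_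
  · obtain ⟨w, s⟩ := ws
    exact ((uses_gramM P A w).bind fun g => (hcall g).bind fun r => (uses_linM P _ _ _ _).bind
      fun t => (uses_gramM P A t).bind fun g => (hcall g).bind fun r => (uses_tick P 10).bind
        fun _ => (uses_linM P _ _ _ _).bind fun w => (uses_linM P _ _ _ _).bind fun s =>
          uses_pure P (w, s)).congr rfl rfl rfl (by push_cast; ring)
  · simp
  · simp
  · simp; ring
  · push_cast; ring

theorem uses_ridgePCR {P : Prop} {p₁ p₂ c₁ c₂ : ℝ} {R : Routine d} {A : Matrix (Fin n) (Fin d) ℝ}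
    {lam : ℝ} {b : Fin n → ℝ} {gam eps del : ℝ} {nproj : ℕ} {τ τ' : ℝ}
    (h : P → ∀ y, ∀ o ∈ (R (pcrTol c₂ (kappa A lam) eps (pcrIter c₁ (kappa A lam) eps))
      (pcrFail (pcrIter c₁ (kappa A lam) eps) del) y).support, (o.2 : ℝ) ≤ τ)
    (hproj : ∀ z, Uses P (pcProj p₁ p₂ R A lam z gam
      (pcrTol c₂ (kappa A lam) eps (pcrIter c₁ (kappa A lam) eps)) (del / 2)) 1 0 nproj τ') :
    Uses P (ridgePCR p₁ p₂ c₁ c₂ R A lam b gam eps del) 1 (pcrIter c₁ (kappa A lam) eps + 1) nproj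
      (nnz A + d + 21 + τ' + τ + pcrIter c₁ (kappa A lam) eps * (d + 2 + τ)) := by
  unfold ridgePCR
  have hcall := fun y => uses_callRidge Caller.pcr (fun hP => h hP y)
  refine ((uses_tick P 20).bind fun _ => (uses_mulTM P A b).bind fun z => (hproj z).bind fun y =>
    (hcall y).bind fun s₀ => Uses.forLoop (fun k s => (hcall s).bind fun r =>
      uses_linM P _ _ _ _) s₀ _).congr rfl ?_ ?_ ?_
  · simp; ring
  · simp
  · push_cast; ring

/-! ### Singular values and the spectral gap -/

theorem adjoint_comp_toEuclideanLin (A : Matrix (Fin n) (Fin d) ℝ) (v : EuclideanSpace ℝ (Fin d)) :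
    (LinearMap.adjoint (Matrix.toEuclideanLin A) ∘ₗ Matrix.toEuclideanLin A) v =
      WithLp.toLp 2 ((Aᵀ * A) *ᵥ WithLp.ofLp v) := by
  rw [← Matrix.toEuclideanLin_conjTranspose_eq_adjoint,
    Matrix.conjTranspose_eq_transpose_of_trivial]
  simp [Matrix.toEuclideanLin, Matrix.toLpLin_apply, Matrix.mulVec_mulVec]

/-- Both families list eigenvalues of the same operator. It is enough that each `gramEig` occurs
among the squared singular values, so the two orderings need not be matched. -/
theorem exists_gramEig_eq (A : Matrix (Fin n) (Fin d) ℝ) (i : Fin d) :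
    ∃ j : ℕ, gramEig A i = (Matrix.toEuclideanLin A).singularValues j ^ 2 := by
  set T := Matrix.toEuclideanLin A
  have hv : Module.End.HasEigenvalue (LinearMap.adjoint T ∘ₗ T) (gramEig A i : ℝ) := by
    refine Module.End.hasEigenvalue_of_hasEigenvector
      (x := (isHermitian_gram A).eigenvectorBasis i) ⟨?_, ?_⟩
    · rw [Module.End.mem_eigenspace_iff, adjoint_comp_toEuclideanLin,
        (isHermitian_gram A).mulVec_eigenvectorBasis]
      rfl
    · exact (isHermitian_gram A).eigenvectorBasis.toBasis.ne_zero i |> fun h => by simpa using h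
  obtain ⟨j, hj⟩ := T.isSymmetric_adjoint_comp_self.exists_eigenvalues_eq
    (finrank_euclideanSpace_fin) hv
  refine ⟨j, ?_⟩
  rw [T.sq_singularValues_fin finrank_euclideanSpace_fin]
  exact hj.symm

theorem sigma_nonneg (A : Matrix (Fin n) (Fin d) ℝ) (k : ℕ) : 0 ≤ sigma A k :=
  LinearMap.singularValues_nonneg _ _

theorem gramEig_le_or_ge (A : Matrix (Fin n) (Fin d) ℝ) (i : Fin d) {k : ℕ} (hk : 1 ≤ k) :
    sigma A k ^ 2 ≤ gramEig A i ∨ gramEig A i ≤ sigma A (k + 1) ^ 2 := by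
  obtain ⟨j, hj⟩ := exists_gramEig_eq A i
  have hanti := (Matrix.toEuclideanLin A).singularValues_antitone
  have hnn := (Matrix.toEuclideanLin A).singularValues_nonneg
  rw [hj]
  -- `sigma A k` is the singular value with index `k - 1`, so no index lies strictly between the two
  -- sides of the gap.
  rcases le_or_gt j (k - 1) with h | h
  · exact Or.inl (pow_le_pow_left₀ (hnn _) (hanti h) 2)
  · refine Or.inr (pow_le_pow_left₀ (hnn _) (hanti ?_) 2)
    omega

theorem gramEig_le_sigma_one_sq (A : Matrix (Fin n) (Fin d) ℝ) (i : Fin d) :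
    gramEig A i ≤ sigma A 1 ^ 2 := by
  obtain ⟨j, hj⟩ := exists_gramEig_eq A i
  rw [hj]
  exact pow_le_pow_left₀ (LinearMap.singularValues_nonneg _ _)
    ((Matrix.toEuclideanLin A).singularValues_antitone (Nat.zero_le j)) 2

theorem norm2_mulVec_sq_le (A : Matrix (Fin n) (Fin d) ℝ) (x : Fin d → ℝ) :
    norm2 (A *ᵥ x) ^ 2 ≤ frobSq A * norm2 x ^ 2 := by
  rw [norm2_sq, norm2_sq, frobSq, Finset.sum_mul]
  refine Finset.sum_le_sum fun i _ => ?_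
  have := dotProduct_sq_le (A i) x
  rw [← sq]
  refine this.trans (le_of_eq ?_)
  simp [dotProduct, sq]

/-- Compare ‖Av‖² = σ₁²‖v‖² for a top right singular vector v with the Cauchy–Schwarz bound ‖Av‖² ≤
‖A‖_F²‖v‖². Such a v exists only if `d` is positive. -/
theorem sigma_one_sq_le_frobSq (A : Matrix (Fin n) (Fin d) ℝ) (hd : 0 < d) :
    sigma A 1 ^ 2 ≤ frobSq A := by
  set T := Matrix.toEuclideanLin A
  have h := T.hasEigenvalue_adjoint_comp_self_sq_singularValues (n := 0) (by simpa using hd)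
  obtain ⟨v, hv⟩ := h.exists_hasEigenvector
  have h1 := hv.apply_eq_smul
  rw [adjoint_comp_toEuclideanLin] at h1
  have h2 : (Aᵀ * A) *ᵥ WithLp.ofLp v = sigma A 1 ^ 2 • WithLp.ofLp v := congrArg WithLp.ofLp h1
  have h3 := norm2_mulVec_sq_le A (WithLp.ofLp v)
  have h4 : norm2 (A *ᵥ WithLp.ofLp v) ^ 2 = sigma A 1 ^ 2 * norm2 (WithLp.ofLp v) ^ 2 := by
    rw [norm2_sq, norm2_sq, Matrix.dotProduct_mulVec, Matrix.vecMul_mulVec,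
      ← Matrix.dotProduct_mulVec, h2, dotProduct_smul, smul_eq_mul]
  have h5 : 0 < norm2 (WithLp.ofLp v) ^ 2 := by
    have : norm2 (WithLp.ofLp v) = ‖v‖ := rfl
    rw [this]
    exact pow_pos (norm_pos_iff.2 hv.2) 2
  rw [h4] at h3
  exact le_of_mul_le_mul_right h3 h5

theorem pos_of_sigma_pos {A : Matrix (Fin n) (Fin d) ℝ} {k : ℕ} (h : 0 < sigma A k ^ 2) :
    0 < d := by
  by_contra hd
  have : sigma A k = 0 := LinearMap.singularValues_of_finrank_le _ (by simp; omega)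
  rw [this] at h
  simp at h

/-- What the analysis uses of the assumptions on the input. -/
structure Gapped (A : Matrix (Fin n) (Fin d) ℝ) (lam gam : ℝ) : Prop where
  lam_pos : 0 < lam
  gam_pos : 0 < gam
  gam_lt : gam < 1 / 4
  dim_pos : 0 < d
  kappa_gt : 1 < kappa A lam
  eig_le : ∀ i, gramEig A i ≤ kappa A lam * lam
  le_frobSq : kappa A lam * lam ≤ frobSq A
  gap : ∀ i, 2 * gam ≤ |signArg lam (gramEig A i)|

theorem Gapped.of_sigma {A : Matrix (Fin n) (Fin d) ℝ} {lam gam : ℝ} {k : ℕ} (hlam : 0 < lam)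
    (hgam : 0 < gam) (hk : 1 ≤ k) (h1 : 1 / (1 - 4 * gam) * sigma A (k + 1) ^ 2 ≤ lam)
    (h2 : lam ≤ (1 - 4 * gam) * sigma A k ^ 2) : Gapped A lam gam := by
  have h3 : 0 ≤ sigma A k ^ 2 := sq_nonneg _
  -- Otherwise the upper bound on `lam` would be nonpositive.
  have h4 : 0 < 1 - 4 * gam := by
    by_contra h
    nlinarith
  have h5 : 0 < sigma A k ^ 2 := by
    by_contra h
    nlinarith
  have hkl : kappa A lam * lam = sigma A 1 ^ 2 := div_mul_cancel₀ _ hlam.ne'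
  have h6 : sigma A k ^ 2 ≤ sigma A 1 ^ 2 :=
    pow_le_pow_left₀ (sigma_nonneg _ _)
      ((Matrix.toEuclideanLin A).singularValues_antitone (by simp)) 2
  refine ⟨hlam, hgam, by linarith, pos_of_sigma_pos h5, ?_, ?_, ?_, ?_⟩
  · rw [kappa, lt_div_iff₀ hlam]
    nlinarith
  · intro i
    rw [hkl]
    exact gramEig_le_sigma_one_sq A i
  · rw [hkl]
    exact sigma_one_sq_le_frobSq A (pos_of_sigma_pos h5)
  · intro i
    have hi := ridgeEig_pos (A := A) hlam i
    have h0 := gramEig_nonneg A i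
    rw [one_div, inv_mul_le_iff₀ h4] at h1
    rw [signArg, abs_div, abs_of_pos hi, le_div_iff₀ hi]
    rcases gramEig_le_or_ge A i hk with h | h
    -- Above the gap, t - λ ≥ 4γt ≥ 2γ(t + λ), as t ≥ λ. Below it, λ - t ≥ 4γλ ≥ 2γ(t + λ), as t ≤
    -- λ.
    · have h7 : lam ≤ (1 - 4 * gam) * gramEig A i :=
        h2.trans (mul_le_mul_of_nonneg_left h h4.le)
      have h8 : lam ≤ gramEig A i := by nlinarith
      refine le_trans ?_ (le_abs_self _)
      nlinarith [mul_nonneg hgam.le (sub_nonneg.2 h8)]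
    · have h7 : gramEig A i ≤ (1 - 4 * gam) * lam := h.trans h1
      have h8 : gramEig A i ≤ lam := by nlinarith
      refine le_trans ?_ (neg_le_abs _)
      nlinarith [mul_nonneg hgam.le (sub_nonneg.2 h8)]

/-! ### The parameters of the algorithms -/

/-- The assumptions on the constants of the algorithms. -/
structure GoodConstants (p₁ p₂ c₁ c₂ : ℝ) : Prop where
  p₁_ge : 2 ≤ p₁
  c₁_ge : 2 ≤ c₁
  p₂_ge : 500 * (p₁ + 2) ≤ p₂
  c₂_ge : 500 * (p₁ + 2) ≤ c₂

section Parameters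

variable {p₁ p₂ c₁ c₂ kap gam eps del : ℝ}

theorem log_div_pos (hkap : 1 < kap) (heps : 0 < eps) (heps1 : eps < 1) :
    0 < Real.log (kap / eps) :=
  Real.log_pos ((one_lt_div heps).2 (by linarith))

theorem one_le_pcrIter (hc₁ : 2 ≤ c₁) (hkap : 1 < kap) (heps : 0 < eps) (heps1 : eps < 1) :
    1 ≤ pcrIter c₁ kap eps := by
  have := log_div_pos hkap heps heps1
  exact Nat.one_le_ceil_iff.2 (by positivity)

theorem pcrIter_le (hc₁ : 2 ≤ c₁) (hkap : 1 < kap) (heps : 0 < eps) (heps1 : eps < 1) :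
    (pcrIter c₁ kap eps : ℝ) ≤ c₁ * Real.log (kap / eps) + 1 := by
  have := log_div_pos hkap heps heps1
  exact (Nat.ceil_lt_add_one (by positivity)).le

/-- As `c₁` ≥ 2 and log 2 > 1/2, already 2^q ≥ 1/ε. The exponent q + 1 supplies the extra factor
1/2, which leaves half of ε for rounding. -/
theorem half_pow_pcrIter_le (hc₁ : 2 ≤ c₁) (hkap : 1 < kap) (heps : 0 < eps) (heps1 : eps < 1) :
    (1 / 2 : ℝ) ^ (pcrIter c₁ kap eps + 1) ≤ eps / 2 := by
  have hL := log_div_pos hkap heps heps1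
  have h1 : c₁ * Real.log (kap / eps) ≤ pcrIter c₁ kap eps := Nat.le_ceil _
  have h2 : Real.log (1 / eps) ≤ Real.log (kap / eps) :=
    Real.log_le_log (by positivity) (div_le_div_of_nonneg_right hkap.le heps.le)
  have h3 : 1 / 2 < Real.log 2 := by linarith [Real.log_two_gt_d9]
  have h4 : Real.log (1 / eps) ≤ pcrIter c₁ kap eps * Real.log 2 := by
    nlinarith
  have h5 : 1 / eps ≤ 2 ^ pcrIter c₁ kap eps := by
    rw [← Real.log_le_log_iff (by positivity) (by positivity), Real.log_pow]
    exact h4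
  rw [pow_succ, one_div, inv_pow]
  have h6 : (2 ^ pcrIter c₁ kap eps : ℝ)⁻¹ ≤ eps := by
    rw [inv_le_comm₀ (by positivity) heps, ← one_div]
    exact h5
  linarith

theorem pcrTol_pos (hc₂ : 0 < c₂) (hkap : 1 < kap) (heps : 0 < eps) {q : ℕ} (hq : 1 ≤ q) :
    0 < pcrTol c₂ kap eps q := by
  have : 0 < √kap := Real.sqrt_pos.2 (by linarith)
  have : (0 : ℝ) < q := by exact_mod_cast hq
  rw [pcrTol]
  positivity

/-- The tolerance of `ridge-pcr` makes up for the conditioning and for the number of rounds. -/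
theorem mul_sqrt_mul_pcrTol_le (hc₂ : 0 < c₂) (hkap : 1 < kap) (heps : 0 < eps) {q : ℕ}
    (hq : 1 ≤ q) : q * √kap * pcrTol c₂ kap eps q ≤ eps / c₂ := by
  have : 0 < √kap := Real.sqrt_pos.2 (by linarith)
  have hq' : (1 : ℝ) ≤ q := by exact_mod_cast hq
  have h : q * √kap * pcrTol c₂ kap eps q = eps / c₂ / q := by
    rw [pcrTol]
    field_simp
  rw [h]
  exact div_le_self (by positivity) hq'

theorem pcrTol_le (hc₂ : 0 < c₂) (hkap : 1 < kap) (heps : 0 < eps) {q : ℕ} (hq : 1 ≤ q) :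
    pcrTol c₂ kap eps q ≤ eps / c₂ := by
  refine le_trans ?_ (mul_sqrt_mul_pcrTol_le hc₂ hkap heps hq)
  have h1 : 1 ≤ √kap := Real.one_le_sqrt.2 hkap.le
  have hq' : (1 : ℝ) ≤ q := by exact_mod_cast hq
  exact le_mul_of_one_le_left (pcrTol_pos hc₂ hkap heps hq).le (by nlinarith)

theorem log_one_div_pcrTol_le (hc₁ : 2 ≤ c₁) (hc₂ : 0 < c₂) (hkap : 1 < kap) (heps : 0 < eps)
    (heps1 : eps < 1) :
    Real.log (1 / pcrTol c₂ kap eps (pcrIter c₁ kap eps)) ≤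
      (c₂ + 2 * c₁ + 3) * (1 + Real.log (kap / eps)) := by
  have hq := one_le_pcrIter hc₁ hkap heps heps1
  have hqle := pcrIter_le hc₁ hkap heps heps1
  set q := pcrIter c₁ kap eps
  have hs : 0 < √kap := Real.sqrt_pos.2 (by linarith)
  have hq' : (0 : ℝ) < q := by exact_mod_cast hq
  have hL := log_div_pos hkap heps heps1
  have h1 : 1 / pcrTol c₂ kap eps q = c₂ * (q ^ 2 * (√kap / eps)) := by
    rw [pcrTol]
    field_simp
  rw [h1, Real.log_mul hc₂.ne' (by positivity), Real.log_mul (by positivity) (by positivity),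
    Real.log_pow]
  have h2 : Real.log (√kap / eps) ≤ Real.log (kap / eps) := by
    refine Real.log_le_log (by positivity) (div_le_div_of_nonneg_right ?_ heps.le)
    rw [Real.sqrt_le_left (by linarith)]
    nlinarith
  have h3 := Real.log_le_sub_one_of_pos hc₂
  have h4 := Real.log_le_sub_one_of_pos hq'
  push_cast
  nlinarith

theorem projTol_pos (hp₂ : 0 < p₂) (hkap : 1 < kap) (hgam : 0 < gam) (heps : 0 < eps) :
    0 < projTol p₂ kap gam eps := by
  have : 0 < √kap := Real.sqrt_pos.2 (by linarith)
  rw [projTol]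
  positivity

theorem projTol_lt_one (hp₂ : 1 ≤ p₂) (hkap : 1 < kap) (hgam : 0 < gam) (hgam1 : gam < 1)
    (heps : 0 < eps) (heps1 : eps < 1) : projTol p₂ kap gam eps < 1 := by
  have h1 : 1 ≤ √kap := Real.one_le_sqrt.2 hkap.le
  rw [projTol, inv_mul_lt_iff₀ (by linarith), div_lt_iff₀ (by linarith)]
  have h2 : eps ^ 2 < 1 := by nlinarith
  have h3 : gam ^ 2 < 1 := by nlinarith
  have h4 : eps ^ 2 * gam ^ 2 < 1 := by nlinarith [sq_nonneg eps, sq_nonneg gam]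
  nlinarith

theorem projIter_le (hp₁ : 2 ≤ p₁) (heps : 0 < eps) (heps1 : eps < 1) :
    (projIter p₁ gam eps : ℝ) ≤ p₁ * (gam ^ 2)⁻¹ * Real.log (1 / eps) + 1 := by
  have : 0 < Real.log (1 / eps) := Real.log_pos ((one_lt_div heps).2 heps1)
  exact (Nat.ceil_lt_add_one (by positivity)).le

/-- The crude bound log(1/ε) ≤ 1/ε gives γ²(q + 1) ≤ (p₁ + 2)/ε. One of the two factors ε in
`projTol` is spent on this, and `p₂` ≥ 500(p₁ + 2) yields the constant. -/
theorem projIter_succ_mul_projTol_le (hp₁ : 2 ≤ p₁) (hp₂ : 500 * (p₁ + 2) ≤ p₂) (hkap : 1 < kap)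
    (hgam : 0 < gam) (hgam1 : gam < 1) (heps : 0 < eps) (heps1 : eps < 1) :
    √kap * ((projIter p₁ gam eps + 1) * projTol p₂ kap gam eps) ≤ eps / 500 := by
  have h1 := projIter_le (gam := gam) hp₁ heps heps1
  have h2 := Real.log_le_sub_one_of_pos (one_div_pos.2 heps)
  have hs : 0 < √kap := Real.sqrt_pos.2 (by linarith)
  have h3 : √kap * ((projIter p₁ gam eps + 1) * projTol p₂ kap gam eps) =
      (gam ^ 2 * (projIter p₁ gam eps + 1)) * eps ^ 2 / p₂ := by
    rw [projTol]
    field_simp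
  have h4 : gam ^ 2 * (projIter p₁ gam eps + 1) ≤ (p₁ + 2) / eps := by
    calc gam ^ 2 * (projIter p₁ gam eps + 1 : ℝ)
        ≤ gam ^ 2 * (p₁ * (gam ^ 2)⁻¹ * Real.log (1 / eps) + 1 + 1) :=
          mul_le_mul_of_nonneg_left (by linarith) (sq_nonneg _)
      _ = p₁ * Real.log (1 / eps) + 2 * gam ^ 2 := by
          field_simp
          ring
      _ ≤ p₁ * (1 / eps) + 2 * (1 / eps) := by
          have h5 : 1 ≤ 1 / eps := (one_le_div heps).2 heps1.le
          have h6 : gam ^ 2 ≤ 1 := by nlinarith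
          have h7 : p₁ * Real.log (1 / eps) ≤ p₁ * (1 / eps) :=
            mul_le_mul_of_nonneg_left (by linarith) (by linarith)
          linarith
      _ = (p₁ + 2) / eps := by ring
  have hp : 0 < p₂ := by linarith
  rw [h3, div_le_div_iff₀ hp (by norm_num)]
  have h5 := mul_le_mul_of_nonneg_right h4 (sq_nonneg eps)
  have h6 : (p₁ + 2) / eps * eps ^ 2 = (p₁ + 2) * eps := by
    field_simp
  rw [h6] at h5
  nlinarith

/-- Since 1 - 4γ² ≤ exp(-4γ²), the choice of the number of rounds gives more than enough decay. The
square on the right is needed: the error is later multiplied by κ, and each factor `eps` will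
contain 1/√κ. -/
theorem pow_projIter_le (hp₁ : 2 ≤ p₁) (hgam : 0 < gam) (hgam1 : gam < 1 / 4) (heps : 0 < eps)
    (heps1 : eps < 1) : (1 - 4 * gam ^ 2) ^ (projIter p₁ gam eps + 1) ≤ eps ^ 2 := by
  have hL : 0 < Real.log (1 / eps) := Real.log_pos ((one_lt_div heps).2 heps1)
  have h1 : p₁ * (gam ^ 2)⁻¹ * Real.log (1 / eps) ≤ projIter p₁ gam eps := Nat.le_ceil _
  have h2 : 1 - 4 * gam ^ 2 ≤ Real.exp (-(4 * gam ^ 2)) := by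
    linarith [Real.add_one_le_exp (-(4 * gam ^ 2))]
  have h3 : 0 ≤ 1 - 4 * gam ^ 2 := by nlinarith
  have h4 : p₁ * Real.log (1 / eps) ≤ gam ^ 2 * projIter p₁ gam eps := by
    have := mul_le_mul_of_nonneg_left h1 (sq_nonneg gam)
    have h5 : gam ^ 2 * (p₁ * (gam ^ 2)⁻¹ * Real.log (1 / eps)) = p₁ * Real.log (1 / eps) := by
      field_simp
    linarith
  calc (1 - 4 * gam ^ 2) ^ (projIter p₁ gam eps + 1)
      ≤ Real.exp (-(4 * gam ^ 2)) ^ (projIter p₁ gam eps + 1) := pow_le_pow_left₀ h3 h2 _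
    _ = Real.exp (-(4 * gam ^ 2 * (projIter p₁ gam eps + 1))) := by
        rw [← Real.exp_nat_mul]
        push_cast
        ring_nf
    _ ≤ Real.exp (Real.log eps + Real.log eps) := by
        apply Real.exp_le_exp.2
        rw [one_div, Real.log_inv] at hL h4
        nlinarith [sq_nonneg gam]
    _ = eps ^ 2 := by
        rw [Real.exp_add, Real.exp_log heps, sq]

end Parameters

/-! ### The reduction -/

theorem PMF.toOuterMeasure_compl {α : Type} (p : PMF α) (s : Set α) :
    p.toOuterMeasure s + p.toOuterMeasure sᶜ = 1 := by
  rw [PMF.toOuterMeasure_apply, PMF.toOuterMeasure_apply, ← ENNReal.tsum_add, ← p.tsum_coe]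
  exact tsum_congr fun a => Set.indicator_self_add_compl_apply s p a

theorem PMF.toOuterMeasure_compl_le {α : Type} {p : PMF α} {s : Set α} {δ : ℝ}
    (h : ENNReal.ofReal (1 - δ) ≤ p.toOuterMeasure s) :
    p.toOuterMeasure sᶜ ≤ ENNReal.ofReal δ := by
  have h1 := PMF.toOuterMeasure_compl p s
  have h2 : ENNReal.ofReal (1 - δ) + p.toOuterMeasure sᶜ ≤
      ENNReal.ofReal (1 - δ) + ENNReal.ofReal δ := by
    calc _ ≤ 1 := by rw [← h1]; exact add_le_add_left h _
      _ = ENNReal.ofReal ((1 - δ) + δ) := by simp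
      _ ≤ _ := ENNReal.ofReal_add_le
  exact (ENNReal.add_le_add_iff_left ENNReal.ofReal_ne_top).1 h2

theorem PMF.le_toOuterMeasure_of_compl {α : Type} {p : PMF α} {s : Set α} {δ : ℝ} (hδ : 0 ≤ δ)
    (h : p.toOuterMeasure sᶜ ≤ ENNReal.ofReal δ) :
    ENNReal.ofReal (1 - δ) ≤ p.toOuterMeasure s := by
  have h1 := PMF.toOuterMeasure_compl p s
  rw [ENNReal.ofReal_sub _ hδ, ENNReal.ofReal_one, tsub_le_iff_right, ← h1]
  exact add_le_add_right h _

section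

variable {p₁ p₂ c₁ c₂ : ℝ} {A : Matrix (Fin n) (Fin d) ℝ} {lam gam eps del : ℝ}

theorem failsAtMost_ridgePCR_of_gapped (C : GoodConstants p₁ p₂ c₁ c₂) (G : Gapped A lam gam)
    (heps : 0 < eps) (heps1 : eps < 1) {R : Routine d} (b : Fin n → ℝ) {φ ψ : ENNReal}
    (hR : ∀ y, (R (pcrTol c₂ (kappa A lam) eps (pcrIter c₁ (kappa A lam) eps))
      (pcrFail (pcrIter c₁ (kappa A lam) eps) del) y).toOuterMeasure
        {o | ¬ RidgeAccurate A lam (pcrTol c₂ (kappa A lam) eps (pcrIter c₁ (kappa A lam) eps)) y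
          o.1} ≤ φ)
    (hR' : ∀ y, (R (projTol p₂ (kappa A lam) gam
        (pcrTol c₂ (kappa A lam) eps (pcrIter c₁ (kappa A lam) eps)))
      (projFail (projIter p₁ gam (pcrTol c₂ (kappa A lam) eps (pcrIter c₁ (kappa A lam) eps)))
        (del / 2)) y).toOuterMeasure
        {o | ¬ RidgeAccurate A lam (projTol p₂ (kappa A lam) gam
          (pcrTol c₂ (kappa A lam) eps (pcrIter c₁ (kappa A lam) eps))) y o.1} ≤ ψ) :
    FailsAtMost (ridgePCR p₁ p₂ c₁ c₂ R A lam b gam eps del)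
      ((2 * projIter p₁ gam (pcrTol c₂ (kappa A lam) eps (pcrIter c₁ (kappa A lam) eps)) + 1) * ψ +
        (pcrIter c₁ (kappa A lam) eps + 1) * φ) fun s =>
      matNorm (Aᵀ * A) (s - pinv (topPart A lam) *ᵥ b) ≤ eps * norm2 b := by
  obtain ⟨hp₁, hc₁, hp₂, hc₂⟩ := C
  have hkap := G.kappa_gt
  have hgam := G.gam_pos
  have hc₂0 : 0 < c₂ := by linarith
  have hp₂0 : 0 < p₂ := by linarith
  have hq := one_le_pcrIter hc₁ hkap heps heps1
  have hhalf := half_pow_pcrIter_le hc₁ hkap heps heps1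
  set q := pcrIter c₁ (kappa A lam) eps with hqdef
  have htol := pcrTol_pos hc₂0 hkap heps hq
  have hmul := mul_sqrt_mul_pcrTol_le hc₂0 hkap heps hq
  have hle := pcrTol_le hc₂0 hkap heps hq
  set e := pcrTol c₂ (kappa A lam) eps q with he
  set kap := kappa A lam with hk
  -- `c₂` ≥ 500(p₁ + 2) ≥ 2000.
  have hec : eps / c₂ ≤ eps / 2000 := div_le_div_of_nonneg_left heps.le (by norm_num) (by linarith)
  have he1 : e < 1 := by linarith
  have hstep := projIter_succ_mul_projTol_le (gam := gam) hp₁ hp₂ hkap hgam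
    (by linarith [G.gam_lt]) htol he1
  have hpow := pow_projIter_le hp₁ hgam G.gam_lt htol he1
  have hptol := projTol_pos hp₂0 hkap hgam htol
  set Q := projIter p₁ gam e with hQ
  set e' := projTol p₂ kap gam e with he'
  have hs1 : 1 ≤ √kap := Real.one_le_sqrt.2 hkap.le
  have hss : √kap * √kap = kap := Real.mul_self_sqrt (by linarith)
  have hq' : (1 : ℝ) ≤ q := by exact_mod_cast hq
  -- The first term is the truncation error of the step polynomial. In the second, 24 = 2 · 12 comes
  -- from the rounding bound of `projInv_norm_sub_le`.
  set rho : ℝ := 1 / 2 * e ^ 2 + 24 * ((Q + 1) * e') with hrho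
  have hQe : 0 ≤ (Q + 1) * e' := by positivity
  have hrho0 : 0 ≤ rho := by positivity
  have hproj : ∀ z, FailsAtMost (pcProj p₁ p₂ R A lam z gam e (del / 2)) ((2 * Q + 1) * ψ)
      fun s => matNorm (ridgeMat A lam) (s - topProj A lam *ᵥ z) ≤
        rho * matNorm (ridgeMat A lam) z := fun z => by
    refine (failsAtMost_pcProj G.lam_pos hgam G.gap hptol ?_ hR' z).mono le_rfl fun s hs =>
      hs.trans (mul_le_mul_of_nonneg_right ?_ (matNorm_nonneg _ _))
    · have h1 : (Q + 1) * e' ≤ e / 500 := by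
        refine le_trans ?_ hstep
        exact le_mul_of_one_le_left hQe hs1
      rw [← he', ← hQ]
      nlinarith
    · rw [← he', ← hQ, hrho]
      linarith
  -- The other half of ε is reserved for the Neumann tail. In q κ e² each factor e pays for one √κ.
  -- In q κ (Q + 1) e' one √κ is absorbed by e and the other by `projTol`.
  have hsmall : (q + 1) * (2 * kap * rho + 6 * e) ≤ eps / 2 := by
    have h1 : q * √kap * e * (√kap * e) ≤ eps / c₂ := by
      have h2 : √kap * e ≤ 1 := by
        have : 1 * (√kap * e) ≤ q * (√kap * e) :=
          mul_le_mul_of_nonneg_right hq' (by positivity)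
        linarith
      calc _ ≤ q * √kap * e * 1 := mul_le_mul_of_nonneg_left h2 (by positivity)
        _ ≤ _ := by linarith
    have h3 : q * kap * ((Q + 1) * e') ≤ eps / c₂ / 500 := by
      calc q * kap * ((Q + 1) * e') = q * √kap * (√kap * ((Q + 1) * e')) := by
            linear_combination (-(q * ((Q + 1) * e'))) * hss
        _ ≤ q * √kap * (e / 500) := mul_le_mul_of_nonneg_left hstep (by positivity)
        _ ≤ _ := by linarith
    have h4 : q * e ≤ eps / c₂ := by
      refine le_trans ?_ hmul
      have : 0 ≤ q * e := by positivity
      nlinarith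
    have h5 : q * kap * e ^ 2 ≤ eps / c₂ := by
      refine le_trans (le_of_eq ?_) h1
      linear_combination (-(q * e ^ 2)) * hss
    have h6 : q * (2 * kap * rho + 6 * e) =
        q * kap * e ^ 2 + 48 * (q * kap * ((Q + 1) * e')) + 6 * (q * e) := by
      rw [hrho]
      ring
    have h7 : 0 ≤ 2 * kap * rho + 6 * e := by positivity
    nlinarith
  refine (failsAtMost_ridgePCR G.lam_pos hkap.le G.eig_le hrho0 htol ?_ hR hproj).mono le_rfl
    fun s hs => hs.trans (mul_le_mul_of_nonneg_right ?_ (norm2_nonneg b))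
  · linarith
  · linarith

theorem pcrFail_mem (hdel : 0 < del) (hdel1 : del < 1) (q : ℕ) :
    0 < pcrFail q del ∧ pcrFail q del < 1 := by
  rw [pcrFail, div_lt_one (by positivity)]
  exact ⟨by positivity, by linarith [Nat.cast_nonneg (α := ℝ) q]⟩

theorem projFail_mem (hdel : 0 < del) (hdel1 : del < 1) (q : ℕ) :
    0 < projFail q del ∧ projFail q del < 1 := by
  rw [projFail, div_lt_one (by positivity)]
  exact ⟨by positivity, by linarith [Nat.cast_nonneg (α := ℝ) q]⟩

theorem tolerances_mem (C : GoodConstants p₁ p₂ c₁ c₂) (G : Gapped A lam gam) (heps : 0 < eps)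
    (heps1 : eps < 1) :
    (0 < pcrTol c₂ (kappa A lam) eps (pcrIter c₁ (kappa A lam) eps) ∧
      pcrTol c₂ (kappa A lam) eps (pcrIter c₁ (kappa A lam) eps) < 1) ∧
    (0 < projTol p₂ (kappa A lam) gam
        (pcrTol c₂ (kappa A lam) eps (pcrIter c₁ (kappa A lam) eps)) ∧
      projTol p₂ (kappa A lam) gam
        (pcrTol c₂ (kappa A lam) eps (pcrIter c₁ (kappa A lam) eps)) < 1) := by
  obtain ⟨hp₁, hc₁, hp₂, hc₂⟩ := C
  have hc₂0 : 0 < c₂ := by linarith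
  have hq := one_le_pcrIter hc₁ G.kappa_gt heps heps1
  have h0 := pcrTol_pos hc₂0 G.kappa_gt heps hq
  have h1 := pcrTol_le hc₂0 G.kappa_gt heps hq
  have h2 : eps / c₂ ≤ eps := div_le_self heps.le (by linarith)
  have h3 := G.gam_lt
  exact ⟨⟨h0, by linarith⟩, projTol_pos (by linarith) G.kappa_gt G.gam_pos h0,
    projTol_lt_one (by linarith) G.kappa_gt G.gam_pos (by linarith) h0 (by linarith)⟩

theorem runPCR_accurate (C : GoodConstants p₁ p₂ c₁ c₂) (G : Gapped A lam gam) (heps : 0 < eps)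
    (heps1 : eps < 1) (hdel : 0 < del) (hdel1 : del < 1) {R : Routine d} (b : Fin n → ℝ)
    (hR : RidgeSpec A lam R) :
    ENNReal.ofReal (1 - del) ≤ (runPCR p₁ p₂ c₁ c₂ R A lam b gam eps del).toOuterMeasure
      {o | matNorm (Aᵀ * A) (o.1 - pinv (topPart A lam) *ᵥ b) ≤ eps * norm2 b} := by
  obtain ⟨⟨h1, h2⟩, h3, h4⟩ := tolerances_mem C G heps heps1
  obtain ⟨h5, h6⟩ := pcrFail_mem hdel hdel1 (pcrIter c₁ (kappa A lam) eps)
  obtain ⟨h7, h8⟩ := projFail_mem (del := del / 2) (by linarith) (by linarith)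
    (projIter p₁ gam (pcrTol c₂ (kappa A lam) eps (pcrIter c₁ (kappa A lam) eps)))
  have h := failsAtMost_ridgePCR_of_gapped C G heps heps1 b (del := del)
    (fun y => PMF.toOuterMeasure_compl_le (hR _ _ h1 h2 h5 h6 y))
    (fun y => PMF.toOuterMeasure_compl_le (hR _ _ h3 h4 h7 h8 y)) Tally.zero
  refine PMF.le_toOuterMeasure_of_compl hdel.le (h.trans (le_of_eq ?_))
  rw [pcrFail, projFail]
  generalize pcrIter c₁ (kappa A lam) eps = q
  generalize projIter p₁ gam (pcrTol c₂ (kappa A lam) eps q) = Q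
  have e1 : (2 * (Q : ENNReal) + 1) = ENNReal.ofReal (2 * Q + 1) := by
    rw [ENNReal.ofReal_add (by positivity) zero_le_one, ENNReal.ofReal_mul zero_le_two]
    simp
  have e2 : ((q : ENNReal) + 1) = ENNReal.ofReal (q + 1) := by
    rw [ENNReal.ofReal_add (by positivity) zero_le_one]
    simp
  rw [e1, e2, ← ENNReal.ofReal_mul (by positivity), ← ENNReal.ofReal_mul (by positivity),
    ← ENNReal.ofReal_add (by positivity) (by positivity)]
  -- The 2Q + 1 calls with failure rate (δ/2)/(2Q + 1) and the q + 1 calls with rate δ/(2(q + 1))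
  -- add up to exactly δ.
  congr 1
  field_simp
  ring

theorem runPCR_sure (C : GoodConstants p₁ p₂ c₁ c₂) (G : Gapped A lam gam) (heps : 0 < eps)
    (heps1 : eps < 1) (hdel : 0 < del) (hdel1 : del < 1) {R : Routine d} (b : Fin n → ℝ)
    (hR : SureRidgeSpec A lam R) :
    ∀ o ∈ (runPCR p₁ p₂ c₁ c₂ R A lam b gam eps del).support,
      matNorm (Aᵀ * A) (o.1 - pinv (topPart A lam) *ᵥ b) ≤ eps * norm2 b := by
  obtain ⟨⟨h1, h2⟩, h3, h4⟩ := tolerances_mem C G heps heps1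
  obtain ⟨h5, h6⟩ := pcrFail_mem hdel hdel1 (pcrIter c₁ (kappa A lam) eps)
  obtain ⟨h7, h8⟩ := projFail_mem (del := del / 2) (by linarith) (by linarith)
    (projIter p₁ gam (pcrTol c₂ (kappa A lam) eps (pcrIter c₁ (kappa A lam) eps)))
  have hz : ∀ e δ, 0 < e → e < 1 → 0 < δ → δ < 1 → ∀ y,
      (R e δ y).toOuterMeasure {o | ¬ RidgeAccurate A lam e y o.1} ≤ 0 := by
    intro e δ he he1 hδ hδ1 y
    rw [nonpos_iff_eq_zero, PMF.toOuterMeasure_apply_eq_zero_iff, Set.disjoint_left]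
    exact fun o ho hn => hn (hR e δ he he1 hδ hδ1 y o ho)
  have h := failsAtMost_ridgePCR_of_gapped C G heps heps1 b (del := del)
    (hz _ _ h1 h2 h5 h6) (hz _ _ h3 h4 h7 h8) Tally.zero
  rw [mul_zero, mul_zero, add_zero, nonpos_iff_eq_zero, PMF.toOuterMeasure_apply_eq_zero_iff,
    Set.disjoint_left] at h
  intro o ho
  by_contra hn
  exact h ho hn

/-- The constant in the bound for the number of ridge calls of `pc-proj`. -/
def projConst (p₁ c₁ c₂ : ℝ) : ℝ := 2 * p₁ * (c₂ + 2 * c₁ + 3) + 3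

/-- The constant in the bound for the running time. -/
def timeConst (p₁ c₁ c₂ : ℝ) : ℝ := 50 * (c₁ + 2) + 25 * projConst p₁ c₁ c₂

theorem one_le_inv_sq (G : Gapped A lam gam) : 1 ≤ (gam ^ 2)⁻¹ := by
  have h1 := G.gam_pos
  have h2 := G.gam_lt
  exact (one_le_inv₀ (by positivity)).2 (by nlinarith)

theorem pcrIter_succ_le (C : GoodConstants p₁ p₂ c₁ c₂) (G : Gapped A lam gam) (heps : 0 < eps)
    (heps1 : eps < 1) :
    (pcrIter c₁ (kappa A lam) eps + 1 : ℝ) ≤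
      (c₁ + 2) * (1 + Real.log (kappa A lam / eps)) := by
  have h1 := pcrIter_le C.c₁_ge G.kappa_gt heps heps1
  have h2 := log_div_pos G.kappa_gt heps heps1
  have h3 := C.c₁_ge
  nlinarith

theorem two_mul_projIter_succ_le (C : GoodConstants p₁ p₂ c₁ c₂) (G : Gapped A lam gam)
    (heps : 0 < eps) (heps1 : eps < 1) :
    (2 * projIter p₁ gam (pcrTol c₂ (kappa A lam) eps (pcrIter c₁ (kappa A lam) eps)) + 1 : ℝ) ≤
      projConst p₁ c₁ c₂ * ((gam ^ 2)⁻¹ * (1 + Real.log (kappa A lam / eps))) := by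
  obtain ⟨⟨h1, h2⟩, -⟩ := tolerances_mem C G heps heps1
  have h3 := projIter_le (gam := gam) C.p₁_ge h1 h2
  have h4 := log_div_pos G.kappa_gt heps heps1
  have hg := one_le_inv_sq G
  obtain ⟨hp₁, hc₁, hp₂, hc₂⟩ := C
  have h5 := log_one_div_pcrTol_le hc₁ (by linarith) G.kappa_gt heps heps1
  have h6 := mul_le_mul_of_nonneg_left h5 (show 0 ≤ p₁ * (gam ^ 2)⁻¹ by positivity)
  have h7 : 1 ≤ (gam ^ 2)⁻¹ * (1 + Real.log (kappa A lam / eps)) := by nlinarith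
  rw [projConst]
  nlinarith

theorem Routine.costBound_nonneg {R : Routine d} {T : ℝ → ℝ → ℝ} (hT : CostBound R T) {e δ : ℝ}
    (he : 0 < e) (he1 : e < 1) (hδ : 0 < δ) (hδ1 : δ < 1) : 0 ≤ T e δ := by
  obtain ⟨o, ho⟩ := (R e δ 0).support_nonempty
  exact (Nat.cast_nonneg _).trans (hT e δ he he1 hδ hδ1 0 o ho)

theorem runPCR_uses (C : GoodConstants p₁ p₂ c₁ c₂) (G : Gapped A lam gam) (heps : 0 < eps)
    (heps1 : eps < 1) (hdel : 0 < del) (hdel1 : del < 1) (R : Routine d) (b : Fin n → ℝ)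
    (T : ℝ → ℝ → ℝ) {K : ℝ} (hK : timeConst p₁ c₁ c₂ ≤ K) :
    ∀ o ∈ (runPCR p₁ p₂ c₁ c₂ R A lam b gam eps del).support,
      o.2.projCalls = 1 ∧
      (o.2.ridgeCalls .pcr : ℝ) ≤ K * (1 + Real.log (kappa A lam / eps)) ∧
      (o.2.ridgeCalls .proj : ℝ) ≤
        K * ((gam ^ 2)⁻¹ * (1 + Real.log (kappa A lam / eps))) ∧
      (CostBound R T →
        (o.2.time : ℝ) ≤ K * (1 + Real.log (kappa A lam / eps)) *
          ((T (pcrTol c₂ (kappa A lam) eps (pcrIter c₁ (kappa A lam) eps))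
              (pcrFail (pcrIter c₁ (kappa A lam) eps) del) + inputSize A) +
            (gam ^ 2)⁻¹ * (T (projTol p₂ (kappa A lam) gam
                (pcrTol c₂ (kappa A lam) eps (pcrIter c₁ (kappa A lam) eps)))
              (projFail (projIter p₁ gam
                (pcrTol c₂ (kappa A lam) eps (pcrIter c₁ (kappa A lam) eps))) (del / 2)) +
                  inputSize A))) := by
  obtain ⟨⟨h1, h2⟩, h3, h4⟩ := tolerances_mem C G heps heps1
  have hq := pcrIter_succ_le C G heps heps1
  have hQ := two_mul_projIter_succ_le C G heps heps1
  have hL := log_div_pos G.kappa_gt heps heps1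
  have hg := one_le_inv_sq G
  have hc₁ := C.c₁_ge
  have hconst : 0 ≤ projConst p₁ c₁ c₂ := by
    obtain ⟨hp₁, hc₁, hp₂, hc₂⟩ := C
    have : 0 < c₂ := by linarith
    rw [projConst]
    positivity
  set q := pcrIter c₁ (kappa A lam) eps
  set e := pcrTol c₂ (kappa A lam) eps q
  obtain ⟨h5, h6⟩ := pcrFail_mem hdel hdel1 q
  obtain ⟨h7, h8⟩ := projFail_mem (del := del / 2) (by linarith) (by linarith)
    (projIter p₁ gam e)
  -- Taking the cost bound as `P` makes only the time estimate conditional on it, not the call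
  -- counts.
  have hu := uses_ridgePCR (P := CostBound R T) (p₁ := p₁) (p₂ := p₂) (c₁ := c₁) (c₂ := c₂)
    (R := R) (A := A) (lam := lam) (b := b) (gam := gam) (eps := eps) (del := del)
    (fun hT y o ho => hT _ _ h1 h2 h5 h6 y o ho)
    (fun z => uses_pcProj (fun hT y o ho => hT _ _ h3 h4 h7 h8 y o ho) z)
  rw [show pcrIter c₁ (kappa A lam) eps = q from rfl] at hu
  set e' := projTol p₂ (kappa A lam) gam e
  set δ' := pcrFail q del
  set δ'' := projFail (projIter p₁ gam e) (del / 2)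
  set Q := projIter p₁ gam e
  set L := Real.log (kappa A lam / eps)
  intro o ho
  obtain ⟨u1, u2, u3, u4⟩ := hu Tally.zero o ho
  simp only [Tally.zero, zero_add] at u1 u2 u3 u4
  have hK1 : c₁ + 2 ≤ K := by rw [timeConst] at hK; linarith
  have hK2 : projConst p₁ c₁ c₂ ≤ K := by rw [timeConst] at hK; linarith
  refine ⟨u1, ?_, ?_, fun hT => ?_⟩
  · rw [u2]
    push_cast
    exact hq.trans (mul_le_mul_of_nonneg_right hK1 (by linarith))
  · rw [u3]
    push_cast
    exact hQ.trans (mul_le_mul_of_nonneg_right hK2 (by positivity))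
  · have hT1 := Routine.costBound_nonneg hT h1 h2 h5 h6
    have hT2 := Routine.costBound_nonneg hT h3 h4 h7 h8
    refine (u4 hT).trans ?_
    rw [Nat.cast_zero, zero_add]
    set T₁ := T e δ'
    set T₂ := T e' δ''
    -- A positive dimension makes the input size at least 1, so it absorbs all additive constants.
    have hd : (1 : ℝ) ≤ d := by exact_mod_cast G.dim_pos
    have hn : (0 : ℝ) ≤ n := Nat.cast_nonneg n
    have hz : (0 : ℝ) ≤ nnz A := Nat.cast_nonneg _
    have hN : (inputSize A : ℝ) = nnz A + n + d := by
      rw [inputSize]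
      push_cast
      ring
    set N : ℝ := (inputSize A : ℝ)
    have hN1 : 1 ≤ N := by linarith
    have hQ0 : (0 : ℝ) ≤ Q := Nat.cast_nonneg Q
    have hq0 : (0 : ℝ) ≤ q := Nat.cast_nonneg q
    set G₂ := (gam ^ 2)⁻¹
    calc _ ≤ 50 * ((q + 1) * (T₁ + N)) + 25 * ((2 * Q + 1) * (T₂ + N)) := by
          have b1 : Q * (4 * nnz A + 2 * n + 5 * d + 18 + 2 * T₂) ≤ Q * (25 * N + 2 * T₂) :=
            mul_le_mul_of_nonneg_left (by linarith) hQ0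
          have b2 : q * (d + 2 + T₁) ≤ q * (3 * N + T₁) :=
            mul_le_mul_of_nonneg_left (by linarith) hq0
          have b3 : 0 ≤ q * T₁ := by positivity
          have b4 : 0 ≤ q * N := by positivity
          have b5 : 0 ≤ Q * T₂ := by positivity
          have b6 : 0 ≤ Q * N := by positivity
          linarith
      _ ≤ 50 * ((c₁ + 2) * (1 + L) * (T₁ + N)) +
          25 * (projConst p₁ c₁ c₂ * (G₂ * (1 + L)) * (T₂ + N)) := by
          have b1 := mul_le_mul_of_nonneg_right hq (show 0 ≤ T₁ + N by linarith)
          have b2 := mul_le_mul_of_nonneg_right hQ (show 0 ≤ T₂ + N by linarith)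
          linarith
      _ = 50 * (c₁ + 2) * ((1 + L) * (T₁ + N)) +
          25 * projConst p₁ c₁ c₂ * ((1 + L) * (G₂ * (T₂ + N))) := by ring
      _ ≤ K * ((1 + L) * (T₁ + N)) + K * ((1 + L) * (G₂ * (T₂ + N))) := by
          rw [timeConst] at hK
          refine add_le_add (mul_le_mul_of_nonneg_right (by linarith) (by positivity))
            (mul_le_mul_of_nonneg_right (by linarith) (by positivity))
      _ = _ := by ring

end

/-! ### The heavy ball method -/

/-- The residual polynomials of the heavy ball method, shifted by one:
`c` is the linear coefficient and `β` the momentum. -/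
def heavyBall (c β : ℝ) : ℕ → ℝ
  | 0 => 1
  | 1 => 1
  | k + 2 => c * heavyBall c β (k + 1) - β * heavyBall c β k

/-- Each step of the recurrence multiplies this quadratic form by r². It replaces the closed form
with complex roots. -/
theorem heavyBall_energy (c r : ℝ) : ∀ k,
    heavyBall c (r ^ 2) (k + 1) ^ 2 - c * heavyBall c (r ^ 2) k * heavyBall c (r ^ 2) (k + 1) +
      r ^ 2 * heavyBall c (r ^ 2) k ^ 2 = r ^ (2 * k) * (1 - c + r ^ 2)
  | 0 => by simp [heavyBall]
  | k + 1 => by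
    have ih := heavyBall_energy c r k
    rw [heavyBall]
    linear_combination r ^ 2 * ih

/-- For |c| ≤ 2r the form is (y - cx/2)² plus a nonnegative multiple of x², so |y - cx/2| ≤
r^{k+1}(1 + r). Then |y| ≤ r|x| + r^{k+1}(1 + r), and the induction produces the linear factor
typical of a double root. -/
theorem abs_heavyBall_le {c r : ℝ} (hr : 0 ≤ r) (hc : |c| ≤ 2 * r) : ∀ k,
    |heavyBall c (r ^ 2) (k + 1)| ≤ r ^ k * (r + (k + 1) * (1 + r))
  | 0 => by
    simp [heavyBall]
    linarith
  | k + 1 => by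
    have ih := abs_heavyBall_le hr hc k
    have hE := heavyBall_energy c r (k + 1)
    set x := heavyBall c (r ^ 2) (k + 1)
    set y := heavyBall c (r ^ 2) (k + 1 + 1)
    have hc2 : c ^ 2 ≤ (2 * r) ^ 2 := by
      rw [← sq_abs c]
      exact pow_le_pow_left₀ (abs_nonneg _) hc 2
    have h1 : (y - c / 2 * x) ^ 2 ≤ (r ^ (k + 1) * (1 + r)) ^ 2 := by
      have h2 : 1 - c + r ^ 2 ≤ (1 + r) ^ 2 := by
        have := (abs_le.1 hc).1
        nlinarith
      have h3 := mul_le_mul_of_nonneg_left h2 (show 0 ≤ r ^ (2 * (k + 1)) by positivity)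
      have h4 : (r ^ (k + 1) * (1 + r)) ^ 2 = r ^ (2 * (k + 1)) * (1 + r) ^ 2 := by ring
      rw [h4]
      nlinarith [mul_nonneg (sub_nonneg.2 hc2) (sq_nonneg x)]
    have h2 := abs_le_of_sq_le_sq h1 (by positivity)
    have h3 : |c / 2 * x| ≤ r * |x| := by
      rw [abs_mul]
      refine mul_le_mul_of_nonneg_right ?_ (abs_nonneg _)
      rw [abs_div, abs_two]
      linarith
    have h4 : |y| ≤ |y - c / 2 * x| + |c / 2 * x| := by
      have := abs_add_le (y - c / 2 * x) (c / 2 * x)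
      rwa [sub_add_cancel] at this
    have h5 := mul_le_mul_of_nonneg_left ih hr
    have h6 : |y - c / 2 * x| ≤ r ^ (k + 1) * (1 + r) := h2
    calc |y| ≤ r ^ (k + 1) * (1 + r) + r * (r ^ k * (r + (k + 1) * (1 + r))) := by linarith
      _ = _ := by
        push_cast
        ring

/-- The iterates `(x_k, x_{k-1})` of the heavy ball method for `(AᵀA + λ) x = y`. -/
def heavyBallIter (A : Matrix (Fin n) (Fin d) ℝ) (lam al be : ℝ) (y : Fin d → ℝ) :
    ℕ → (Fin d → ℝ) × (Fin d → ℝ)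
  | 0 => (0, 0)
  | k + 1 =>
    let x := heavyBallIter A lam al be y k
    ((1 + be - al * lam) • x.1 + (-be) • x.2 + (al • y + (-al) • (Aᵀ *ᵥ (A *ᵥ x.1))), x.1)

/-- The residual of x_k is the polynomial with index k + 1 applied to the exact solution. The start
x₀ = x₋₁ = 0 corresponds to the two initial values 1. -/
theorem gramCoord_heavyBallIter {A : Matrix (Fin n) (Fin d) ℝ} {lam al be : ℝ} {y : Fin d → ℝ}
    (hlam : 0 < lam) (i : Fin d) : ∀ k,
      gramCoord A (heavyBallIter A lam al be y k).1 i =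
        (1 - heavyBall (1 + be - al * (gramEig A i + lam)) be (k + 1)) *
          ((gramEig A i + lam)⁻¹ * gramCoord A y i) ∧
      gramCoord A (heavyBallIter A lam al be y k).2 i =
        (1 - heavyBall (1 + be - al * (gramEig A i + lam)) be k) *
          ((gramEig A i + lam)⁻¹ * gramCoord A y i)
  | 0 => by
    have h0 : gramCoord A 0 i = 0 := by simp [gramCoord]
    simp [heavyBallIter, heavyBall, h0]
  | k + 1 => by
    obtain ⟨ih1, ih2⟩ := gramCoord_heavyBallIter (al := al) (be := be) (y := y) hlam i k
    refine ⟨?_, ih1⟩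
    have hi := ridgeEig_pos (A := A) hlam i
    simp only [heavyBallIter, gramCoord_add, gramCoord_smul, Matrix.mulVec_mulVec, gramCoord_gram,
      ih1, ih2, heavyBall]
    field_simp
    ring

theorem ridgeAccurate_heavyBallIter {A : Matrix (Fin n) (Fin d) ℝ} {lam kap h eps : ℝ} {m : ℕ}
    (hlam : 0 < lam) (heig : ∀ i, gramEig A i ≤ kap * lam) (hh : h ^ 2 = kap + 1) (hh1 : 1 ≤ h)
    (heps : 0 < eps) (hm : (h + 1) * Real.log (8 * (h + 1) / eps) ≤ m) (y : Fin d → ℝ) :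
    RidgeAccurate A lam eps y
      (heavyBallIter A lam (4 / (lam * (h + 1) ^ 2)) (((h - 1) / (h + 1)) ^ 2) y m).1 := by
  have hmeps : ((h - 1) / (h + 1)) ^ m * (2 * m + 3) ≤ eps := by
    have h1 : (h - 1) / (h + 1) ≤ Real.exp (-(2 / (h + 1))) := by
      have := Real.add_one_le_exp (-(2 / (h + 1)))
      have h2 : (h - 1) / (h + 1) = -(2 / (h + 1)) + 1 := by
        field_simp
        ring
      linarith
    set u : ℝ := m / (h + 1) with hu
    have hmu : (m : ℝ) = (h + 1) * u := by
      rw [hu]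
      field_simp
    have hu0 : 0 ≤ u := by positivity
    -- Of the two factors exp(-u), one is used to reach ε/(8(h + 1)) and the other to absorb the
    -- linear factor 2u + 3.
    have h2 : ((h - 1) / (h + 1)) ^ m ≤ Real.exp (-u) * Real.exp (-u) := by
      calc _ ≤ Real.exp (-(2 / (h + 1))) ^ m :=
            pow_le_pow_left₀ (div_nonneg (by linarith) (by linarith)) h1 _
        _ = _ := by
          rw [← Real.exp_nat_mul, ← Real.exp_add, hu]
          congr 1
          field_simp
          ring
    have h3 : Real.log (8 * (h + 1) / eps) ≤ u := by
      rw [hmu] at hm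
      exact le_of_mul_le_mul_left hm (by linarith)
    have h4 : Real.exp (-u) ≤ eps / (8 * (h + 1)) := by
      rw [Real.exp_neg, inv_le_comm₀ (Real.exp_pos _) (by positivity), inv_div]
      rwa [Real.log_le_iff_le_exp (by positivity)] at h3
    have h5 : Real.exp (-u) * (2 * u + 3) ≤ 3 := by
      rw [Real.exp_neg, inv_mul_le_iff₀ (Real.exp_pos _)]
      linarith [Real.add_one_le_exp u]
    have h6 : 2 * (m : ℝ) + 3 ≤ (h + 1) * (2 * u + 3) := by
      rw [hmu]
      nlinarith
    calc _ ≤ Real.exp (-u) * Real.exp (-u) * ((h + 1) * (2 * u + 3)) :=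
          mul_le_mul h2 h6 (by positivity) (by positivity)
      _ = (h + 1) * Real.exp (-u) * (Real.exp (-u) * (2 * u + 3)) := by ring
      _ ≤ (h + 1) * Real.exp (-u) * 3 := mul_le_mul_of_nonneg_left h5 (by positivity)
      _ ≤ (h + 1) * (eps / (8 * (h + 1))) * 3 := by
          have := mul_le_mul_of_nonneg_left h4 (show 0 ≤ h + 1 by linarith)
          linarith
      _ = 3 / 8 * eps := by field_simp
      _ ≤ eps := by linarith
  set r := (h - 1) / (h + 1) with hr
  have hr0 : 0 ≤ r := div_nonneg (by linarith) (by linarith)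
  have hr1 : r ≤ 1 := by
    rw [hr, div_le_one (by linarith)]
    linarith
  set al := 4 / (lam * (h + 1) ^ 2) with hal
  have hpos : ∀ i, 0 < gramEig A i + lam := fun i => ridgeEig_pos hlam i
  rw [RidgeAccurate, ridgeMat_inv hlam, ridgeMat_eq_gramFun]
  refine matNorm_gramFun_le heps.le (fun i => (hpos i).le) (fun i => (inv_pos.2 (hpos i)).le)
    fun i => ?_
  rw [gramCoord_sub, gramCoord_mulVec, (gramCoord_heavyBallIter hlam i m).1]
  have hi := hpos i
  -- The eigenvalues of M_λ divided by λ lie in [1, h²]. The step size and the momentum are chosen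
  -- so that these two endpoints give exactly 2r and -2r.
  have hc : |1 + r ^ 2 - al * (gramEig A i + lam)| ≤ 2 * r := by
    have h1 : 1 + r ^ 2 - al * (gramEig A i + lam) =
        (2 * h ^ 2 + 2 - 4 * ((gramEig A i + lam) / lam)) / (h + 1) ^ 2 := by
      rw [hr, hal]
      field_simp
      ring
    have h2 : 2 * r = (2 * h ^ 2 - 2) / (h + 1) ^ 2 := by
      rw [hr]
      field_simp
      ring
    have h3 : 1 ≤ (gramEig A i + lam) / lam := by
      rw [one_le_div hlam]
      linarith [gramEig_nonneg A i]
    have h4 : (gramEig A i + lam) / lam ≤ h ^ 2 := by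
      rw [div_le_iff₀ hlam, hh]
      linarith [heig i]
    rw [h1, h2, abs_div, abs_of_pos (a := (h + 1) ^ 2) (by positivity)]
    refine div_le_div_of_nonneg_right ?_ (by positivity)
    rw [abs_le]
    constructor <;> linarith
  have hb := abs_heavyBall_le hr0 hc m
  set p := heavyBall (1 + r ^ 2 - al * (gramEig A i + lam)) (r ^ 2) (m + 1)
  have hp : |p| ≤ eps := by
    refine hb.trans (le_trans (mul_le_mul_of_nonneg_left ?_ (pow_nonneg hr0 m)) hmeps)
    nlinarith [Nat.cast_nonneg (α := ℝ) m]
  have hp2 : p ^ 2 ≤ eps ^ 2 := by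
    rw [← sq_abs p]
    exact pow_le_pow_left₀ (abs_nonneg _) hp 2
  have e1 : (gramEig A i + lam) * ((1 - p) * ((gramEig A i + lam)⁻¹ * gramCoord A y i) -
      (gramEig A i + lam)⁻¹ * gramCoord A y i) ^ 2 =
      p ^ 2 * ((gramEig A i + lam)⁻¹ * gramCoord A y i ^ 2) := by
    field_simp
    ring
  rw [e1]
  exact mul_le_mul_of_nonneg_right hp2 (by positivity)

/-! ### A program for the heavy ball method -/

/-- Compute the step size, the momentum and the number of rounds. -/
def heavyBallSetup : Prog :=
  -- With h = √(κ_λ + 1), the scalar registers receive: 4: the number 1; 5: h; 7: h + 1; 8: the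
  -- momentum β; 9: the step size α; 11: the number of rounds; 12: -α; 14: 1 + β - αλ; 15: -β.
  -- Register 13 is never written and serves as 0.
  .seq (.op (.const 4 1)) <| .seq (.op (.add 5 3 4)) <| .seq (.op (.sqrt 5 5)) <|
  .seq (.op (.sub 6 5 4)) <| .seq (.op (.add 7 5 4)) <| .seq (.op (.div 6 6 7)) <|
  .seq (.op (.mul 8 6 6)) <| .seq (.op (.const 9 4)) <| .seq (.op (.mul 10 7 7)) <|
  .seq (.op (.mul 10 0 10)) <| .seq (.op (.div 9 9 10)) <| .seq (.op (.const 11 8)) <|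
  .seq (.op (.mul 11 11 7)) <| .seq (.op (.div 11 11 1)) <| .seq (.op (.log 11 11)) <|
  .seq (.op (.mul 11 7 11)) <| .seq (.op (.sub 12 13 9)) <| .seq (.op (.add 14 4 8)) <|
  .seq (.op (.mul 10 9 0)) <| .seq (.op (.sub 14 14 10)) (.op (.sub 15 13 8))

/-- One round: the vector registers `1` and `2` hold `x_k` and `x_{k-1}`. -/
def heavyBallRound : Prog :=
  .seq (.op (.mulA 0 1)) <| .seq (.op (.mulAT 3 0)) <| .seq (.op (.lin 3 9 0 12 3)) <|
  .seq (.op (.lin 2 14 1 15 2)) <| .seq (.op (.lin 4 4 2 4 3)) <|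
  .seq (.op (.lin 2 4 1 13 1)) (.op (.lin 1 4 4 13 4))

/-- The deterministic ridge regression program. -/
def heavyBallProg : Prog :=
  .seq heavyBallSetup <| .seq (.loop 11 heavyBallRound) (.op (.lin 0 4 1 13 1))

theorem heavyBallProg_sampleFree : heavyBallProg.SampleFree := by
  simp [heavyBallProg, heavyBallSetup, heavyBallRound, Prog.SampleFree]

theorem iterRounds_pure {f : Store n d → PMF (Store n d)} {I : ℕ → Store n d → Prop}
    (h : ∀ k s, I k s → ∃ s', f (s.wait 1) = PMF.pure s' ∧ I (k + 1) s') :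
    ∀ m k s, I k s → ∃ s', iterRounds f m s = PMF.pure s' ∧ I (k + m) s'
  | 0, k, s, hs => ⟨s, rfl, hs⟩
  | m + 1, k, s, hs => by
    obtain ⟨s', h1, h2⟩ := h k s hs
    obtain ⟨s'', h3, h4⟩ := iterRounds_pure h m (k + 1) s' h2
    refine ⟨s'', ?_, ?_⟩
    · rw [iterRounds, h1, PMF.pure_bind, h3]
    · rwa [show k + (m + 1) = k + 1 + m by ring]

/-- The registers during the iteration. -/
def HeavyBallState (A : Matrix (Fin n) (Fin d) ℝ) (lam al be : ℝ) (y : Fin d → ℝ) (t k : ℕ)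
    (s : Store n d) : Prop :=
  s.scal 4 = 1 ∧ s.scal 9 = al ∧ s.scal 12 = -al ∧ s.scal 13 = 0 ∧
    s.scal 14 = 1 + be - al * lam ∧ s.scal 15 = -be ∧ s.vec 0 = y ∧
    s.vec 1 = (heavyBallIter A lam al be y k).1 ∧ s.vec 2 = (heavyBallIter A lam al be y k).2 ∧
    s.time = t + k * (2 * nnz A + n + 6 * d + 8)

theorem heavyBallSetup_exec (A : Matrix (Fin n) (Fin d) ℝ) (lam eps del : ℝ) (y : Fin d → ℝ) :
    ∃ s, heavyBallSetup.exec A (initStore A lam eps del y) = PMF.pure s ∧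
      s.scal 11 = (√(kappa A lam + 1) + 1) * Real.log (8 * (√(kappa A lam + 1) + 1) / eps) ∧
      HeavyBallState A lam (4 / (lam * (√(kappa A lam + 1) + 1) ^ 2))
        (((√(kappa A lam + 1) - 1) / (√(kappa A lam + 1) + 1)) ^ 2) y (inputSize A + 21) 0 s := by
  refine ⟨_, by simp only [heavyBallSetup, Prog.exec, Instr.exec, PMF.pure_bind]; rfl, ?_, ?_⟩
  · simp [Store.setScal, initStore]
  · refine ⟨?_, ?_, ?_, ?_, ?_, ?_, ?_, ?_, ?_, ?_⟩ <;>
      simp [Store.setScal, initStore, heavyBallIter] <;> ring_nf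

theorem heavyBallRound_exec {A : Matrix (Fin n) (Fin d) ℝ} {lam al be : ℝ} {y : Fin d → ℝ}
    {t k : ℕ} {s : Store n d} (hs : HeavyBallState A lam al be y t k s) :
    ∃ s', heavyBallRound.exec A (s.wait 1) = PMF.pure s' ∧
      HeavyBallState A lam al be y t (k + 1) s' := by
  obtain ⟨h1, h2, h3, h4, h5, h6, h7, h8, h9, h10⟩ := hs
  refine ⟨_, by simp only [heavyBallRound, Prog.exec, Instr.exec, PMF.pure_bind]; rfl, ?_⟩
  refine ⟨?_, ?_, ?_, ?_, ?_, ?_, ?_, ?_, ?_, ?_⟩ <;>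
    simp [Store.setVec, Store.setVecN, Store.wait, heavyBallIter, h1, h2,
      h3, h4, h5, h6, h7, h8, h9, h10]
  ring

theorem heavyBallProg_exec (A : Matrix (Fin n) (Fin d) ℝ) (lam eps del : ℝ) (y : Fin d → ℝ) :
    ∃ m : ℕ, m = ⌈(√(kappa A lam + 1) + 1) * Real.log (8 * (√(kappa A lam + 1) + 1) / eps)⌉₊ ∧
      heavyBallProg.routine A lam eps del y = PMF.pure
        ((heavyBallIter A lam (4 / (lam * (√(kappa A lam + 1) + 1) ^ 2))
          (((√(kappa A lam + 1) - 1) / (√(kappa A lam + 1) + 1)) ^ 2) y m).1,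
          inputSize A + 22 + m * (2 * nnz A + n + 6 * d + 8) + (d + 1)) := by
  obtain ⟨s, h1, h2, h3⟩ := heavyBallSetup_exec A lam eps del y
  refine ⟨_, rfl, ?_⟩
  rw [← h2]
  set al := 4 / (lam * (√(kappa A lam + 1) + 1) ^ 2)
  set be := ((√(kappa A lam + 1) - 1) / (√(kappa A lam + 1) + 1)) ^ 2
  -- The 21 setup instructions are followed by one step for entering the loop.
  have h4 : HeavyBallState A lam al be y (inputSize A + 22) 0 (s.wait 1) := by
    obtain ⟨g1, g2, g3, g4, g5, g6, g7, g8, g9, g10⟩ := h3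
    refine ⟨g1, g2, g3, g4, g5, g6, g7, g8, g9, ?_⟩
    simp [Store.wait, g10]
  obtain ⟨s', h5, h6⟩ := iterRounds_pure (f := heavyBallRound.exec A)
    (I := HeavyBallState A lam al be y (inputSize A + 22))
    (fun k s hs => heavyBallRound_exec hs) ⌈s.scal 11⌉₊ 0 (s.wait 1) h4
  obtain ⟨g1, g2, g3, g4, g5, g6, g7, g8, g9, g10⟩ := h6
  have h7 : heavyBallProg.exec A (initStore A lam eps del y) =
      PMF.pure (s'.setVec 0 (s'.scal 4 • s'.vec 1 + s'.scal 13 • s'.vec 1) (d + 1)) := by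
    rw [heavyBallProg, Prog.exec, h1, PMF.pure_bind, Prog.exec, Prog.exec, h5, PMF.pure_bind]
    rfl
  rw [Prog.routine, h7, PMF.pure_map]
  simp [Store.setVec, g1, g4, g8, g10]

/-! ### Expectations -/

/-- The expectation of a nonnegative function. -/
def expect {α : Type} (p : PMF α) (f : α → ENNReal) : ENNReal := ∑' a, p a * f a

theorem expect_pure {α : Type} (a : α) (f : α → ENNReal) : expect (PMF.pure a) f = f a := by
  rw [expect, tsum_eq_single a]
  · simp
  · intro b hb
    simp [hb]

theorem expect_bind {α β : Type} (p : PMF α) (q : α → PMF β) (f : β → ENNReal) :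
    expect (p.bind q) f = expect p fun a => expect (q a) f := by
  simp only [expect, PMF.bind_apply, ← ENNReal.tsum_mul_right, ← ENNReal.tsum_mul_left]
  rw [ENNReal.tsum_comm]
  simp only [mul_assoc]

theorem expect_map {α β : Type} (p : PMF α) (g : α → β) (f : β → ENNReal) :
    expect (p.map g) f = expect p fun a => f (g a) := by
  change expect (p.bind fun a => PMF.pure (g a)) f = _
  rw [expect_bind]
  simp only [expect_pure]

theorem expect_mono {α : Type} {p : PMF α} {f g : α → ENNReal} (h : ∀ a ∈ p.support, f a ≤ g a) :
    expect p f ≤ expect p g := by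
  refine ENNReal.tsum_le_tsum fun a => ?_
  by_cases ha : p a = 0
  · simp [ha]
  · exact mul_le_mul_right (h a ((p.mem_support_iff a).2 ha)) _

theorem expect_const_mul {α : Type} (p : PMF α) (c : ENNReal) (f : α → ENNReal) :
    expect p (fun a => c * f a) = c * expect p f := by
  simp only [expect, ← ENNReal.tsum_mul_left]
  exact tsum_congr fun a => by ring

/-- Markov's inequality, in multiplied form to avoid division in `ENNReal`. -/
theorem toOuterMeasure_mul_le_expect {α : Type} (p : PMF α) (f : α → ENNReal) (s : Set α)
    (c : ENNReal) (h : ∀ a ∈ s, c ≤ f a) : p.toOuterMeasure s * c ≤ expect p f := by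
  rw [PMF.toOuterMeasure_apply, ← ENNReal.tsum_mul_right]
  refine ENNReal.tsum_le_tsum fun a => ?_
  by_cases ha : a ∈ s
  · rw [Set.indicator_of_mem ha]
    exact mul_le_mul_right (h a ha) _
  · simp [Set.indicator_of_notMem ha]

theorem toOuterMeasure_eq_zero_of_expect {α : Type} {p : PMF α} {f : α → ENNReal}
    (hf : expect p f = 0) {s : Set α} (h : ∀ a ∈ s, f a ≠ 0) : p.toOuterMeasure s = 0 := by
  rw [PMF.toOuterMeasure_apply_eq_zero_iff, Set.disjoint_left]
  intro a ha has
  rw [expect, ENNReal.tsum_eq_zero] at hf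
  rcases mul_eq_zero.1 (hf a) with h1 | h1
  · exact (p.mem_support_iff a).1 ha h1
  · exact h a has h1

theorem frobSq_eq (A : Matrix (Fin n) (Fin d) ℝ) : frobSq A = ∑ i, A i ⬝ᵥ A i := by
  simp [frobSq, dotProduct, sq]

theorem expect_rowLaw {A : Matrix (Fin n) (Fin d) ℝ} (hA : 0 < frobSq A) {g : (Fin d → ℝ) → ℝ}
    (hg : ∀ a, 0 ≤ g a) :
    expect (rowLaw A) (fun a => ENNReal.ofReal (g a)) =
      ENNReal.ofReal ((frobSq A)⁻¹ * ∑ i, (A i ⬝ᵥ A i) * g (A i)) := by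
  have hw : ∀ i, 0 ≤ A i ⬝ᵥ A i := fun i => by
    rw [← norm2_sq]
    positivity
  have hrw : ∀ i, rowWeight A i = ENNReal.ofReal (A i ⬝ᵥ A i) := fun i => by
    simp [rowWeight, dotProduct, sq]
  have hsum : ∑' i, rowWeight A i = ENNReal.ofReal (frobSq A) := by
    rw [tsum_fintype, frobSq_eq, ENNReal.ofReal_sum_of_nonneg fun i _ => hw i]
    exact Finset.sum_congr rfl fun i _ => hrw i
  have hne : ∑' i, rowWeight A i ≠ 0 := by
    rw [hsum]
    simpa using hA
  rw [rowLaw, dif_pos hne, expect_map, expect, tsum_fintype, Finset.mul_sum,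
    ENNReal.ofReal_sum_of_nonneg fun i _ => by have := hw i; have := hg (A i); positivity]
  refine Finset.sum_congr rfl fun i _ => ?_
  rw [PMF.normalize_apply, hsum, hrw, ← ENNReal.ofReal_inv_of_pos hA,
    ← ENNReal.ofReal_mul (hw i), ← ENNReal.ofReal_mul (mul_nonneg (hw i) (by positivity))]
  congr 1
  ring

/-- A supermartingale argument: `I` holds on every possible run, and the potential, which may depend
on the round, does not increase in expectation. -/
theorem iterRounds_invariant {f : Store n d → PMF (Store n d)} {I : ℕ → Store n d → Prop}
    {Φ : ℕ → Store n d → ENNReal} {M : ℕ}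
    (h : ∀ k < M, ∀ s, I k s → (∀ s' ∈ (f (s.wait 1)).support, I (k + 1) s') ∧
      expect (f (s.wait 1)) (Φ (k + 1)) ≤ Φ k s) :
    ∀ m k, k + m = M → ∀ s, I k s → (∀ s' ∈ (iterRounds f m s).support, I M s') ∧
      expect (iterRounds f m s) (Φ M) ≤ Φ k s
  | 0, k, hk, s, hs => by
    rw [add_zero] at hk
    subst hk
    refine ⟨fun s' hs' => ?_, ?_⟩
    · rw [iterRounds, PMF.support_pure, Set.mem_singleton_iff] at hs'
      rwa [hs']
    · rw [iterRounds, expect_pure]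
  | m + 1, k, hk, s, hs => by
    obtain ⟨h1, h2⟩ := h k (by omega) s hs
    have ih := fun s' hs' => iterRounds_invariant h m (k + 1) (by omega) s' (h1 s' hs')
    refine ⟨fun s' hs' => ?_, ?_⟩
    · rw [iterRounds, PMF.mem_support_bind_iff] at hs'
      obtain ⟨s'', h3, h4⟩ := hs'
      exact (ih s'' h3).1 s' h4
    · rw [iterRounds, expect_bind]
      exact (expect_mono fun s' hs' => (ih s' hs').2).trans h2

/-! ### Variance reduced stochastic gradient descent -/

/-- One stochastic step: `w` is the displacement from the anchor, `g` the gradient at the anchor and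
`a` the sampled row. -/
def svrgStep (lam F : ℝ) (g w a : Fin d → ℝ) : Fin d → ℝ :=
  ((1 - 1 / (8 * F) * lam) • w + (-(1 / (8 * F))) • g) + ((a ⬝ᵥ w) / (a ⬝ᵥ a) * (-1 / 8)) • a

/-- The weights make the sampled step an unbiased gradient step of size η = 1/(8F) for the error w +
e₀. Per eigenvalue μ + λ, contraction contributes -1/4 + 1/32 and the variance at most 1/32, in
total -3/16. The variance also leaves 1/32 for e₀. -/
theorem sum_svrgStep_le {A : Matrix (Fin n) (Fin d) ℝ} {lam : ℝ} (hlam : 0 < lam)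
    (hF : 0 < frobSq A) (heig : ∀ i, gramEig A i ≤ frobSq A) (hlamF : lam ≤ frobSq A)
    (w e₀ : Fin d → ℝ) :
    ∑ i, (A i ⬝ᵥ A i) * norm2 (svrgStep lam (frobSq A) (ridgeMat A lam *ᵥ e₀) w (A i) + e₀) ^ 2 ≤
      frobSq A * norm2 (w + e₀) ^ 2 - 3 / 16 * matNorm (ridgeMat A lam) (w + e₀) ^ 2 +
        1 / 32 * matNorm (ridgeMat A lam) e₀ ^ 2 := by
  set F := frobSq A with hFdef
  set η := 1 / (8 * F) with hη
  set v := w + e₀ - η • (lam • w + ridgeMat A lam *ᵥ e₀) with hv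
  have hstep : ∀ a : Fin d → ℝ, (a ⬝ᵥ a) * norm2 (svrgStep lam F (ridgeMat A lam *ᵥ e₀) w a + e₀) ^ 2
      = (a ⬝ᵥ a) * norm2 v ^ 2 - 1 / 4 * ((a ⬝ᵥ w) * (a ⬝ᵥ v)) + 1 / 64 * (a ⬝ᵥ w) ^ 2 := by
    intro a
    have h1 : svrgStep lam F (ridgeMat A lam *ᵥ e₀) w a + e₀ =
        v - ((a ⬝ᵥ w) / (a ⬝ᵥ a) * (1 / 8)) • a := by
      rw [svrgStep, hv, ← hη]
      module
    rw [h1, norm2_sq, norm2_sq]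
    simp only [sub_dotProduct, dotProduct_sub, smul_dotProduct, dotProduct_smul, smul_eq_mul,
      dotProduct_comm v a]
    -- For a zero row the step divides by zero, but its weight vanishes.
    by_cases ha : a ⬝ᵥ a = 0
    · have : a = 0 := dotProduct_self_eq_zero.1 ha
      simp [this]
    · field_simp
      ring
  have hAA : ∀ x y : Fin d → ℝ, ∑ i, (A i ⬝ᵥ x) * (A i ⬝ᵥ y) = ((Aᵀ * A) *ᵥ x) ⬝ᵥ y := fun x y => by
    rw [← Matrix.mulVec_mulVec, dotProduct_comm, Matrix.dotProduct_mulVec, Matrix.vecMul_transpose,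
      dotProduct_comm]
    rfl
  simp only [hstep, Finset.sum_add_distrib, Finset.sum_sub_distrib, ← Finset.mul_sum,
    ← Finset.sum_mul, ← frobSq_eq, hAA, sq (_ ⬝ᵥ w)]
  have hFη : F * η = 1 / 8 := by
    rw [hη]
    field_simp
  -- Completing the square, with Fη = 1/8, exhibits the exact gradient step: v - ηAᵀAw = (I -
  -- ηM_λ)(w + e₀).
  have hsplit : F * norm2 v ^ 2 - 1 / 4 * (((Aᵀ * A) *ᵥ w) ⬝ᵥ v) =
      F * norm2 (v - η • ((Aᵀ * A) *ᵥ w)) ^ 2 -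
        F * η ^ 2 * norm2 ((Aᵀ * A) *ᵥ w) ^ 2 := by
    rw [norm2_sq, norm2_sq, norm2_sq]
    simp only [sub_dotProduct, dotProduct_sub, smul_dotProduct, dotProduct_smul, smul_eq_mul,
      dotProduct_comm v]
    linear_combination 2 * (((Aᵀ * A) *ᵥ w) ⬝ᵥ v) * hFη
  have hAw : ((Aᵀ * A) *ᵥ w) ⬝ᵥ w = ∑ i, gramEig A i * gramCoord A w i ^ 2 := by
    have h1 := matNorm_gramFun_sq (A := A) (g := fun t => t) (gramEig_nonneg A) w
    rw [gramFun_id, gramNorm_eq, norm2_sq, Matrix.dotProduct_mulVec, Matrix.vecMul_mulVec,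
      ← Matrix.dotProduct_mulVec, dotProduct_comm] at h1
    exact h1
  rw [hsplit, hAw, norm2_sq_eq_gramCoord A, norm2_sq_eq_gramCoord A, norm2_sq_eq_gramCoord A,
    ridgeNorm_sq hlam, ridgeNorm_sq hlam, Finset.mul_sum, Finset.mul_sum, Finset.mul_sum,
    Finset.mul_sum, Finset.mul_sum, Finset.mul_sum, ← Finset.sum_sub_distrib,
    ← Finset.sum_add_distrib, ← Finset.sum_sub_distrib, ← Finset.sum_add_distrib]
  refine Finset.sum_le_sum fun i _ => ?_
  rw [hv, ridgeMat_eq_gramFun]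
  simp only [gramCoord_sub, gramCoord_add, gramCoord_smul, gramCoord_gram, gramCoord_mulVec]
  have h0 := gramEig_nonneg A i
  have h1 := heig i
  generalize gramEig A i = μ at *
  generalize gramCoord A w i = x at *
  generalize gramCoord A e₀ i = z at *
  have e1 : x + z - η * (lam * x + (μ + lam) * z) - η * (μ * x) =
      (1 - η * (μ + lam)) * (x + z) := by ring
  rw [e1]
  have e2 : F * ((1 - η * (μ + lam)) * (x + z)) ^ 2 = F * (x + z) ^ 2 -
      1 / 4 * (μ + lam) * (x + z) ^ 2 + 1 / 8 * η * (μ + lam) ^ 2 * (x + z) ^ 2 := by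
    linear_combination (-2 * (μ + lam) * (x + z) ^ 2 + η * (μ + lam) ^ 2 * (x + z) ^ 2) * hFη
  rw [e2]
  have hη0 : 0 < η := by positivity
  have h2 : η * (μ + lam) ≤ 1 / 4 := by nlinarith
  have h3 : 1 / 8 * η * (μ + lam) ^ 2 * (x + z) ^ 2 ≤ 1 / 32 * ((μ + lam) * (x + z) ^ 2) := by
    have := mul_le_mul_of_nonneg_right h2 (show 0 ≤ (μ + lam) * (x + z) ^ 2 by positivity)
    linarith
  -- The variance is controlled through x = (x + z) - z, so it is small when both the current point
  -- and the anchor are near the solution.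
  have h4 : μ * x ^ 2 ≤ 2 * ((μ + lam) * (x + z) ^ 2) + 2 * ((μ + lam) * z ^ 2) := by
    have h5 : x ^ 2 ≤ 2 * (x + z) ^ 2 + 2 * z ^ 2 := by nlinarith [sq_nonneg (x + 2 * z)]
    have h6 := mul_le_mul_of_nonneg_left h5 h0
    have h7 : 0 ≤ lam * (2 * (x + z) ^ 2 + 2 * z ^ 2) := by positivity
    linarith
  have h8 : 0 ≤ F * η ^ 2 * (μ * x) ^ 2 := by positivity
  linarith

/-- The potential of the inner loop after `t` of `m` steps. -/
def svrgPotential (A : Matrix (Fin n) (Fin d) ℝ) (lam : ℝ) (m : ℕ) (e₀ : Fin d → ℝ) (t : ℕ)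
    (w S : Fin d → ℝ) : ℝ :=
  matNorm (ridgeMat A lam) (S + (t : ℝ) • e₀) ^ 2 / t + 16 / 3 * frobSq A * norm2 (w + e₀) ^ 2 +
    ((m : ℝ) - t) / 6 * matNorm (ridgeMat A lam) e₀ ^ 2

theorem svrgPotential_nonneg {A : Matrix (Fin n) (Fin d) ℝ} {lam : ℝ} (hF : 0 < frobSq A) {m t : ℕ}
    (ht : t ≤ m) (e₀ w S : Fin d → ℝ) : 0 ≤ svrgPotential A lam m e₀ t w S := by
  have : (t : ℝ) ≤ m := by exact_mod_cast ht
  have := sub_nonneg.2 this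
  rw [svrgPotential]
  positivity

theorem ridgeNorm_add_sq_div_le {A : Matrix (Fin n) (Fin d) ℝ} {lam : ℝ} (hlam : 0 < lam) (t : ℕ)
    {x y : Fin d → ℝ} (h : t = 0 → x = 0) :
    matNorm (ridgeMat A lam) (x + y) ^ 2 / ((t + 1 : ℕ) : ℝ) ≤
      matNorm (ridgeMat A lam) x ^ 2 / t + matNorm (ridgeMat A lam) y ^ 2 := by
  -- At t = 0 the quotient by `t` is 0 by convention, so the estimate relies on x = 0 there.
  rcases Nat.eq_zero_or_pos t with ht | ht
  · rw [h ht, ht]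
    simp
  · have ht' : (0 : ℝ) < t := by exact_mod_cast ht
    have h1 := ridgeNorm_add_le (A := A) hlam x y
    have h2 := pow_le_pow_left₀ (matNorm_nonneg _ _) h1 2
    set P := matNorm (ridgeMat A lam) x
    set Q := matNorm (ridgeMat A lam) y
    have h3 : (P + Q) ^ 2 / ((t + 1 : ℕ) : ℝ) ≤ P ^ 2 / t + Q ^ 2 := by
      rw [div_add' _ _ _ ht'.ne', div_le_div_iff₀ (by positivity) ht']
      push_cast
      nlinarith [sq_nonneg (P - t * Q)]
    exact (div_le_div_of_nonneg_right h2 (by positivity)).trans h3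

/-- The first term is t times the squared error of the average, and by convexity it grows by at most
the squared M_λ-norm of w + e₀. The weight 16/3 turns the gain 3/16 into exactly this amount and the
loss 1/32 into 1/6, which the last term of the potential pays back. -/
theorem expect_svrgPotential_le {A : Matrix (Fin n) (Fin d) ℝ} {lam : ℝ} (hlam : 0 < lam)
    (hF : 0 < frobSq A) (heig : ∀ i, gramEig A i ≤ frobSq A) (hlamF : lam ≤ frobSq A) {m t : ℕ}
    (ht : t < m) (w e₀ S : Fin d → ℝ) (hS : t = 0 → S = 0) :
    expect (rowLaw A) (fun a => ENNReal.ofReal (svrgPotential A lam m e₀ (t + 1)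
      (svrgStep lam (frobSq A) (ridgeMat A lam *ᵥ e₀) w a) (S + w))) ≤
      ENNReal.ofReal (svrgPotential A lam m e₀ t w S) := by
  rw [expect_rowLaw hF fun a => svrgPotential_nonneg hF ht e₀ _ _]
  apply ENNReal.ofReal_le_ofReal
  rw [inv_mul_le_iff₀ hF]
  have h1 := sum_svrgStep_le hlam hF heig hlamF w e₀
  have h2 := ridgeNorm_add_sq_div_le (A := A) hlam t (x := S + (t : ℝ) • e₀) (y := w + e₀)
    fun h => by rw [hS h, h]; simp
  have e1 : S + (t : ℝ) • e₀ + (w + e₀) = S + w + ((t + 1 : ℕ) : ℝ) • e₀ := by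
    push_cast
    module
  rw [e1] at h2
  simp only [svrgPotential, mul_add, Finset.sum_add_distrib, ← Finset.sum_mul, ← frobSq_eq]
  have e2 : ∑ i, (A i ⬝ᵥ A i) * (16 / 3 * frobSq A *
      norm2 (svrgStep lam (frobSq A) (ridgeMat A lam *ᵥ e₀) w (A i) + e₀) ^ 2) =
      16 / 3 * frobSq A * ∑ i, (A i ⬝ᵥ A i) *
        norm2 (svrgStep lam (frobSq A) (ridgeMat A lam *ᵥ e₀) w (A i) + e₀) ^ 2 := by
    rw [Finset.mul_sum]
    exact Finset.sum_congr rfl fun i _ => by ring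
  rw [e2]
  have h3 := mul_le_mul_of_nonneg_left h1 (show 0 ≤ 16 / 3 * frobSq A by positivity)
  have h4 := mul_le_mul_of_nonneg_left h2 hF.le
  push_cast at h4 ⊢
  nlinarith

/-! ### A program for variance reduced stochastic gradient descent -/

/-- Compute the step size and the numbers of rounds. -/
def svrgSetup : Prog :=
  -- With F = ‖A‖_F², register 5 receives F, 6 the length 16F/λ of an epoch, 7 the number -1/(8F),
  -- 14 the number 1 - λ/(8F), and 17 the number of epochs before rounding up. Register 9 is
  -- scratch, and 13 stays 0.
  .seq (.op (.const 4 1)) <| .seq (.op (.frob 5)) <| .seq (.op (.const 9 16)) <|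
  .seq (.op (.mul 9 9 5)) <| .seq (.op (.div 6 9 0)) <| .seq (.op (.const 9 8)) <|
  .seq (.op (.mul 9 9 5)) <| .seq (.op (.div 9 4 9)) <| .seq (.op (.sub 7 13 9)) <|
  .seq (.op (.mul 9 9 0)) <| .seq (.op (.sub 14 4 9)) <| .seq (.op (.const 12 (-1 / 8))) <|
  .seq (.op (.const 16 (-1))) <| .seq (.op (.mul 9 1 1)) <| .seq (.op (.mul 9 9 2)) <|
  .seq (.op (.div 9 4 9)) <| .seq (.op (.log 9 9)) <| .seq (.op (.const 17 2))
  (.op (.mul 17 17 9))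

/-- The deterministic part of a stochastic step; the sampled row is in the vector register `5`. -/
def svrgUpdate : Prog :=
  -- Vector register 3 holds the displacement and 4 the sum of displacements. The sum is updated
  -- before the displacement moves, so the average starts with the anchor itself.
  .seq (.op (.dot 10 5 5)) <| .seq (.op (.dot 11 5 3)) <| .seq (.op (.div 11 11 10)) <|
  .seq (.op (.mul 11 11 12)) <| .seq (.op (.lin 4 4 4 4 3)) <| .seq (.op (.lin 3 14 3 7 2)) <|
  .seq (.op (.lin 3 4 3 11 5)) (.op (.add 8 8 4))

/-- Compute the gradient at the anchor (vector register `1`) and reset the inner loop. -/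
def svrgAnchor : Prog :=
  .seq (.op (.mulA 0 1)) <| .seq (.op (.mulAT 2 0)) <| .seq (.op (.lin 2 4 2 0 1)) <|
  .seq (.op (.lin 2 4 2 16 0)) <| .seq (.op (.lin 3 13 3 13 3)) <|
  .seq (.op (.lin 4 13 4 13 4)) (.op (.sub 8 8 8))

/-- Move the anchor to the average of the iterates. -/
def svrgAverage : Prog := .seq (.op (.div 9 4 8)) (.op (.lin 1 4 1 9 4))

/-- One epoch. -/
def svrgEpoch : Prog :=
  .seq svrgAnchor <| .seq (.loop 6 (.seq (.op (.sampleRow 5)) svrgUpdate)) svrgAverage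

/-- The stochastic ridge regression program. -/
def svrgProg : Prog :=
  .seq svrgSetup <| .seq (.loop 17 svrgEpoch) (.op (.lin 0 4 1 13 1))

/-- The registers that do not change after the setup. -/
def SvrgConst (A : Matrix (Fin n) (Fin d) ℝ) (lam : ℝ) (y : Fin d → ℝ) (s : Store n d) : Prop :=
  s.scal 0 = lam ∧ s.scal 4 = 1 ∧ s.scal 6 = 16 * frobSq A / lam ∧
    s.scal 7 = -(1 / (8 * frobSq A)) ∧ s.scal 12 = -1 / 8 ∧ s.scal 13 = 0 ∧
    s.scal 14 = 1 - 1 / (8 * frobSq A) * lam ∧ s.scal 16 = -1 ∧ s.vec 0 = y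

theorem svrgSetup_exec (A : Matrix (Fin n) (Fin d) ℝ) (lam eps del : ℝ) (y : Fin d → ℝ) :
    ∃ s, svrgSetup.exec A (initStore A lam eps del y) = PMF.pure s ∧
      s.scal 17 = 2 * Real.log (1 / (eps * eps * del)) ∧ SvrgConst A lam y s ∧ s.vec 1 = 0 ∧
      s.time = inputSize A + nnz A + 19 := by
  refine ⟨_, by simp only [svrgSetup, Prog.exec, Instr.exec, PMF.pure_bind]; rfl, ?_, ?_, ?_, ?_⟩
  · simp [Store.setScal, initStore]
  · refine ⟨?_, ?_, ?_, ?_, ?_, ?_, ?_, ?_, ?_⟩ <;> simp [Store.setScal, initStore]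
  · simp [Store.setScal, initStore]
  · simp [Store.setScal, initStore]
    ring

/-- The registers during an epoch with anchor `x₀`, after `t` stochastic steps. -/
def SvrgInner (A : Matrix (Fin n) (Fin d) ℝ) (lam : ℝ) (y x₀ g : Fin d → ℝ) (τ t : ℕ)
    (s : Store n d) : Prop :=
  SvrgConst A lam y s ∧ s.vec 1 = x₀ ∧ s.vec 2 = g ∧ s.scal 8 = t ∧ (t = 0 → s.vec 4 = 0) ∧
    s.time = τ + t * (6 * d + 10)

theorem svrgAnchor_exec {A : Matrix (Fin n) (Fin d) ℝ} {lam : ℝ} {y : Fin d → ℝ} {s : Store n d}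
    (hs : SvrgConst A lam y s) :
    ∃ s', svrgAnchor.exec A (s.wait 1) = PMF.pure s' ∧
      SvrgInner A lam y (s.vec 1) (ridgeMat A lam *ᵥ s.vec 1 - y)
        (s.time + (2 * nnz A + n + 5 * d + 8)) 0 s' ∧ s'.vec 3 = 0 := by
  obtain ⟨h1, h2, h3, h4, h5, h6, h7, h8, h9⟩ := hs
  refine ⟨_, by simp only [svrgAnchor, Prog.exec, Instr.exec, PMF.pure_bind]; rfl,
    ⟨⟨?_, ?_, ?_, ?_, ?_, ?_, ?_, ?_, ?_⟩, ?_, ?_, ?_, ?_, ?_⟩, ?_⟩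
  all_goals simp [Store.setVec, Store.setVecN, Store.setScal, Store.wait, h1, h2, h3, h4, h5, h6,
    h7, h8, h9]
  · rw [ridgeMat, Matrix.add_mulVec, Matrix.smul_mulVec, Matrix.one_mulVec, sub_eq_add_neg]
  · ring

theorem svrgUpdate_exec {A : Matrix (Fin n) (Fin d) ℝ} {lam : ℝ} {y x₀ g : Fin d → ℝ} {τ t : ℕ}
    {s : Store n d} (hs : SvrgInner A lam y x₀ g τ t s) (a : Fin d → ℝ) :
    ∃ s', svrgUpdate.exec A ((s.wait 1).setVec 5 a (d + 1)) = PMF.pure s' ∧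
      SvrgInner A lam y x₀ g τ (t + 1) s' ∧ s'.vec 3 = svrgStep lam (frobSq A) g (s.vec 3) a ∧
      s'.vec 4 = s.vec 4 + s.vec 3 := by
  obtain ⟨⟨h1, h2, h3, h4, h5, h6, h7, h8, h9⟩, h10, h11, h12, h13, h14⟩ := hs
  refine ⟨_, by simp only [svrgUpdate, Prog.exec, Instr.exec, PMF.pure_bind]; rfl,
    ⟨⟨?_, ?_, ?_, ?_, ?_, ?_, ?_, ?_, ?_⟩, ?_, ?_, ?_, ?_, ?_⟩, ?_, ?_⟩
  all_goals simp [Store.setVec, Store.setScal, Store.wait, svrgStep, h1, h2, h3, h4, h5, h6, h7, h8,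
    h9, h10, h11, h12, h14]
  ring

theorem svrgAverage_exec {A : Matrix (Fin n) (Fin d) ℝ} {lam : ℝ} {y x₀ g : Fin d → ℝ} {τ t : ℕ}
    {s : Store n d} (hs : SvrgInner A lam y x₀ g τ t s) :
    ∃ s', svrgAverage.exec A s = PMF.pure s' ∧ SvrgConst A lam y s' ∧
      s'.vec 1 = x₀ + (1 / (t : ℝ)) • s.vec 4 ∧ s'.time = τ + t * (6 * d + 10) + (d + 2) := by
  obtain ⟨⟨h1, h2, h3, h4, h5, h6, h7, h8, h9⟩, h10, h11, h12, h13, h14⟩ := hs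
  refine ⟨_, by simp only [svrgAverage, Prog.exec, Instr.exec, PMF.pure_bind]; rfl,
    ⟨?_, ?_, ?_, ?_, ?_, ?_, ?_, ?_, ?_⟩, ?_, ?_⟩
  all_goals simp [Store.setVec, Store.setScal, h1, h2, h3, h4, h5, h6, h7, h8,
    h9, h10, h12, h14]
  ring

/-- The number of stochastic steps in an epoch. -/
def svrgRounds (A : Matrix (Fin n) (Fin d) ℝ) (lam : ℝ) : ℕ := ⌈16 * frobSq A / lam⌉₊

/-- The number of steps of an epoch. -/
def svrgEpochTime (A : Matrix (Fin n) (Fin d) ℝ) (lam : ℝ) : ℕ :=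
  2 * nnz A + n + 6 * d + 11 + svrgRounds A lam * (6 * d + 10)

/-- The potential starts at (16/3)F‖e₀‖² + (m/6)X, where X is the squared M_λ-norm of e₀. Since m ≥
16F/λ and λ‖e₀‖² ≤ X, this is at most mX/2. At the end it dominates m times the squared error of the
average, so the expectation is halved. -/
theorem svrgEpoch_exec {A : Matrix (Fin n) (Fin d) ℝ} {lam : ℝ} (hlam : 0 < lam)
    (hF : 0 < frobSq A) (heig : ∀ i, gramEig A i ≤ frobSq A) (hlamF : lam ≤ frobSq A)
    {x : Fin d → ℝ} {s : Store n d} (hs : SvrgConst A lam (ridgeMat A lam *ᵥ x) s) :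
    (∀ s' ∈ (svrgEpoch.exec A (s.wait 1)).support, SvrgConst A lam (ridgeMat A lam *ᵥ x) s' ∧
      s'.time = s.time + svrgEpochTime A lam) ∧
    2 * expect (svrgEpoch.exec A (s.wait 1))
      (fun s' => ENNReal.ofReal (matNorm (ridgeMat A lam) (s'.vec 1 - x) ^ 2)) ≤
        ENNReal.ofReal (matNorm (ridgeMat A lam) (s.vec 1 - x) ^ 2) := by
  set y := ridgeMat A lam *ᵥ x with hy
  set m := svrgRounds A lam with hm
  obtain ⟨s₁, h1, h2, h3⟩ := svrgAnchor_exec hs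
  set e₀ := s.vec 1 - x with he₀
  set τ := s.time + (2 * nnz A + n + 5 * d + 8) with hτ
  have hg : ridgeMat A lam *ᵥ s.vec 1 - y = ridgeMat A lam *ᵥ e₀ := by
    rw [he₀, Matrix.mulVec_sub]
  rw [hg] at h2
  have h4 : SvrgInner A lam y (s.vec 1) (ridgeMat A lam *ᵥ e₀) (τ + 1) 0 (s₁.wait 1) := by
    obtain ⟨g1, g2, g3, g4, g5, g6⟩ := h2
    exact ⟨g1, g2, g3, g4, g5, by simp [Store.wait, g6]⟩
  have hround : ∀ k < m, ∀ s', SvrgInner A lam y (s.vec 1) (ridgeMat A lam *ᵥ e₀) (τ + 1) k s' →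
      (∀ s'' ∈ ((Prog.seq (.op (.sampleRow 5)) svrgUpdate).exec A (s'.wait 1)).support,
        SvrgInner A lam y (s.vec 1) (ridgeMat A lam *ᵥ e₀) (τ + 1) (k + 1) s'') ∧
      expect ((Prog.seq (.op (.sampleRow 5)) svrgUpdate).exec A (s'.wait 1)) (fun s'' =>
        ENNReal.ofReal (svrgPotential A lam m e₀ (k + 1) (s''.vec 3) (s''.vec 4))) ≤
          ENNReal.ofReal (svrgPotential A lam m e₀ k (s'.vec 3) (s'.vec 4)) := by
    intro k hk s' hs'
    -- After the row is drawn the round is deterministic, so its law is the image of the row law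
    -- under `f`.
    choose f hf1 hf2 hf3 hf4 using svrgUpdate_exec hs'
    have hexec : (Prog.seq (.op (.sampleRow 5)) svrgUpdate).exec A (s'.wait 1) =
        (rowLaw A).map f := by
      rw [Prog.exec, Prog.exec, Instr.exec, PMF.bind_map]
      change _ = (rowLaw A).bind (PMF.pure ∘ f)
      congr 1
      funext a
      exact hf1 a
    rw [hexec]
    constructor
    · intro s'' hs''
      rw [PMF.mem_support_map_iff] at hs''
      obtain ⟨a, -, rfl⟩ := hs''
      exact hf2 a
    · rw [expect_map]
      simp only [hf3, hf4]
      exact expect_svrgPotential_le hlam hF heig hlamF hk _ _ _ hs'.2.2.2.2.1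
  have hloop := iterRounds_invariant (M := m)
    (Φ := fun k s'' => ENNReal.ofReal (svrgPotential A lam m e₀ k (s''.vec 3) (s''.vec 4)))
    hround m 0 (zero_add m) (s₁.wait 1) h4
  have hm6 : ⌈s₁.scal 6⌉₊ = m := by rw [h2.1.2.2.1, hm, svrgRounds]
  have hm1 : 16 * frobSq A / lam ≤ m := Nat.le_ceil _
  have hmpos : (0 : ℝ) < m := lt_of_lt_of_le (by positivity) hm1
  have hexec : svrgEpoch.exec A (s.wait 1) = (iterRounds
      ((Prog.seq (.op (.sampleRow 5)) svrgUpdate).exec A) m (s₁.wait 1)).bind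
        (svrgAverage.exec A) := by
    rw [svrgEpoch, Prog.exec, h1, PMF.pure_bind, Prog.exec, Prog.exec, hm6]
  rw [hexec]
  constructor
  · intro s' hs'
    rw [PMF.mem_support_bind_iff] at hs'
    obtain ⟨s₂, h5, h6⟩ := hs'
    obtain ⟨s₃, h7, h8, h9, h10⟩ := svrgAverage_exec (hloop.1 s₂ h5)
    rw [h7, PMF.support_pure, Set.mem_singleton_iff] at h6
    subst h6
    refine ⟨h8, ?_⟩
    rw [h10, hτ, svrgEpochTime]
    ring
  · rw [expect_bind]
    have h5 : ∀ s₂ ∈ (iterRounds ((Prog.seq (.op (.sampleRow 5)) svrgUpdate).exec A) m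
        (s₁.wait 1)).support, expect (svrgAverage.exec A s₂)
          (fun s' => ENNReal.ofReal (matNorm (ridgeMat A lam) (s'.vec 1 - x) ^ 2)) ≤
        ENNReal.ofReal (1 / m) *
          ENNReal.ofReal (svrgPotential A lam m e₀ m (s₂.vec 3) (s₂.vec 4)) := by
      intro s₂ hs₂
      obtain ⟨s₃, h7, -, h9, -⟩ := svrgAverage_exec (hloop.1 s₂ hs₂)
      rw [h7, expect_pure, h9, ← ENNReal.ofReal_mul (by positivity)]
      apply ENNReal.ofReal_le_ofReal
      have e1 : s.vec 1 + (1 / (m : ℝ)) • s₂.vec 4 - x =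
          (1 / (m : ℝ)) • (s₂.vec 4 + (m : ℝ) • e₀) := by
        rw [smul_add, smul_smul, one_div_mul_cancel hmpos.ne', one_smul, he₀]
        abel
      rw [e1, ridgeNorm_smul hlam, svrgPotential, abs_of_pos (by positivity), mul_pow]
      have e2 : (1 / (m : ℝ)) ^ 2 * matNorm (ridgeMat A lam) (s₂.vec 4 + (m : ℝ) • e₀) ^ 2 =
          1 / m * (matNorm (ridgeMat A lam) (s₂.vec 4 + (m : ℝ) • e₀) ^ 2 / m) := by
        field_simp
      rw [e2]
      refine mul_le_mul_of_nonneg_left ?_ (by positivity)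
      rw [sub_self, zero_div, zero_mul, add_zero]
      have : 0 ≤ 16 / 3 * frobSq A * norm2 (s₂.vec 3 + e₀) ^ 2 := by positivity
      linarith
    have h6 := (expect_mono h5).trans (le_of_eq (expect_const_mul _ _ _))
    have h7 := h6.trans (mul_le_mul_right hloop.2 _)
    have h8 := mul_le_mul_right h7 (2 : ENNReal)
    refine h8.trans ?_
    rw [show (2 : ENNReal) = ENNReal.ofReal 2 by simp, ← ENNReal.ofReal_mul (by positivity),
      ← ENNReal.ofReal_mul zero_le_two]
    apply ENNReal.ofReal_le_ofReal
    have e1 : (s₁.wait 1).vec 3 = 0 := h3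
    have e2 : (s₁.wait 1).vec 4 = 0 := h4.2.2.2.2.1 rfl
    have e3 : matNorm (ridgeMat A lam) 0 = 0 := by simp [matNorm]
    rw [e1, e2, svrgPotential]
    simp only [Nat.cast_zero, zero_smul, add_zero, zero_add, e3, sub_zero]
    have h9 : lam * norm2 e₀ ^ 2 ≤ matNorm (ridgeMat A lam) e₀ ^ 2 := by
      rw [ridgeNorm_sq hlam, norm2_sq_eq_gramCoord A, Finset.mul_sum]
      refine Finset.sum_le_sum fun i _ => mul_le_mul_of_nonneg_right ?_ (sq_nonneg _)
      linarith [gramEig_nonneg A i]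
    set X := matNorm (ridgeMat A lam) e₀ ^ 2
    have hX : 0 ≤ X := sq_nonneg _
    have h10 : 16 / 3 * frobSq A * norm2 e₀ ^ 2 ≤ m / 3 * X := by
      rw [div_le_iff₀ hlam] at hm1
      calc 16 / 3 * frobSq A * norm2 e₀ ^ 2 ≤ (m * lam) / 3 * norm2 e₀ ^ 2 :=
            mul_le_mul_of_nonneg_right (by linarith) (sq_nonneg _)
        _ = m / 3 * (lam * norm2 e₀ ^ 2) := by ring
        _ ≤ _ := mul_le_mul_of_nonneg_left h9 (by positivity)
    have h11 : 2 * (1 / m * (16 / 3 * frobSq A * norm2 e₀ ^ 2 + m / 6 * X)) ≤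
        2 * (1 / m * (m / 3 * X + m / 6 * X)) :=
      mul_le_mul_of_nonneg_left (mul_le_mul_of_nonneg_left (by linarith) (by positivity))
        zero_le_two
    have h12 : 2 * (1 / m * (m / 3 * X + m / 6 * X)) = X := by
      field_simp
      ring
    simpa using h11.trans h12.le

/-- The number of epochs. -/
def svrgEpochs (eps del : ℝ) : ℕ := ⌈2 * Real.log (1 / (eps * eps * del))⌉₊

/-- The right-hand side is given as M_λ x so that errors can refer to the solution. The first anchor
is 0, which makes the initial error ‖x‖, and the factor 2^k makes the potential nonincreasing over
epochs. -/
theorem svrgProg_exec {A : Matrix (Fin n) (Fin d) ℝ} {lam : ℝ} (hlam : 0 < lam)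
    (hF : 0 < frobSq A) (heig : ∀ i, gramEig A i ≤ frobSq A) (hlamF : lam ≤ frobSq A)
    (eps del : ℝ) (x : Fin d → ℝ) :
    (∀ o ∈ (svrgProg.routine A lam eps del (ridgeMat A lam *ᵥ x)).support,
      o.2 = inputSize A + nnz A + 20 + svrgEpochs eps del * svrgEpochTime A lam + (d + 1)) ∧
    2 ^ svrgEpochs eps del * expect (svrgProg.routine A lam eps del (ridgeMat A lam *ᵥ x))
      (fun o => ENNReal.ofReal (matNorm (ridgeMat A lam) (o.1 - x) ^ 2)) ≤
        ENNReal.ofReal (matNorm (ridgeMat A lam) x ^ 2) := by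
  set y := ridgeMat A lam *ᵥ x with hy
  set J := svrgEpochs eps del with hJ
  obtain ⟨s₁, h1, h2, h3, h4, h5⟩ := svrgSetup_exec A lam eps del y
  have hJ17 : ⌈s₁.scal 17⌉₊ = J := by rw [h2, hJ, svrgEpochs]
  set I : ℕ → Store n d → Prop := fun k s => SvrgConst A lam y s ∧
    s.time = inputSize A + nnz A + 20 + k * svrgEpochTime A lam with hI
  have hloop := iterRounds_invariant (f := svrgEpoch.exec A) (M := J) (I := I)
    (Φ := fun k s => 2 ^ k * ENNReal.ofReal (matNorm (ridgeMat A lam) (s.vec 1 - x) ^ 2))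
    (fun k _ s hs => by
      obtain ⟨g1, g2⟩ := svrgEpoch_exec hlam hF heig hlamF hs.1
      refine ⟨fun s' hs' => ⟨(g1 s' hs').1, ?_⟩, ?_⟩
      · rw [(g1 s' hs').2, hs.2]
        ring
      · rw [expect_const_mul, pow_succ, mul_assoc]
        exact mul_le_mul_right g2 _) J 0 (zero_add J) (s₁.wait 1)
    ⟨h3, by simp [Store.wait, h5]⟩
  have hexec : svrgProg.routine A lam eps del y = (iterRounds (svrgEpoch.exec A) J
      (s₁.wait 1)).map fun s => (s.scal 4 • s.vec 1 + s.scal 13 • s.vec 1, s.time + (d + 1)) := by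
    rw [Prog.routine, svrgProg, Prog.exec, h1, PMF.pure_bind, Prog.exec, Prog.exec, hJ17,
      PMF.map_bind]
    change _ = PMF.bind _ (PMF.pure ∘ _)
    congr 1
    funext s
    rw [Prog.exec, Instr.exec, PMF.pure_map]
    simp [Store.setVec]
  rw [hexec]
  constructor
  · intro o ho
    rw [PMF.mem_support_map_iff] at ho
    obtain ⟨s, hs, rfl⟩ := ho
    rw [(hloop.1 s hs).2]
  · rw [expect_map, ← expect_const_mul]
    refine le_trans (expect_mono fun s hs => ?_) (hloop.2.trans ?_)
    · obtain ⟨g1, g2, g3, g4, g5, g6, g7⟩ := (hloop.1 s hs).1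
      simp [g2, g6]
    · have e1 : (s₁.wait 1).vec 1 = 0 := h4
      rw [e1, pow_zero, one_mul, zero_sub, ← neg_one_smul ℝ, ridgeNorm_smul hlam]
      simp

/-! ### The two programs as ridge regression routines -/

section

variable {p₁ p₂ c₁ c₂ : ℝ} {A : Matrix (Fin n) (Fin d) ℝ} {lam gam eps del : ℝ}

theorem cast_inputSize (A : Matrix (Fin n) (Fin d) ℝ) : (inputSize A : ℝ) = nnz A + n + d := by
  rw [inputSize]
  push_cast
  ring

theorem heavyBallProg_sureRidgeSpec (G : Gapped A lam gam) :
    SureRidgeSpec A lam (heavyBallProg.routine A lam) := by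
  intro e δ he _ _ _ y o ho
  obtain ⟨m, hm, hexec⟩ := heavyBallProg_exec A lam e δ y
  have hk := G.kappa_gt
  rw [hexec, PMF.mem_support_pure_iff] at ho
  rw [ho]
  exact ridgeAccurate_heavyBallIter G.lam_pos G.eig_le (Real.sq_sqrt (by linarith))
    (Real.one_le_sqrt.2 (by linarith)) he (hm ▸ Nat.le_ceil _) y

theorem heavyBallProg_costBound (G : Gapped A lam gam) :
    CostBound (heavyBallProg.routine A lam) fun e _ =>
      1100 * (inputSize A * √(kappa A lam)) * (1 + Real.log (kappa A lam / e)) := by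
  intro e δ he he1 _ _ y o ho
  obtain ⟨m, hm, hexec⟩ := heavyBallProg_exec A lam e δ y
  rw [hexec, PMF.mem_support_pure_iff] at ho
  rw [ho]
  dsimp only
  have hk := G.kappa_gt
  have hL := log_div_pos hk he he1
  have hd : (1 : ℝ) ≤ d := by exact_mod_cast G.dim_pos
  have hn : (0 : ℝ) ≤ n := Nat.cast_nonneg n
  have hz : (0 : ℝ) ≤ nnz A := Nat.cast_nonneg _
  have hN := cast_inputSize A
  set N : ℝ := (inputSize A : ℝ)
  have hN1 : 1 ≤ N := by linarith
  set r := √(kappa A lam) with hr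
  have hr1 : 1 ≤ r := Real.one_le_sqrt.2 hk.le
  have hr2 : r ^ 2 = kappa A lam := Real.sq_sqrt (by linarith)
  -- κ_λ > 1 allows the shifted quantity to be compared with √κ_λ alone.
  have hh : √(kappa A lam + 1) + 1 ≤ 3 * r := by
    have : √(kappa A lam + 1) ≤ 2 * r := Real.sqrt_le_iff.2 ⟨by linarith, by nlinarith⟩
    linarith
  set h := √(kappa A lam + 1) + 1 with hh'
  have hh0 : 1 ≤ h := by
    have := Real.sqrt_nonneg (kappa A lam + 1)
    linarith
  have hlog : Real.log (8 * h / e) ≤ 23 + Real.log (kappa A lam / e) := by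
    calc Real.log (8 * h / e) ≤ Real.log (24 * (kappa A lam / e)) := by
          refine Real.log_le_log (by positivity) ?_
          rw [← mul_div_assoc]
          exact div_le_div_of_nonneg_right (by nlinarith) he.le
      _ = Real.log 24 + Real.log (kappa A lam / e) :=
          Real.log_mul (by norm_num) (by positivity)
      _ ≤ _ := by linarith [Real.log_le_sub_one_of_pos (show (0 : ℝ) < 24 by norm_num)]
  have hlog0 : 0 ≤ Real.log (8 * h / e) := Real.log_nonneg ((one_le_div he).2 (by linarith))
  set L := Real.log (kappa A lam / e)
  have hm' : (m : ℝ) ≤ 3 * r * (23 + L) + 1 := by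
    rw [hm]
    refine (Nat.ceil_lt_add_one (by positivity)).le.trans ?_
    have := mul_le_mul hh hlog hlog0 (by linarith)
    linarith
  push_cast
  have hNr : 1 ≤ N * r := one_le_mul_of_one_le_of_one_le hN1 hr1
  have hNr' : N ≤ N * r := le_mul_of_one_le_right (by linarith) hr1
  have b1 : (m : ℝ) * (2 * nnz A + n + 6 * d + 8) ≤ (3 * r * (23 + L) + 1) * (14 * N) :=
    mul_le_mul hm' (by linarith) (by positivity) (by positivity)
  have b2 : 0 ≤ N * r * L := by positivity
  nlinarith

theorem ridgeMat_mulVec_inv (hlam : 0 < lam) (y : Fin d → ℝ) :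
    ridgeMat A lam *ᵥ ((ridgeMat A lam)⁻¹ *ᵥ y) = y := by
  rw [Matrix.mulVec_mulVec, ridgeMat_inv hlam, ridgeMat_eq_gramFun, gramFun_mul,
    gramFun_congr (g := fun _ => 1) fun i => mul_inv_cancel₀ (ridgeEig_pos hlam i).ne',
    ← one_eq_gramFun, Matrix.one_mulVec]

theorem svrgProg_ridgeSpec (G : Gapped A lam gam) : RidgeSpec A lam (svrgProg.routine A lam) := by
  intro e δ he he1 hδ hδ1 y
  have hlam := G.lam_pos
  have hlamF : lam ≤ frobSq A :=
    (le_mul_of_one_le_left hlam.le G.kappa_gt.le).trans G.le_frobSq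
  have hF : 0 < frobSq A := hlam.trans_le hlamF
  set x := (ridgeMat A lam)⁻¹ *ᵥ y with hx
  have hy : ridgeMat A lam *ᵥ x = y := ridgeMat_mulVec_inv hlam y
  obtain ⟨-, hexp⟩ := svrgProg_exec hlam hF (fun i => (G.eig_le i).trans G.le_frobSq) hlamF e δ x
  rw [hy] at hexp
  set p := svrgProg.routine A lam e δ y
  set J := svrgEpochs e δ with hJ
  have hdual : matNorm (ridgeMat A lam)⁻¹ y = matNorm (ridgeMat A lam) x := by
    rw [ridgeDualNorm_eq hlam, hx, ridgeMat_inv hlam]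
  set X := matNorm (ridgeMat A lam) x with hX
  have hX0 : 0 ≤ X := matNorm_nonneg _ _
  set f : (Fin d → ℝ) × ℕ → ENNReal := fun o =>
    ENNReal.ofReal (matNorm (ridgeMat A lam) (o.1 - x) ^ 2)
  refine PMF.le_toOuterMeasure_of_compl hδ.le ?_
  have hbad : ∀ o ∈ {o : (Fin d → ℝ) × ℕ | RidgeAccurate A lam e y o.1}ᶜ,
      e * X < matNorm (ridgeMat A lam) (o.1 - x) := by
    intro o ho
    rw [← hdual]
    exact not_le.1 ho
  -- If the solution is zero, the accuracy demanded is exact and Markov's inequality says nothing.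
  -- Then the expected error itself vanishes, so the answer is exact on every possible run.
  rcases hX0.eq_or_lt with hX1 | hX1
  · have h0 : expect p f = 0 := by
      rw [← hX1] at hexp
      simpa using hexp
    rw [toOuterMeasure_eq_zero_of_expect h0]
    · exact zero_le
    · intro o ho
      have := hbad o ho
      rw [← hX1, mul_zero] at this
      exact (ENNReal.ofReal_pos.2 (by positivity)).ne'
  · have hmarkov := toOuterMeasure_mul_le_expect p f
      {o : (Fin d → ℝ) × ℕ | RidgeAccurate A lam e y o.1}ᶜ (ENNReal.ofReal ((e * X) ^ 2))
      fun o ho => ENNReal.ofReal_le_ofReal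
        (pow_le_pow_left₀ (by positivity) (hbad o ho).le 2)
    set P := p.toOuterMeasure {o : (Fin d → ℝ) × ℕ | RidgeAccurate A lam e y o.1}ᶜ
    -- As 2 log 2 > 1, twice log(1/(e²δ)) halvings bring the initial squared error below δe² times
    -- itself.
    have hpow : 1 ≤ δ * (2 ^ J * e ^ 2) := by
      have h1 : 2 * Real.log (1 / (e * e * δ)) ≤ J := Nat.le_ceil _
      have h2 : 1 / 2 < Real.log 2 := by linarith [Real.log_two_gt_d9]
      have h3 : 0 ≤ Real.log (1 / (e * e * δ)) := by
        refine Real.log_nonneg ((one_le_div (by positivity)).2 ?_)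
        exact mul_le_one₀ (mul_le_one₀ he1.le he.le he1.le) hδ.le hδ1.le
      have h4 : 1 / (e * e * δ) ≤ 2 ^ J := by
        rw [← Real.log_le_log_iff (by positivity) (by positivity), Real.log_pow]
        nlinarith
      rw [div_le_iff₀ (by positivity)] at h4
      linarith
    have h5 : P * ENNReal.ofReal (2 ^ J * (e * X) ^ 2) ≤ ENNReal.ofReal (X ^ 2) := by
      refine le_trans ?_ hexp
      rw [ENNReal.ofReal_mul (by positivity), ENNReal.ofReal_pow zero_le_two,
        ENNReal.ofReal_ofNat, mul_left_comm]
      exact mul_le_mul_right hmarkov _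
    have h6 : ENNReal.ofReal (X ^ 2) ≤
        ENNReal.ofReal δ * ENNReal.ofReal (2 ^ J * (e * X) ^ 2) := by
      rw [← ENNReal.ofReal_mul hδ.le]
      refine ENNReal.ofReal_le_ofReal ?_
      have := mul_le_mul_of_nonneg_right hpow (sq_nonneg X)
      linarith
    exact (ENNReal.mul_le_mul_iff_left (ENNReal.ofReal_pos.2 (by positivity)).ne'
      ENNReal.ofReal_ne_top).1 (h5.trans h6)

/-- σ₁² cancels, and it is nonzero because κ_λ > 1. This rewrites the epoch length in terms of the
stable rank. -/
theorem stableRank_mul_kappa (G : Gapped A lam gam) :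
    stableRank A * kappa A lam = frobSq A / lam := by
  have h1 := G.kappa_gt
  have h2 : sigma A 1 ^ 2 ≠ 0 := by
    intro h
    rw [kappa, h, zero_div] at h1
    linarith
  rw [stableRank, kappa, div_mul_div_cancel₀ h2]

theorem svrgProg_costBound (G : Gapped A lam gam) :
    CostBound (svrgProg.routine A lam) fun e δ =>
      800 * (inputSize A + d * stableRank A * kappa A lam) *
        (1 + (2 * Real.log (1 / e) + Real.log (1 / δ))) := by
  intro e δ he he1 hδ hδ1 y o ho
  have hlam := G.lam_pos
  have hlamF : lam ≤ frobSq A :=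
    (le_mul_of_one_le_left hlam.le G.kappa_gt.le).trans G.le_frobSq
  have hF : 0 < frobSq A := hlam.trans_le hlamF
  have hy : ridgeMat A lam *ᵥ ((ridgeMat A lam)⁻¹ *ᵥ y) = y := ridgeMat_mulVec_inv hlam y
  obtain ⟨htime, -⟩ := svrgProg_exec hlam hF (fun i => (G.eig_le i).trans G.le_frobSq) hlamF e δ
    ((ridgeMat A lam)⁻¹ *ᵥ y)
  rw [hy] at htime
  rw [htime o ho, mul_assoc (d : ℝ), stableRank_mul_kappa G]
  have hd : (1 : ℝ) ≤ d := by exact_mod_cast G.dim_pos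
  have hn : (0 : ℝ) ≤ n := Nat.cast_nonneg n
  have hz : (0 : ℝ) ≤ nnz A := Nat.cast_nonneg _
  have hN := cast_inputSize A
  have hlog : 2 * Real.log (1 / e) + Real.log (1 / δ) = Real.log (1 / (e * e * δ)) := by
    simp only [one_div, Real.log_inv, Real.log_mul (mul_ne_zero he.ne' he.ne') hδ.ne',
      Real.log_mul he.ne' he.ne']
    ring
  have hl0 : 0 ≤ Real.log (1 / (e * e * δ)) := by
    refine Real.log_nonneg ((one_le_div (by positivity)).2 ?_)
    exact mul_le_one₀ (mul_le_one₀ he1.le he.le he1.le) hδ.le hδ1.le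
  beta_reduce
  rw [hlog]
  have hJ : (svrgEpochs e δ : ℝ) ≤ 2 * Real.log (1 / (e * e * δ)) + 1 :=
    (Nat.ceil_lt_add_one (by positivity)).le
  set ℓ := Real.log (1 / (e * e * δ))
  have hS : 0 ≤ frobSq A / lam := by positivity
  have hR : (svrgRounds A lam : ℝ) ≤ 16 * (frobSq A / lam) + 1 := by
    rw [← mul_div_assoc]
    exact (Nat.ceil_lt_add_one (by positivity)).le
  set S := frobSq A / lam
  have hE : (svrgEpochTime A lam : ℝ) ≤ 256 * (inputSize A + d * S) := by
    rw [svrgEpochTime]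
    push_cast
    have := mul_le_mul hR (show (6 * d + 10 : ℝ) ≤ 16 * d by linarith) (by positivity)
      (by positivity)
    rw [hN]
    linarith
  push_cast
  have hdS : 0 ≤ d * S := by positivity
  set B : ℝ := inputSize A + d * S with hB
  have b1 : (svrgEpochs e δ : ℝ) * svrgEpochTime A lam ≤ (2 * ℓ + 1) * (256 * B) :=
    mul_le_mul hJ hE (by positivity) (by positivity)
  have hB1 : 1 ≤ B := by linarith
  have b2 : 0 ≤ B * ℓ := by positivity
  linarith

/-! ### The total running times -/

/-- The constant in the bound for the logarithms of the tolerances. -/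
def tolConst (p₂ c₁ c₂ : ℝ) : ℝ := p₂ + 2 * (c₂ + 2 * c₁ + 3) + 3

/-- The constant in the bound for the logarithms of the failure rates. -/
def failConst (p₁ c₁ c₂ : ℝ) : ℝ := 2 * projConst p₁ c₁ c₂ + 2 * c₁ + 5

theorem projConst_pos (C : GoodConstants p₁ p₂ c₁ c₂) : 0 < projConst p₁ c₁ c₂ := by
  obtain ⟨hp₁, hc₁, hp₂, hc₂⟩ := C
  have : 0 < c₂ := by linarith
  rw [projConst]
  positivity

theorem tolConst_pos (C : GoodConstants p₁ p₂ c₁ c₂) : 0 < tolConst p₂ c₁ c₂ := by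
  obtain ⟨hp₁, hc₁, hp₂, hc₂⟩ := C
  rw [tolConst]
  linarith

theorem failConst_pos (C : GoodConstants p₁ p₂ c₁ c₂) : 0 < failConst p₁ c₁ c₂ := by
  have := projConst_pos C
  have := C.c₁_ge
  rw [failConst]
  linarith

theorem timeConst_pos (C : GoodConstants p₁ p₂ c₁ c₂) : 0 < timeConst p₁ c₁ c₂ := by
  have := projConst_pos C
  have := C.c₁_ge
  rw [timeConst]
  linarith

/-- As 1/γ > 4 > e, the logarithm with γ in the denominator absorbs additive constants, and the
bounds for the two programs need no summand 1. -/
theorem one_le_log_one_div (hgam : 0 < gam) (hgam1 : gam < 1 / 4) : 1 ≤ Real.log (1 / gam) := by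
  rw [Real.le_log_iff_exp_le (by positivity), le_div_iff₀ hgam]
  nlinarith [Real.exp_one_lt_d9, Real.exp_pos 1]

theorem log_div_mul_eq {kap : ℝ} (hkap : 0 < kap) (heps : 0 < eps) (hgam : 0 < gam) :
    Real.log (kap / (eps * gam)) = Real.log (kap / eps) + Real.log (1 / gam) := by
  rw [← Real.log_mul (by positivity) (by positivity)]
  congr 1
  field_simp

theorem one_add_log_le (G : Gapped A lam gam) (heps : 0 < eps) :
    1 + Real.log (kappa A lam / eps) ≤ Real.log (kappa A lam / (eps * gam)) := by
  rw [log_div_mul_eq (by linarith [G.kappa_gt]) heps G.gam_pos]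
  linarith [one_le_log_one_div G.gam_pos G.gam_lt]

theorem log_one_div_pcrTol_le_log (C : GoodConstants p₁ p₂ c₁ c₂) (G : Gapped A lam gam)
    (heps : 0 < eps) (heps1 : eps < 1) :
    Real.log (1 / pcrTol c₂ (kappa A lam) eps (pcrIter c₁ (kappa A lam) eps)) ≤
      (c₂ + 2 * c₁ + 3) * Real.log (kappa A lam / (eps * gam)) := by
  obtain ⟨hp₁, hc₁, hp₂, hc₂⟩ := C
  exact (log_one_div_pcrTol_le hc₁ (by linarith) G.kappa_gt heps heps1).trans
    (mul_le_mul_of_nonneg_left (one_add_log_le G heps) (by linarith))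

theorem log_one_div_projTol_le_log (C : GoodConstants p₁ p₂ c₁ c₂) (G : Gapped A lam gam)
    (heps : 0 < eps) (heps1 : eps < 1) :
    Real.log (1 / projTol p₂ (kappa A lam) gam
        (pcrTol c₂ (kappa A lam) eps (pcrIter c₁ (kappa A lam) eps))) ≤
      tolConst p₂ c₁ c₂ * Real.log (kappa A lam / (eps * gam)) := by
  have h1 := log_one_div_pcrTol_le_log C G heps heps1
  obtain ⟨⟨h2, -⟩, -⟩ := tolerances_mem C G heps heps1
  have hk := G.kappa_gt
  have hg := G.gam_pos
  have h3 := one_le_log_one_div G.gam_pos G.gam_lt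
  have h4 := log_div_mul_eq (by linarith) heps hg (kap := kappa A lam)
  have h5 := log_div_pos hk heps heps1
  obtain ⟨hp₁, hc₁, hp₂, hc₂⟩ := C
  have hp₂' : 0 < p₂ := by linarith
  set e := pcrTol c₂ (kappa A lam) eps (pcrIter c₁ (kappa A lam) eps)
  have hs : 0 < √(kappa A lam) := Real.sqrt_pos.2 (by linarith)
  have h6 : 1 / projTol p₂ (kappa A lam) gam e =
      p₂ * ((1 / e) ^ 2 * ((1 / gam) ^ 2 * √(kappa A lam))) := by
    rw [projTol]
    field_simp
  have h7 : Real.log (√(kappa A lam)) ≤ Real.log (kappa A lam / eps) := by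
    refine Real.log_le_log hs ?_
    rw [le_div_iff₀ heps]
    have : √(kappa A lam) ≤ kappa A lam := by
      rw [Real.sqrt_le_left (by linarith)]
      nlinarith
    nlinarith
  have h8 := Real.log_le_sub_one_of_pos hp₂'
  rw [h6, Real.log_mul hp₂'.ne' (by positivity), Real.log_mul (by positivity) (by positivity),
    Real.log_mul (by positivity) (by positivity), Real.log_pow, Real.log_pow, tolConst]
  push_cast
  have h9 : p₂ ≤ p₂ * Real.log (kappa A lam / (eps * gam)) :=
    le_mul_of_one_le_right hp₂'.le (by linarith)
  linarith

theorem log_div_mul_mul_eq {kap : ℝ} (hkap : 0 < kap) (heps : 0 < eps) (hgam : 0 < gam)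
    (hdel : 0 < del) :
    Real.log (kap / (eps * gam * del)) = Real.log (kap / (eps * gam)) + Real.log (1 / del) := by
  rw [← Real.log_mul (by positivity) (by positivity)]
  congr 1
  field_simp

theorem log_one_div_pcrFail_le_log (C : GoodConstants p₁ p₂ c₁ c₂) (G : Gapped A lam gam)
    (heps : 0 < eps) (heps1 : eps < 1) (hdel : 0 < del) (hdel1 : del < 1) :
    Real.log (1 / pcrFail (pcrIter c₁ (kappa A lam) eps) del) ≤
      failConst p₁ c₁ c₂ * Real.log (kappa A lam / (eps * gam * del)) := by
  have hq := pcrIter_succ_le C G heps heps1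
  have h1 := one_add_log_le G heps
  have h2 := log_div_pos G.kappa_gt heps heps1
  have h3 : 0 < Real.log (1 / del) := Real.log_pos ((one_lt_div hdel).2 hdel1)
  have h4 := projConst_pos C
  have hc₁ := C.c₁_ge
  rw [log_div_mul_mul_eq (by linarith [G.kappa_gt]) heps G.gam_pos hdel]
  set q := pcrIter c₁ (kappa A lam) eps
  have h5 : 1 / pcrFail q del = (2 * (q + 1)) * (1 / del) := by
    rw [pcrFail]
    field_simp
  have h6 := Real.log_le_sub_one_of_pos (show (0 : ℝ) < 2 * (q + 1) by positivity)
  rw [h5, Real.log_mul (by positivity) (by positivity), failConst]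
  set Λ := Real.log (kappa A lam / (eps * gam))
  have h7 : (c₁ + 2) * (1 + Real.log (kappa A lam / eps)) ≤ (c₁ + 2) * Λ :=
    mul_le_mul_of_nonneg_left h1 (by linarith)
  have h8 : 0 ≤ projConst p₁ c₁ c₂ * Λ := mul_nonneg h4.le (by linarith)
  have h9 : 0 ≤ projConst p₁ c₁ c₂ * Real.log (1 / del) := by positivity
  have h10 : 0 ≤ c₁ * Real.log (1 / del) := by positivity
  linarith

/-- The number of calls enters only through its logarithm. It is of order γ⁻² times a logarithm, so
it contributes 2 log(1/γ) and an iterated logarithm, bounded by log x ≤ x - 1. -/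
theorem log_one_div_projFail_le_log (C : GoodConstants p₁ p₂ c₁ c₂) (G : Gapped A lam gam)
    (heps : 0 < eps) (heps1 : eps < 1) (hdel : 0 < del) (hdel1 : del < 1) :
    Real.log (1 / projFail (projIter p₁ gam
        (pcrTol c₂ (kappa A lam) eps (pcrIter c₁ (kappa A lam) eps))) (del / 2)) ≤
      failConst p₁ c₁ c₂ * Real.log (kappa A lam / (eps * gam * del)) := by
  have hQ := two_mul_projIter_succ_le C G heps heps1
  have h1 := one_add_log_le G heps
  have h2 := log_div_pos G.kappa_gt heps heps1
  have h3 : 0 < Real.log (1 / del) := Real.log_pos ((one_lt_div hdel).2 hdel1)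
  have h4 := projConst_pos C
  have hc₁ := C.c₁_ge
  have hk : 0 < kappa A lam := by linarith [G.kappa_gt]
  have hg := G.gam_pos
  rw [log_div_mul_mul_eq hk heps hg hdel]
  set Q := projIter p₁ gam (pcrTol c₂ (kappa A lam) eps (pcrIter c₁ (kappa A lam) eps))
  have h5 : 1 / projFail Q (del / 2) = 2 * (2 * Q + 1) * (1 / del) := by
    rw [projFail]
    field_simp
  have h6 : Real.log (2 * (2 * Q + 1)) ≤
      Real.log (2 * projConst p₁ c₁ c₂ * ((1 / gam) ^ 2 *
        (1 + Real.log (kappa A lam / eps)))) := by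
    refine Real.log_le_log (by positivity) ?_
    rw [one_div, inv_pow]
    linarith
  have h7 := Real.log_le_sub_one_of_pos (show 0 < 2 * projConst p₁ c₁ c₂ by positivity)
  have h8 := Real.log_le_sub_one_of_pos (show 0 < 1 + Real.log (kappa A lam / eps) by linarith)
  rw [Real.log_mul (y := (1 / gam) ^ 2 * _) (by positivity) (by positivity),
    Real.log_mul (x := (1 / gam) ^ 2) (by positivity) (by positivity), Real.log_pow] at h6
  push_cast at h6
  rw [h5, Real.log_mul (by positivity) (by positivity), failConst]
  have h9 := log_div_mul_eq hk heps hg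
  set Λ := Real.log (kappa A lam / (eps * gam))
  have h10 : projConst p₁ c₁ c₂ ≤ projConst p₁ c₁ c₂ * Λ :=
    le_mul_of_one_le_right h4.le (by linarith)
  have h11 : 0 ≤ projConst p₁ c₁ c₂ * Real.log (1 / del) := by positivity
  have h12 : 0 ≤ c₁ * Real.log (1 / del) := by positivity
  have h13 : 0 ≤ c₁ * Λ := mul_nonneg (by linarith) (by linarith)
  linarith

/-- The total running time, if each ridge call takes time proportional to `Λ`. -/
theorem runPCR_time_le (C : GoodConstants p₁ p₂ c₁ c₂) (G : Gapped A lam gam) (heps : 0 < eps)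
    (heps1 : eps < 1) (hdel : 0 < del) (hdel1 : del < 1) {R : Routine d} {T : ℝ → ℝ → ℝ}
    (hT : CostBound R T) {M B Λ : ℝ} (hM : 0 ≤ M) (hB : inputSize A ≤ B)
    (hΛ : 1 + Real.log (kappa A lam / eps) ≤ Λ)
    (h₁ : T (pcrTol c₂ (kappa A lam) eps (pcrIter c₁ (kappa A lam) eps))
      (pcrFail (pcrIter c₁ (kappa A lam) eps) del) ≤ M * (B * Λ))
    (h₂ : T (projTol p₂ (kappa A lam) gam
        (pcrTol c₂ (kappa A lam) eps (pcrIter c₁ (kappa A lam) eps)))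
      (projFail (projIter p₁ gam
        (pcrTol c₂ (kappa A lam) eps (pcrIter c₁ (kappa A lam) eps))) (del / 2)) ≤ M * (B * Λ))
    (b : Fin n → ℝ) :
    ∀ o ∈ (runPCR p₁ p₂ c₁ c₂ R A lam b gam eps del).support,
      (o.2.time : ℝ) ≤ 2 * timeConst p₁ c₁ c₂ * (M + 1) * (B * (gam ^ 2)⁻¹ * Λ ^ 2) := by
  intro o ho
  refine ((runPCR_uses C G heps heps1 hdel hdel1 R b T le_rfl o ho).2.2.2 hT).trans ?_
  have hK := timeConst_pos C
  have hg := one_le_inv_sq G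
  have hL := log_div_pos G.kappa_gt heps heps1
  have hN : (0 : ℝ) ≤ inputSize A := Nat.cast_nonneg _
  have hB' : B ≤ B * Λ := le_mul_of_one_le_right (by linarith) (by linarith)
  set D := (M + 1) * (B * Λ) with hD
  have hD0 : 0 ≤ D := mul_nonneg (by linarith) (by linarith)
  set T₁ := T (pcrTol c₂ (kappa A lam) eps (pcrIter c₁ (kappa A lam) eps))
    (pcrFail (pcrIter c₁ (kappa A lam) eps) del)
  set T₂ := T (projTol p₂ (kappa A lam) gam
      (pcrTol c₂ (kappa A lam) eps (pcrIter c₁ (kappa A lam) eps)))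
    (projFail (projIter p₁ gam
      (pcrTol c₂ (kappa A lam) eps (pcrIter c₁ (kappa A lam) eps))) (del / 2))
  set g := (gam ^ 2)⁻¹
  -- The calls of `ridge-pcr` itself do not carry γ⁻². They are bounded by the cost of the
  -- projection because γ⁻² ≥ 1.
  have e₁ : T₁ + inputSize A ≤ g * D := by nlinarith
  have e₂ : g * (T₂ + inputSize A) ≤ g * D :=
    mul_le_mul_of_nonneg_left (by linarith) (by linarith)
  calc timeConst p₁ c₁ c₂ * (1 + Real.log (kappa A lam / eps)) *
        ((T₁ + inputSize A) + g * (T₂ + inputSize A))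
      ≤ timeConst p₁ c₁ c₂ * (1 + Real.log (kappa A lam / eps)) * (2 * (g * D)) :=
        mul_le_mul_of_nonneg_left (by linarith) (mul_nonneg hK.le (by linarith))
    _ ≤ timeConst p₁ c₁ c₂ * Λ * (2 * (g * D)) :=
        mul_le_mul_of_nonneg_right (mul_le_mul_of_nonneg_left hΛ hK.le) (by positivity)
    _ = 2 * timeConst p₁ c₁ c₂ * (M + 1) * (B * g * Λ ^ 2) := by
        rw [hD]
        ring

/-- The constant in the running time with the deterministic program. -/
def detConst (p₁ p₂ c₁ c₂ : ℝ) : ℝ :=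
  2 * timeConst p₁ c₁ c₂ * (1100 * (2 + tolConst p₂ c₁ c₂) + 1)

/-- The constant in the running time with the randomized program. -/
def stoConst (p₁ p₂ c₁ c₂ : ℝ) : ℝ :=
  2 * timeConst p₁ c₁ c₂ * (800 * (1 + 2 * tolConst p₂ c₁ c₂ + failConst p₁ c₁ c₂) + 1)

theorem runPCR_heavyBallProg_time_le (C : GoodConstants p₁ p₂ c₁ c₂) (G : Gapped A lam gam)
    (heps : 0 < eps) (heps1 : eps < 1) (hdel : 0 < del) (hdel1 : del < 1) (b : Fin n → ℝ) :
    ∀ o ∈ (runPCR p₁ p₂ c₁ c₂ (heavyBallProg.routine A lam) A lam b gam eps del).support,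
      (o.2.time : ℝ) ≤ detConst p₁ p₂ c₁ c₂ *
        (inputSize A * √(kappa A lam) * (gam ^ 2)⁻¹ *
          Real.log (kappa A lam / (eps * gam)) ^ 2) := by
  have ht := tolConst_pos C
  have hk := G.kappa_gt
  have hL := one_add_log_le G heps
  have hL0 := log_div_pos hk heps heps1
  obtain ⟨⟨h1, -⟩, h2, -⟩ := tolerances_mem C G heps heps1
  have h3 := log_one_div_pcrTol_le_log C G heps heps1
  have h4 := log_one_div_projTol_le_log C G heps heps1
  have hB : 0 ≤ (inputSize A : ℝ) * √(kappa A lam) := by positivity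
  have hlogk : Real.log (kappa A lam) ≤ Real.log (kappa A lam / eps) :=
    Real.log_le_log (by linarith) (le_div_self (by linarith) heps heps1.le)
  have key : ∀ e, 0 < e →
      Real.log (1 / e) ≤ tolConst p₂ c₁ c₂ * Real.log (kappa A lam / (eps * gam)) →
      1100 * (inputSize A * √(kappa A lam)) * (1 + Real.log (kappa A lam / e)) ≤
        1100 * (2 + tolConst p₂ c₁ c₂) *
          (inputSize A * √(kappa A lam) * Real.log (kappa A lam / (eps * gam))) := by
    intro e he hle
    have h5 : Real.log (kappa A lam / e) = Real.log (kappa A lam) + Real.log (1 / e) := by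
      rw [← Real.log_mul (by linarith) (by positivity), mul_one_div]
    have h6 := mul_le_mul_of_nonneg_left
      (show 1 + Real.log (kappa A lam / e) ≤
        (2 + tolConst p₂ c₁ c₂) * Real.log (kappa A lam / (eps * gam)) by
          rw [h5]
          linarith) hB
    linarith
  refine runPCR_time_le C G heps heps1 hdel hdel1 (heavyBallProg_costBound G) (by positivity)
    (le_mul_of_one_le_right (Nat.cast_nonneg _) (Real.one_le_sqrt.2 hk.le)) hL
    (key _ h1 (h3.trans ?_)) (key _ h2 h4) b
  refine mul_le_mul_of_nonneg_right ?_ (by linarith)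
  obtain ⟨hp₁, hc₁, hp₂, hc₂⟩ := C
  rw [tolConst]
  linarith

theorem runPCR_svrgProg_time_le (C : GoodConstants p₁ p₂ c₁ c₂) (G : Gapped A lam gam)
    (heps : 0 < eps) (heps1 : eps < 1) (hdel : 0 < del) (hdel1 : del < 1) (b : Fin n → ℝ) :
    ∀ o ∈ (runPCR p₁ p₂ c₁ c₂ (svrgProg.routine A lam) A lam b gam eps del).support,
      (o.2.time : ℝ) ≤ stoConst p₁ p₂ c₁ c₂ *
        ((inputSize A + d * stableRank A * kappa A lam) * (gam ^ 2)⁻¹ *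
          Real.log (kappa A lam / (eps * gam * del)) ^ 2) := by
  have ht := tolConst_pos C
  have hf := failConst_pos C
  have hk := G.kappa_gt
  have hL := one_add_log_le G heps
  have hL0 := log_div_pos hk heps heps1
  have hd0 : 0 < Real.log (1 / del) := Real.log_pos ((one_lt_div hdel).2 hdel1)
  have hΛ := log_div_mul_mul_eq (by linarith) heps G.gam_pos hdel (kap := kappa A lam)
  have h3 := log_one_div_pcrTol_le_log C G heps heps1
  have h4 := log_one_div_projTol_le_log C G heps heps1
  have h5 := log_one_div_pcrFail_le_log C G heps heps1 hdel hdel1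
  have h6 := log_one_div_projFail_le_log C G heps heps1 hdel hdel1
  have hS : 0 ≤ d * stableRank A * kappa A lam := by
    have := G.lam_pos
    have := G.le_frobSq
    have : 0 ≤ frobSq A := by nlinarith
    rw [mul_assoc, stableRank_mul_kappa G]
    positivity
  have hN : (0 : ℝ) ≤ inputSize A := Nat.cast_nonneg _
  set B := inputSize A + d * stableRank A * kappa A lam
  have hB : 0 ≤ B := add_nonneg hN hS
  have key : ∀ e δ : ℝ,
      Real.log (1 / e) ≤ tolConst p₂ c₁ c₂ * Real.log (kappa A lam / (eps * gam)) →
      Real.log (1 / δ) ≤ failConst p₁ c₁ c₂ * Real.log (kappa A lam / (eps * gam * del)) →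
      800 * B * (1 + (2 * Real.log (1 / e) + Real.log (1 / δ))) ≤
        800 * (1 + 2 * tolConst p₂ c₁ c₂ + failConst p₁ c₁ c₂) *
          (B * Real.log (kappa A lam / (eps * gam * del))) := by
    intro e δ hle hle'
    have h7 : tolConst p₂ c₁ c₂ * Real.log (kappa A lam / (eps * gam)) ≤
        tolConst p₂ c₁ c₂ * Real.log (kappa A lam / (eps * gam * del)) :=
      mul_le_mul_of_nonneg_left (by linarith) ht.le
    have h8 := mul_le_mul_of_nonneg_left
      (show 1 + (2 * Real.log (1 / e) + Real.log (1 / δ)) ≤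
        (1 + 2 * tolConst p₂ c₁ c₂ + failConst p₁ c₁ c₂) *
          Real.log (kappa A lam / (eps * gam * del)) by linarith) hB
    linarith
  refine runPCR_time_le C G heps heps1 hdel hdel1 (svrgProg_costBound G) (by positivity)
    (by linarith) (by linarith) (key _ _ (h3.trans ?_) h5) (key _ _ h4 h6) b
  refine mul_le_mul_of_nonneg_right ?_ (by linarith)
  obtain ⟨hp₁, hc₁, hp₂, hc₂⟩ := C
  rw [tolConst]
  linarith

end

end RidgePCR

end

/-! ### The main theorem, assembled from the reduction and the two programs -/

theorem mainTheorem2 :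
    ∃ Pdet Psto : RidgePCR.Prog, Pdet.SampleFree ∧
    -- the constants of `pc-proj` are `p₁, p₂`, those of `ridge-pcr` are `c₁, c₂`
    ∃ C₁ : ℝ, 0 < C₁ ∧ ∀ p₁ c₁ : ℝ, C₁ ≤ p₁ → C₁ ≤ c₁ →
    ∃ C₂ : ℝ, 0 < C₂ ∧ ∀ p₂ c₂ : ℝ, C₂ ≤ p₂ → C₂ ≤ c₂ →
    ∃ K : ℝ, 0 < K ∧
    ∀ (n d : ℕ) (A : Matrix (Fin n) (Fin d) ℝ) (b : Fin n → ℝ) (lam gam eps del : ℝ) (k : ℕ),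
      0 < lam → 0 < gam → gam < 1 → 0 < eps → eps < 1 → 0 < del → del < 1 →
      1 ≤ k →
      1 / (1 - 4 * gam) * RidgePCR.sigma A (k + 1) ^ 2 ≤ lam →
      lam ≤ (1 - 4 * gam) * RidgePCR.sigma A k ^ 2 →
      -- the reduction, for every ridge regression routine
      (∀ R : RidgePCR.Routine d, RidgePCR.RidgeSpec A lam R →
        ENNReal.ofReal (1 - del) ≤
          (RidgePCR.runPCR p₁ p₂ c₁ c₂ R A lam b gam eps del).toOuterMeasure
            {o | RidgePCR.matNorm (A.transpose * A)
                  (o.1 - (RidgePCR.pinv (RidgePCR.topPart A lam)).mulVec b) ≤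
                eps * RidgePCR.norm2 b} ∧
        (∀ o ∈ (RidgePCR.runPCR p₁ p₂ c₁ c₂ R A lam b gam eps del).support,
          o.2.projCalls = 1 ∧
          (o.2.ridgeCalls .pcr : ℝ) ≤ K * (1 + Real.log (RidgePCR.kappa A lam / eps)) ∧
          (o.2.ridgeCalls .proj : ℝ) ≤
            K * ((gam ^ 2)⁻¹ * (1 + Real.log (RidgePCR.kappa A lam / eps)))) ∧
        (∀ T : ℝ → ℝ → ℝ, RidgePCR.CostBound R T →
          let q := RidgePCR.pcrIter c₁ (RidgePCR.kappa A lam) eps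
          let eps' := RidgePCR.pcrTol c₂ (RidgePCR.kappa A lam) eps q
          let del' := RidgePCR.pcrFail q del
          let eps'' := RidgePCR.projTol p₂ (RidgePCR.kappa A lam) gam eps'
          let del'' := RidgePCR.projFail (RidgePCR.projIter p₁ gam eps') (del / 2)
          ∀ o ∈ (RidgePCR.runPCR p₁ p₂ c₁ c₂ R A lam b gam eps del).support,
            (o.2.time : ℝ) ≤ K * (1 + Real.log (RidgePCR.kappa A lam / eps)) *
              ((T eps' del' + RidgePCR.inputSize A) +
                (gam ^ 2)⁻¹ * (T eps'' del'' + RidgePCR.inputSize A)))) ∧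
      -- the total running time with a deterministic routine (which never fails)
      (RidgePCR.SureRidgeSpec A lam (Pdet.routine A lam) ∧
        ∀ o ∈ (RidgePCR.runPCR p₁ p₂ c₁ c₂ (Pdet.routine A lam) A lam b gam eps del).support,
          RidgePCR.matNorm (A.transpose * A)
              (o.1 - (RidgePCR.pinv (RidgePCR.topPart A lam)).mulVec b) ≤
            eps * RidgePCR.norm2 b ∧
          (o.2.time : ℝ) ≤
            K * (RidgePCR.inputSize A * √(RidgePCR.kappa A lam) * (gam ^ 2)⁻¹ *
              Real.log (RidgePCR.kappa A lam / (eps * gam)) ^ 2)) ∧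
      -- the total running time with a stochastic routine
      (RidgePCR.RidgeSpec A lam (Psto.routine A lam) ∧
        ∀ o ∈ (RidgePCR.runPCR p₁ p₂ c₁ c₂ (Psto.routine A lam) A lam b gam eps del).support,
          (o.2.time : ℝ) ≤
            K * ((RidgePCR.inputSize A + d * RidgePCR.stableRank A * RidgePCR.kappa A lam) *
              (gam ^ 2)⁻¹ *
              Real.log (RidgePCR.kappa A lam / (eps * gam * del)) ^ 2)) := by
  refine ⟨RidgePCR.heavyBallProg, RidgePCR.svrgProg, RidgePCR.heavyBallProg_sampleFree,
    2, two_pos, fun p₁ c₁ hp₁ hc₁ => ⟨500 * (p₁ + 2), by linarith, fun p₂ c₂ hp₂ hc₂ => ?_⟩⟩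
  have C : RidgePCR.GoodConstants p₁ p₂ c₁ c₂ := ⟨hp₁, hc₁, hp₂, hc₂⟩
  have ht := RidgePCR.timeConst_pos C
  have htol := RidgePCR.tolConst_pos C
  have hfail := RidgePCR.failConst_pos C
  have hdet : 0 < RidgePCR.detConst p₁ p₂ c₁ c₂ := by
    rw [RidgePCR.detConst]
    positivity
  have hsto : 0 < RidgePCR.stoConst p₁ p₂ c₁ c₂ := by
    rw [RidgePCR.stoConst]
    positivity
  -- All three constants are positive, so their sum serves in every bound.
  refine ⟨RidgePCR.timeConst p₁ c₁ c₂ + RidgePCR.detConst p₁ p₂ c₁ c₂ +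
    RidgePCR.stoConst p₁ p₂ c₁ c₂, by linarith, ?_⟩
  intro n d A b lam gam eps del k hlam hgam _ heps heps1 hdel hdel1 hk h1 h2
  have G := RidgePCR.Gapped.of_sigma hlam hgam hk h1 h2
  refine ⟨fun R hR => ?_, ⟨RidgePCR.heavyBallProg_sureRidgeSpec G, fun o ho => ⟨?_, ?_⟩⟩,
    RidgePCR.svrgProg_ridgeSpec G, fun o ho => ?_⟩
  -- The call counts do not involve `T`, so they are read off at `T = 0`.
  · have hu := fun T => RidgePCR.runPCR_uses C G heps heps1 hdel hdel1 R b T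
      (K := RidgePCR.timeConst p₁ c₁ c₂ + RidgePCR.detConst p₁ p₂ c₁ c₂ +
        RidgePCR.stoConst p₁ p₂ c₁ c₂) (by linarith)
    exact ⟨RidgePCR.runPCR_accurate C G heps heps1 hdel hdel1 b hR,
      fun o ho => ⟨(hu 0 o ho).1, (hu 0 o ho).2.1, (hu 0 o ho).2.2.1⟩,
      fun T hT o ho => (hu T o ho).2.2.2 hT⟩
  · exact RidgePCR.runPCR_sure C G heps heps1 hdel hdel1 b
      (RidgePCR.heavyBallProg_sureRidgeSpec G) o ho
  · exact (RidgePCR.runPCR_heavyBallProg_time_le C G heps heps1 hdel hdel1 b o ho).trans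
      (mul_le_mul_of_nonneg_right (by linarith) (by positivity))
  · refine (RidgePCR.runPCR_svrgProg_time_le C G heps heps1 hdel hdel1 b o ho).trans
      (mul_le_mul_of_nonneg_right (by linarith) ?_)
    have hF : 0 ≤ RidgePCR.frobSq A :=
      (mul_nonneg (by linarith [G.kappa_gt]) hlam.le).trans G.le_frobSq
    rw [mul_assoc (d : ℝ), RidgePCR.stableRank_mul_kappa G]
    positivity
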